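/- Let $S$ be a closed oriented polyhedral surface with a geodesic triangulation $T$: $S$ is glued from finitely many flat (planar Euclidean) triangles, the faces of $T$, by identifying their sides in pairs by orientation-reversing isometries of the sides, and $S$ carries the resulting intrinsic piecewise flat metric. (The faces are not required to form a simplicial complex.) For an edge $e$ of $T$ let $\alpha_e,\beta_e$ be the angles opposite to $e$ in the two triangles adjacent to $e$. Assume that $T$ is Delaunay, i.e. $\alpha_e+\beta_e\le\pi$ for each edge $e$, and satisfies condition (D): there is a constant $\mathrm{Const}>0$ such that $\alpha_e+\beta_e<\pi-1/\mathrm{Const}$ for each edge $e$. Then for each face $w$ there is a circumscribed disk: a closed disk $D_w\subset\mathbb{C}$ and a continuous map $g_w\colon D_w\to S$, an orientation-preserving local isometry in the interior of $D_w$, such that $w$ is the isometric image of a triangle inscribed in $D_w$. The image under $g_w$ of the center of $D_w$ is called the circumcenter of $w$, and the images of the three radii of $D_w$ ending at the vertices of that triangle are called the circumradii from the circumcenter to the vertices of $w$. For any such disks, draw the three circumradii of each face from its circumcenter to its vertices. Then the drawn segments have no self-intersections and no two of them have common interior points. They are the edges of a decomposition $Q$ of $S$ into finitely many vertices, open edges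 and open faces, with the following properties. The vertices of $Q$ are the vertices of $T$ (painted black) and the circumcenters of the faces of $T$ (painted white), no point being both, and each edge joins a black vertex to a white one. For each face of $Q$ there are a simple, not necessarily convex, closed quadrilateral in $\mathbb{C}$ and a continuous map of it to $S$ that takes its interior onto the open face injectively, locally isometrically and preserving the orientation, and that maps each side of the quadrilateral onto an edge of $Q$. If moreover $T$ is a simplicial complex (the vertices of each face are distinct, and the faces and the edges are determined by their sets of vertices), then $Q$ is a quad-surface in the strict sense: each of these maps is injective on the closed quadrilateral, so that each closed face of $Q$ is identified with a planar quadrilateral by an orientation-preserving isometry (of intrinsic metrics), and the intersection of any two distinct closed faces of $Q$ is either empty, or a single vertex, or a single edge. -/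

import Mathlib

open Set Metric Topology

namespace PolyhedralSurface

/-- Twice the signed area of the planar triangle `a b c` (positive iff `a b c` is
nondegenerate and counterclockwise). -/
def orient (a b c : ℂ) : ℝ :=
  (b - a).re * (c - a).im - (b - a).im * (c - a).re

/-- The closed planar triangle with vertices `a b c`. -/
def triangle (a b c : ℂ) : Set ℂ := convexHull ℝ {a, b, c}

/-- Data for gluing a finite family of planar triangles, indexed by `F`, along their sides.
The side `(f, i)` of the face `f` goes from the corner `i` to the corner `i + 1` (mod 3), so
that the corner `i + 2` is the one opposite to it. Each side `s` is glued to exactly one other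
side `opp s`. -/
structure Gluing (F : Type*) where
  corner : F → Fin 3 → ℂ
  corner_ccw : ∀ f, 0 < orient (corner f 0) (corner f 1) (corner f 2)
  opp : F × Fin 3 → F × Fin 3
  opp_opp : ∀ s, opp (opp s) = s
  opp_ne : ∀ s, opp s ≠ s
  side_length_eq : ∀ s, dist (corner s.1 s.2) (corner s.1 (s.2 + 1)) =
    dist (corner (opp s).1 (opp s).2) (corner (opp s).1 ((opp s).2 + 1))

namespace Gluing

variable {F : Type*} (G : Gluing F)

/-- The closed flat triangle representing the face `f`. -/
def face (f : F) : Set ℂ := triangle (G.corner f 0) (G.corner f 1) (G.corner f 2)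

/-- The elementary identifications: the side `s` is glued to the side `opp s` by the isometry
that reverses the boundary orientations (so that the orientations of the faces agree). -/
inductive Glued : F × ℂ → F × ℂ → Prop
  | side (s : F × Fin 3) (t : ℝ) (ht : t ∈ Icc (0 : ℝ) 1) :
      Glued
        (s.1, AffineMap.lineMap (G.corner s.1 s.2) (G.corner s.1 (s.2 + 1)) t)
        ((G.opp s).1, AffineMap.lineMap (G.corner (G.opp s).1 ((G.opp s).2 + 1))
          (G.corner (G.opp s).1 (G.opp s).2) t)

/-- The angle of the triangle containing the side `s` that is opposite to `s`. -/
noncomputable def oppositeAngle (s : F × Fin 3) : ℝ :=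
  EuclideanGeometry.angle (G.corner s.1 s.2) (G.corner s.1 (s.2 + 2)) (G.corner s.1 (s.2 + 1))

end Gluing

/-- A geodesic triangulation, with set of faces `F`, of the closed oriented polyhedral surface
`S`: the faces are flat triangles, `param f` is the orientation-preserving parametrization of
the face `f` by a planar triangle, and `S` is glued from these triangles along their sides,
both as a set and as a metric space.

All sides being glued in pairs, compatibly with the orientations, `S` is a closed oriented
surface, and its metric is flat except for conical singularities at (some) vertices. The faces
need not form a simplicial complex, see `IsSimplicial`. -/
structure GeodesicTriangulation (S : Type*) [MetricSpace S] (F : Type*) extends Gluing F where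
  param : F → ℂ → S
  param_surjective : ∀ x : S, ∃ f, ∃ z ∈ toGluing.face f, param f z = x
  param_eq_iff : ∀ f f', ∀ z ∈ toGluing.face f, ∀ z' ∈ toGluing.face f',
    (param f z = param f' z' ↔ Relation.EqvGen toGluing.Glued (f, z) (f', z'))
  dist_param_le : ∀ f, ∀ z ∈ toGluing.face f, ∀ z' ∈ toGluing.face f,
    dist (param f z) (param f z') ≤ dist z z'
  /-- The metric of `S` is the metric of the gluing (the intrinsic length metric), i.e. the
  largest one for which the parametrizations of the faces do not increase distances. -/
  dist_largest : ∀ d : S → S → ℝ,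
    (∀ x, d x x = 0) → (∀ x y, d x y = d y x) → (∀ x y z, d x z ≤ d x y + d y z) →
    (∀ f, ∀ z ∈ toGluing.face f, ∀ z' ∈ toGluing.face f,
      d (param f z) (param f z') ≤ dist z z') →
    ∀ x y, d x y ≤ dist x y

namespace GeodesicTriangulation

variable {S : Type*} [MetricSpace S] {F : Type*} (T : GeodesicTriangulation S F)

/-- The `i`-th vertex of the face `f`, as a point of the surface. -/
def vertex (f : F) (i : Fin 3) : S := T.param f (T.corner f i)

/-- The set of all vertices of the triangulation. -/
def vertices : Set S := {v | ∃ f i, T.vertex f i = v}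

/-- Delaunay condition: for each edge, the two opposite angles sum up to at most `π`. -/
def IsDelaunay : Prop :=
  ∀ s, T.oppositeAngle s + T.oppositeAngle (T.opp s) ≤ Real.pi

/-- Condition (D): for some constant `C > 0`, for each edge the sum of the two opposite angles
is less than `π - 1 / C`. -/
def ConditionD : Prop :=
  ∃ C : ℝ, 0 < C ∧ ∀ s, T.oppositeAngle s + T.oppositeAngle (T.opp s) < Real.pi - 1 / C

/-- The triangulation is a simplicial complex: the vertices of each face are distinct, and
faces and edges are determined by the sets of their vertices. -/
def IsSimplicial : Prop :=
  (∀ f, Function.Injective (T.vertex f)) ∧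
  (∀ f f', range (T.vertex f) = range (T.vertex f') → f = f') ∧
  (∀ s s' : F × Fin 3,
    ({T.vertex s.1 s.2, T.vertex s.1 (s.2 + 1)} : Set S) =
      {T.vertex s'.1 s'.2, T.vertex s'.1 (s'.2 + 1)} → s' = s ∨ s' = T.opp s)

/-- `g` is an orientation-preserving locally isometric immersion of the open planar set `U`
into the surface. (Over the interior of a face, a locally isometric map followed by the inverse
parametrization is a planar isometry; it preserves the orientation iff its linear part is the
multiplication by a unit complex number.) -/
def IsFlatImmersionOn (g : ℂ → S) (U : Set ℂ) : Prop :=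
  (∀ x ∈ U, ∃ ε > 0, ball x ε ⊆ U ∧
    ∀ a ∈ ball x ε, ∀ b ∈ ball x ε, dist (g a) (g b) = dist a b) ∧
  (∀ x ∈ U, ∀ f, ∀ y ∈ interior (T.face f), g x = T.param f y →
    ∃ u : ℂ, ‖u‖ = 1 ∧ ∀ᶠ z in 𝓝 x, g z = T.param f (y + u * (z - x)))

/-- An immersed flat intrinsic disk in the surface containing the face `f`, with the vertices
of `f` on its boundary. The disk is placed in the plane in such a way that the immersion
restricts to the given parametrization on the triangle representing `f`. -/
structure Circumdisk (f : F) where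
  center : ℂ
  radius : ℝ
  dist_corner : ∀ i, dist (T.corner f i) center = radius
  map : ℂ → S
  continuousOn_map : ContinuousOn map (closedBall center radius)
  flat_map : T.IsFlatImmersionOn map (ball center radius)
  map_eq_param : EqOn map (T.param f) (T.face f)

namespace Circumdisk

variable {T} {f : F} (D : T.Circumdisk f)

/-- The circumcenter of the face, as a point of the surface. -/
def circumcenter : S := D.map D.center

/-- The circumradius (a geodesic segment in the surface) from the `i`-th vertex of the face
(`t = 0`) to the circumcenter (`t = 1`). -/
noncomputable def circumradius (i : Fin 3) (t : ℝ) : S :=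
  D.map (AffineMap.lineMap (T.corner f i) D.center t)

end Circumdisk

end GeodesicTriangulation

/-- `z 0, z 1, z 2, z 3` are the consecutive vertices, in counterclockwise order, of a simple
planar quadrilateral, not necessarily convex (one angle may be equal to or greater than `π`):
one of the two diagonals cuts it into two nondegenerate counterclockwise triangles. -/
def IsQuadrilateral (z : Fin 4 → ℂ) : Prop :=
  (0 < orient (z 0) (z 1) (z 2) ∧ 0 < orient (z 0) (z 2) (z 3)) ∨
  (0 < orient (z 1) (z 2) (z 3) ∧ 0 < orient (z 1) (z 3) (z 0))

/-- The closed region bounded by a simple quadrilateral. Cutting along an inner diagonal gives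
the region itself; the outer diagonal of a nonconvex quadrilateral gives the convex hull. -/
def quadRegion (z : Fin 4 → ℂ) : Set ℂ :=
  (triangle (z 0) (z 1) (z 2) ∪ triangle (z 0) (z 2) (z 3)) ∩
  (triangle (z 1) (z 2) (z 3) ∪ triangle (z 1) (z 3) (z 0))

/-- A decomposition of the surface into finitely many cells (vertices, edges, faces) with
quadrilateral faces, bipartite vertices (black and white, each edge joining a black vertex to
a white one), together with an identification of each face with a planar quadrilateral by an
orientation-preserving isometry. `edgeMap e` runs through the edge `e` from its black end
(`t = 0`) to its white end (`t = 1`). `faceMap q` is the inverse of the chart on the face `q`: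
a continuous map of the closed quadrilateral that takes sides to edges, and is injective and
locally isometric in the interior. -/
structure QuadDecomposition {S : Type*} [MetricSpace S] {F : Type*}
    (T : GeodesicTriangulation S F) (Edge Face : Type*) where
  finite_edge : Finite Edge
  finite_face : Finite Face
  black : Set S
  white : Set S
  finite_black : black.Finite
  finite_white : white.Finite
  disjoint_black_white : Disjoint black white
  edgeMap : Edge → ℝ → S
  continuousOn_edgeMap : ∀ e, ContinuousOn (edgeMap e) (Icc 0 1)
  injOn_edgeMap : ∀ e, InjOn (edgeMap e) (Icc 0 1)
  edgeMap_zero : ∀ e, edgeMap e 0 ∈ black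
  edgeMap_one : ∀ e, edgeMap e 1 ∈ white
  quad : Face → Fin 4 → ℂ
  isQuadrilateral : ∀ q, IsQuadrilateral (quad q)
  faceMap : Face → ℂ → S
  continuousOn_faceMap : ∀ q, ContinuousOn (faceMap q) (quadRegion (quad q))
  injOn_faceMap : ∀ q, InjOn (faceMap q) (interior (quadRegion (quad q)))
  flat_faceMap : ∀ q, T.IsFlatImmersionOn (faceMap q) (interior (quadRegion (quad q)))
  /-- The vertices `0` and `2` of each quadrilateral are black, the vertices `1` and `3` are
  white, and each of its four sides is mapped onto an edge. -/
  side_eq_edge : ∀ q, ∀ k ∈ ({0, 2} : Set (Fin 4)), ∀ l ∈ ({1, 3} : Set (Fin 4)),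
    ∃ e, ∀ t ∈ Icc (0 : ℝ) 1,
      faceMap q (AffineMap.lineMap (quad q k) (quad q l) t) = edgeMap e t
  -- The vertices, the open edges and the open faces are disjoint and cover the surface.
  disjoint_edge_edge : ∀ e e', e ≠ e' →
    Disjoint (edgeMap e '' Ioo 0 1) (edgeMap e' '' Ioo 0 1)
  disjoint_vertex_edge : ∀ e, Disjoint (black ∪ white) (edgeMap e '' Ioo 0 1)
  disjoint_face_face : ∀ q q', q ≠ q' →
    Disjoint (faceMap q '' interior (quadRegion (quad q)))
      (faceMap q' '' interior (quadRegion (quad q')))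
  disjoint_vertex_face : ∀ q,
    Disjoint (black ∪ white) (faceMap q '' interior (quadRegion (quad q)))
  disjoint_edge_face : ∀ e q,
    Disjoint (edgeMap e '' Icc 0 1) (faceMap q '' interior (quadRegion (quad q)))
  cover : ∀ x : S, x ∈ black ∪ white ∨ (∃ e, x ∈ edgeMap e '' Ioo 0 1) ∨
    ∃ q, x ∈ faceMap q '' interior (quadRegion (quad q))

/-- The decomposition is a quad-surface in the strict sense: the identifications of the closed
faces with closed quadrilaterals are bijective, and the intersection of any two distinct faces
is either empty, or a single vertex, or a single edge. -/
def QuadDecomposition.IsQuadSurface {S : Type*} [MetricSpace S] {F : Type*}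
    {T : GeodesicTriangulation S F} {Edge Face : Type*}
    (Q : QuadDecomposition T Edge Face) : Prop :=
  (∀ q, InjOn (Q.faceMap q) (quadRegion (Q.quad q))) ∧
  ∀ q q', q ≠ q' →
    Q.faceMap q '' quadRegion (Q.quad q) ∩ Q.faceMap q' '' quadRegion (Q.quad q') = ∅ ∨
    (∃ v ∈ Q.black ∪ Q.white,
      Q.faceMap q '' quadRegion (Q.quad q) ∩ Q.faceMap q' '' quadRegion (Q.quad q') = {v}) ∨
    ∃ e, Q.faceMap q '' quadRegion (Q.quad q) ∩ Q.faceMap q' '' quadRegion (Q.quad q') =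
      Q.edgeMap e '' Icc 0 1

end PolyhedralSurface

/-! ### Planar orientation and triangles. -/

namespace PolyhedralSurface

/-! Place a side at `[-1, 1]` with its face above it. The circumcenter becomes `h * I` for a real
`h` of either sign, and the opposite angle is `π / 2 - arctan h` (`oppositeAngle_eq`). Condition (D)
thus yields `h + k > 0` for the heights over the two faces adjacent to any side (`height_add_pos`):
the two circumcenters, seen in the unfolded pair of faces, come in the right order. Angles enter the
proof only through this inequality.

Disks: for a point beyond a side, passing to the adjacent face lowers its power with respect to the
circumscribed circle, by an amount proportional to `h + k` (`pow_transfer`). A point of the open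
disk is beyond at most one side (`eq_of_beyond`), so the unfolding is forced, and it stops because
the drops are uniform until a face is reached (`exists_drop`, `disk_induction`). This develops the
open disk onto the surface by `dev`, which is a local isometry (`exists_isometric_of_mem_face`,
`flatAt_dev`). It extends to the closed disk by continuity, and any other choice of the disk agrees
with it (`Circumdisk.map_eq_dev`).

Tiling: the quadrilateral over a side is the kite with vertices `-1, -k * I, 1, h * I`. A
circumcenter may lie outside its face, so the kites are compared with the faces by a signed count.
The isosceles triangles joining the circumcenter to the three sides add up, with signs, to the face
(`sum_isoscelesSign`), and the two isosceles triangles over a common side add up to the kite because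
`h + k > 0` (`kite_indicator`). Summing over the developments of a generic point, every such point
is covered once by the kites, hence twice if each kite is counted from both of its sides
(`sum_ncard_kiteFiber`).

From generic to all points: nongeneric points form a set of Hausdorff dimension at most one, so
generic points are dense (`exists_isGeneric`). If a point has two descriptions, each accounting for
all generic points nearby, the uniqueness at generic points forces the descriptions to share a kite
and a position in it (`Covers.exists_eq`). Applied to open kites, circumradii and circumcenters,
this gives all the disjointness statements. Compactness of the closed kites gives the covering. In
the simplicial case the intersections of closed kites are read off from shared ends and shared
adjacent faces. -/

theorem orient_rotate (a b c : ℂ) : orient b c a = orient a b c := by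
  unfold orient; simp only [Complex.sub_re, Complex.sub_im]; ring

theorem orient_affine (m w p q r : ℂ) :
    orient (m + w * p) (m + w * q) (m + w * r) = Complex.normSq w * orient p q r := by
  unfold orient
  simp only [Complex.sub_re, Complex.sub_im, Complex.add_re, Complex.add_im, Complex.mul_re,
    Complex.mul_im, Complex.normSq_apply]
  ring

theorem convex_orient_nonneg (p q : ℂ) : Convex ℝ {z | 0 ≤ orient p q z} := by
  intro x hx y hy α β hα hβ hαβ
  have : orient p q (α • x + β • y) = α * orient p q x + β * orient p q y := by
    obtain rfl : α = 1 - β := by linarith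
    unfold orient
    simp only [Complex.sub_re, Complex.sub_im, Complex.add_re, Complex.add_im, Complex.real_smul,
      Complex.mul_re, Complex.mul_im, Complex.ofReal_re, Complex.ofReal_im]
    ring
  simp only [mem_ofPred_eq] at *
  rw [this]; positivity

theorem orient_self_left (a b : ℂ) : orient a b a = 0 := by
  unfold orient; simp

theorem orient_self_right (a b : ℂ) : orient a b b = 0 := by
  unfold orient; simp; ring

/-- The three orientations, divided by `orient a b c`, are the barycentric coordinates of `z`. -/
theorem mem_triangle_iff {a b c : ℂ} (h : 0 < orient a b c) (z : ℂ) :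
    z ∈ triangle a b c ↔ 0 ≤ orient a b z ∧ 0 ≤ orient b c z ∧ 0 ≤ orient c a z := by
  constructor
  · intro hz
    have hsub : triangle a b c ⊆
        {z | 0 ≤ orient a b z} ∩ ({z | 0 ≤ orient b c z} ∩ {z | 0 ≤ orient c a z}) := by
      refine convexHull_min ?_ ((convex_orient_nonneg _ _).inter
        ((convex_orient_nonneg _ _).inter (convex_orient_nonneg _ _)))
      have h1 : orient b c a = orient a b c := orient_rotate a b c
      have h2 : orient c a b = orient a b c := by rw [orient_rotate, orient_rotate]
      rintro x (rfl | rfl | rfl) <;>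
        simp [orient_self_left, orient_self_right, h1, h2, h.le]
    exact hsub hz
  · rintro ⟨h1, h2, h3⟩
    have hz : z = (orient b c z / orient a b c) • a + (orient c a z / orient a b c) • b +
        (orient a b z / orient a b c) • c := by
      have h0 := h.ne'
      apply Complex.ext
      · simp only [Complex.add_re, Complex.real_smul, Complex.mul_re, Complex.ofReal_re,
          Complex.ofReal_im, zero_mul, sub_zero]
        field_simp
        simp only [orient, Complex.sub_re, Complex.sub_im]; ring
      · simp only [Complex.add_im, Complex.real_smul, Complex.mul_im, Complex.ofReal_re,
          Complex.ofReal_im, zero_mul, add_zero]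
        field_simp
        simp only [orient, Complex.sub_re, Complex.sub_im]; ring
    have hsum : orient b c z / orient a b c + orient c a z / orient a b c +
        orient a b z / orient a b c = 1 := by
      rw [← add_div, ← add_div, div_eq_one_iff_eq h.ne']
      simp only [orient, Complex.sub_re, Complex.sub_im]; ring
    rw [hz]
    have hc := convex_convexHull ℝ ({a, b, c} : Set ℂ)
    have := hc.sum_mem (t := Finset.univ) (w := ![orient b c z / orient a b c,
      orient c a z / orient a b c, orient a b z / orient a b c]) (z := ![a, b, c])
      (by intro i _; fin_cases i <;> simp <;> positivity)
      (by simp [Fin.sum_univ_three, hsum])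
      (by intro i _; fin_cases i <;> exact subset_convexHull ℝ _ (by simp))
    simpa [Fin.sum_univ_three, triangle] using this

/-! ### Normalized coordinates of a side, circumcenters and powers. -/

namespace Gluing

variable {F : Type*} (G : Gluing F)

/-- The midpoint of a side. -/
noncomputable def mid (s : F × Fin 3) : ℂ := (G.corner s.1 s.2 + G.corner s.1 (s.2 + 1)) / 2

/-- Half of the vector of a side. -/
noncomputable def half (s : F × Fin 3) : ℂ := (G.corner s.1 (s.2 + 1) - G.corner s.1 s.2) / 2

/-- The normalized coordinate in which the side `s` goes from `-1` to `1`. -/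
noncomputable def coord (s : F × Fin 3) (z : ℂ) : ℂ := (z - G.mid s) / G.half s

/-- The inverse of the normalized coordinate. -/
noncomputable def frame (s : F × Fin 3) (ζ : ℂ) : ℂ := G.mid s + G.half s * ζ

/-- The change of coordinates from the plane of the face of `s` to the plane of the face of
`opp s` that unfolds these two faces along the common side. -/
noncomputable def transfer (s : F × Fin 3) (z : ℂ) : ℂ := G.frame (G.opp s) (-G.coord s z)

theorem orient_corner (f : F) (i : Fin 3) :
    0 < orient (G.corner f i) (G.corner f (i + 1)) (G.corner f (i + 2)) := by
  have h := G.corner_ccw f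
  fin_cases i
  · exact h
  · change 0 < orient (G.corner f 1) (G.corner f 2) (G.corner f 0)
    rwa [orient_rotate]
  · change 0 < orient (G.corner f 2) (G.corner f 0) (G.corner f 1)
    rwa [orient_rotate, orient_rotate]

theorem half_ne_zero (s : F × Fin 3) : G.half s ≠ 0 := by
  intro h
  have h1 := G.orient_corner s.1 s.2
  have h2 : G.corner s.1 (s.2 + 1) - G.corner s.1 s.2 = 0 := by
    simpa [half] using h
  simp [orient, h2] at h1

theorem normSq_half_pos (s : F × Fin 3) : 0 < Complex.normSq (G.half s) :=
  Complex.normSq_pos.2 (G.half_ne_zero s)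

@[simp] theorem frame_coord (s : F × Fin 3) (z : ℂ) : G.frame s (G.coord s z) = z := by
  have := G.half_ne_zero s
  unfold frame coord; field_simp; ring

@[simp] theorem coord_frame (s : F × Fin 3) (z : ℂ) : G.coord s (G.frame s z) = z := by
  have := G.half_ne_zero s
  unfold frame coord; field_simp; ring

theorem coord_injective (s : F × Fin 3) : Function.Injective (G.coord s) :=
  Function.LeftInverse.injective (G.frame_coord s)

theorem frame_neg_one (s : F × Fin 3) : G.frame s (-1) = G.corner s.1 s.2 := by
  unfold frame mid half; ring

theorem frame_one (s : F × Fin 3) : G.frame s 1 = G.corner s.1 (s.2 + 1) := by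
  unfold frame mid half; ring

theorem coord_left (s : F × Fin 3) : G.coord s (G.corner s.1 s.2) = -1 := by
  rw [← frame_neg_one, coord_frame]

theorem coord_right (s : F × Fin 3) : G.coord s (G.corner s.1 (s.2 + 1)) = 1 := by
  rw [← frame_one, coord_frame]

theorem continuous_coord (s : F × Fin 3) : Continuous (G.coord s) := by
  unfold coord; fun_prop

theorem continuous_frame (s : F × Fin 3) : Continuous (G.frame s) := by
  unfold frame; fun_prop

theorem coord_transfer (s : F × Fin 3) (z : ℂ) :
    G.coord (G.opp s) (G.transfer s z) = -G.coord s z := by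
  simp [transfer]

@[simp] theorem transfer_transfer (s : F × Fin 3) (z : ℂ) :
    G.transfer (G.opp s) (G.transfer s z) = z := by
  rw [transfer, coord_transfer, G.opp_opp, neg_neg, frame_coord]

theorem transfer_transfer' (s : F × Fin 3) (z : ℂ) :
    G.transfer s (G.transfer (G.opp s) z) = z := by
  have := G.transfer_transfer (G.opp s) z
  rwa [G.opp_opp] at this

theorem normSq_half_opp (s : F × Fin 3) :
    Complex.normSq (G.half (G.opp s)) = Complex.normSq (G.half s) := by
  have h : ‖G.half (G.opp s)‖ = ‖G.half s‖ := by
    have := G.side_length_eq s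
    rw [dist_comm, dist_comm (G.corner (G.opp s).1 _), dist_eq_norm, dist_eq_norm] at this
    simp [half, this]
  rw [Complex.normSq_eq_norm_sq, Complex.normSq_eq_norm_sq, h]

/-- The linear part of `transfer`. -/
noncomputable def rot (s : F × Fin 3) : ℂ := -(G.half (G.opp s) / G.half s)

theorem norm_rot (s : F × Fin 3) : ‖G.rot s‖ = 1 := by
  have h := G.normSq_half_opp s
  have h0 := norm_ne_zero_iff.2 (G.half_ne_zero s)
  rw [Complex.normSq_eq_norm_sq, Complex.normSq_eq_norm_sq,
    sq_eq_sq₀ (norm_nonneg _) (norm_nonneg _)] at h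
  rw [rot, norm_neg, norm_div, h, div_self h0]

theorem transfer_sub (s : F × Fin 3) (z z' : ℂ) :
    G.transfer s z = G.transfer s z' + G.rot s * (z - z') := by
  have := G.half_ne_zero s
  unfold transfer frame rot coord; field_simp; ring

theorem dist_transfer (s : F × Fin 3) (z z' : ℂ) :
    dist (G.transfer s z) (G.transfer s z') = dist z z' := by
  rw [dist_eq_norm, dist_eq_norm, G.transfer_sub s z z', add_sub_cancel_left, norm_mul,
    norm_rot, one_mul]

theorem continuous_transfer (s : F × Fin 3) : Continuous (G.transfer s) :=
  (Isometry.of_dist_eq (G.dist_transfer s)).continuous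

theorem im_coord (s : F × Fin 3) (z : ℂ) :
    (G.coord s z).im = orient (G.corner s.1 s.2) (G.corner s.1 (s.2 + 1)) z /
      (2 * Complex.normSq (G.half s)) := by
  have h := G.normSq_half_pos s
  have h1 := orient_affine (G.mid s) (G.half s) (-1) 1 (G.coord s z)
  change orient (G.frame s (-1)) (G.frame s 1) (G.frame s (G.coord s z)) = _ at h1
  rw [frame_neg_one, frame_one, frame_coord] at h1
  rw [h1]
  field_simp
  unfold orient; simp; ring

theorem im_coord_nonneg_iff (s : F × Fin 3) (z : ℂ) :
    0 ≤ (G.coord s z).im ↔ 0 ≤ orient (G.corner s.1 s.2) (G.corner s.1 (s.2 + 1)) z := by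
  have h := G.normSq_half_pos s
  rw [im_coord, le_div_iff₀ (by positivity), zero_mul]

theorem mem_face_iff (f : F) (z : ℂ) :
    z ∈ G.face f ↔ ∀ i, 0 ≤ (G.coord (f, i) z).im := by
  rw [face, mem_triangle_iff (G.corner_ccw f)]
  simp only [im_coord_nonneg_iff]
  constructor
  · rintro ⟨h0, h1, h2⟩ i
    fin_cases i <;> assumption
  · exact fun h => ⟨h 0, h 1, h 2⟩

theorem im_coord_apex (f : F) (i : Fin 3) : 0 < (G.coord (f, i) (G.corner f (i + 2))).im := by
  have h := G.normSq_half_pos (f, i)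
  rw [im_coord]
  exact div_pos (G.orient_corner f i) (by positivity)

theorem corner_mem_face (f : F) (i : Fin 3) : G.corner f i ∈ G.face f :=
  subset_convexHull ℝ _ (by fin_cases i <;> simp)

theorem convex_face (f : F) : Convex ℝ (G.face f) := convex_convexHull ℝ _

theorem isCompact_face (f : F) : IsCompact (G.face f) :=
  (Set.toFinite _).isCompact_convexHull ℝ

theorem im_coord_pos_of_mem_interior {f : F} {z : ℂ} (hz : z ∈ interior (G.face f))
    (i : Fin 3) : 0 < (G.coord (f, i) z).im := by
  by_contra! hle
  -- This path goes straight across the side, so it would take a nonpositive ordinate to a negative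
  -- one while still in the face.
  have hc : Continuous fun t : ℝ =>
      G.frame (f, i) (G.coord (f, i) z - t * Complex.I) := by
    have := G.continuous_frame (f, i)
    fun_prop
  have hev : ∀ᶠ t : ℝ in 𝓝 0,
      G.frame (f, i) (G.coord (f, i) z - t * Complex.I) ∈ G.face f := by
    apply hc.continuousAt.eventually_mem
    simp only [Complex.ofReal_zero, zero_mul, sub_zero, frame_coord]
    exact mem_interior_iff_mem_nhds.1 hz
  obtain ⟨ε, hε, h⟩ := Metric.eventually_nhds_iff.1 hev
  have := (G.mem_face_iff f _).1 (h (y := ε / 2) (by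
    rw [Real.dist_eq, sub_zero, abs_of_pos] <;> linarith)) i
  rw [coord_frame] at this
  simp at this
  linarith

theorem isOpen_openFace (f : F) : IsOpen {z | ∀ i, 0 < (G.coord (f, i) z).im} := by
  simp only [ofPred_forall]
  exact isOpen_iInter_of_finite fun i =>
    isOpen_lt continuous_const (Complex.continuous_im.comp (G.continuous_coord _))

theorem mem_interior_face_iff {f : F} {z : ℂ} :
    z ∈ interior (G.face f) ↔ ∀ i, 0 < (G.coord (f, i) z).im := by
  refine ⟨fun h i => G.im_coord_pos_of_mem_interior h i, fun h => ?_⟩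
  refine interior_maximal ?_ (G.isOpen_openFace f) h
  intro y hy
  exact (G.mem_face_iff f y).2 fun i => (hy i).le

/-- The circumcenter of the triangle representing a face. -/
noncomputable def center (f : F) : ℂ :=
  let b := G.corner f 1 - G.corner f 0
  let c := G.corner f 2 - G.corner f 0
  let d := 2 * orient (G.corner f 0) (G.corner f 1) (G.corner f 2)
  G.corner f 0 + ⟨(c.im * Complex.normSq b - b.im * Complex.normSq c) / d,
    (b.re * Complex.normSq c - c.re * Complex.normSq b) / d⟩

/-- The power of a point with respect to the circumscribed circle of a face. -/
noncomputable def pow (f : F) (z : ℂ) : ℝ :=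
  Complex.normSq (z - G.center f) - Complex.normSq (G.corner f 0 - G.center f)

theorem pow_corner (f : F) (i : Fin 3) : G.pow f (G.corner f i) = 0 := by
  have h := (G.corner_ccw f).ne'
  unfold pow center
  fin_cases i
  · simp
  · simp only [Complex.normSq_apply, Complex.sub_re, Complex.sub_im, Complex.add_re,
      Complex.add_im, Fin.mk_one, sub_add_cancel_left, Complex.neg_re, Complex.neg_im]
    field_simp
    simp only [orient, Complex.sub_re, Complex.sub_im]
    ring
  · simp only [Complex.normSq_apply, Complex.sub_re, Complex.sub_im, Complex.add_re,
      Complex.add_im, Fin.reduceFinMk, sub_add_cancel_left, Complex.neg_re, Complex.neg_im]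
    field_simp
    simp only [orient, Complex.sub_re, Complex.sub_im]
    ring

theorem normSq_corner_sub_center (f : F) (i : Fin 3) :
    Complex.normSq (G.corner f i - G.center f) =
      Complex.normSq (G.corner f 0 - G.center f) := by
  have := G.pow_corner f i
  unfold pow at this; linarith

/-- The signed distance from a side to the circumcenter, in the normalized coordinate. -/
noncomputable def height (s : F × Fin 3) : ℝ := (G.coord s (G.center s.1)).im

/-- Being equidistant from `-1` and `1`, the circumcenter has zero abscissa. -/
theorem coord_center (s : F × Fin 3) :
    G.coord s (G.center s.1) = G.height s * Complex.I := by
  have h1 := G.normSq_corner_sub_center s.1 s.2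
  have h2 := G.normSq_corner_sub_center s.1 (s.2 + 1)
  rw [← h2] at h1
  have hn := G.normSq_half_pos s
  have key : ∀ p q : ℂ, Complex.normSq (G.frame s p - G.frame s q) =
      Complex.normSq (G.half s) * Complex.normSq (p - q) := by
    intro p q; rw [← Complex.normSq_mul]; congr 1; unfold frame; ring
  rw [← frame_one, ← frame_neg_one, ← G.frame_coord s (G.center s.1), key, key] at h1
  have h3 := mul_left_cancel₀ hn.ne' h1
  simp only [Complex.normSq_apply, Complex.sub_re, Complex.sub_im, Complex.neg_re,
    Complex.neg_im, Complex.one_re, Complex.one_im] at h3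
  apply Complex.ext
  · simp; linarith
  · simp [height]

theorem center_eq_frame (s : F × Fin 3) :
    G.center s.1 = G.frame s (G.height s * Complex.I) := by
  rw [← coord_center, frame_coord]

theorem pow_frame (s : F × Fin 3) (ζ : ℂ) :
    G.pow s.1 (G.frame s ζ) = Complex.normSq (G.half s) *
      (ζ.re ^ 2 + ζ.im ^ 2 - 2 * G.height s * ζ.im - 1) := by
  have h := G.normSq_corner_sub_center s.1 (s.2 + 1)
  have key : ∀ p q : ℂ, Complex.normSq (G.frame s p - G.frame s q) =
      Complex.normSq (G.half s) * Complex.normSq (p - q) := by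
    intro p q; rw [← Complex.normSq_mul]; congr 1; unfold frame; ring
  rw [pow, ← h, ← frame_one, center_eq_frame, key, key]
  simp [Complex.normSq_apply]
  ring

theorem pow_eq (s : F × Fin 3) (z : ℂ) :
    G.pow s.1 z = Complex.normSq (G.half s) *
      ((G.coord s z).re ^ 2 + (G.coord s z).im ^ 2 - 2 * G.height s * (G.coord s z).im - 1) := by
  rw [← pow_frame, frame_coord]

theorem pow_neg_iff (s : F × Fin 3) (z : ℂ) :
    G.pow s.1 z < 0 ↔
      (G.coord s z).re ^ 2 + (G.coord s z).im ^ 2 < 2 * G.height s * (G.coord s z).im + 1 := by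
  rw [pow_eq, mul_neg_iff]
  have := G.normSq_half_pos s
  constructor
  · rintro (⟨-, h⟩ | ⟨h, -⟩) <;> linarith
  · intro h; left; constructor <;> linarith

/-- After unfolding, both circles pass through `-1` and `1`, so the common side is their radical
axis and the difference of the powers is a multiple of the ordinate. The factor `h + k` is what the
angle condition controls. -/
theorem pow_transfer (s : F × Fin 3) (z : ℂ) :
    G.pow (G.opp s).1 (G.transfer s z) = G.pow s.1 z +
      2 * Complex.normSq (G.half s) * (G.height s + G.height (G.opp s)) * (G.coord s z).im := by
  rw [transfer, pow_frame, pow_eq, normSq_half_opp]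
  simp only [Complex.neg_re, Complex.neg_im]
  ring

theorem continuous_pow (f : F) : Continuous (G.pow f) := by
  unfold pow
  exact (Complex.continuous_normSq.comp (by fun_prop)).sub continuous_const

theorem normSq_corner_pos (f : F) : 0 < Complex.normSq (G.corner f 0 - G.center f) := by
  have h := G.pow_frame (f, 0) (G.height (f, 0) * Complex.I)
  rw [← center_eq_frame] at h
  have h1 := G.normSq_half_pos (f, 0)
  unfold pow at h
  simp at h
  have : 0 < Complex.normSq (G.half (f, 0)) * (1 + G.height (f, 0) ^ 2) := by positivity
  nlinarith

theorem pow_neg_iff_mem_ball (f : F) (z : ℂ) :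
    G.pow f z < 0 ↔ z ∈ ball (G.center f) (dist (G.corner f 0) (G.center f)) := by
  rw [mem_ball, pow, Complex.normSq_eq_norm_sq, Complex.normSq_eq_norm_sq, dist_eq_norm,
    dist_eq_norm, sub_neg, sq_lt_sq₀ (norm_nonneg _) (norm_nonneg _)]

theorem pow_nonpos_iff_mem_closedBall (f : F) (z : ℂ) :
    G.pow f z ≤ 0 ↔ z ∈ closedBall (G.center f) (dist (G.corner f 0) (G.center f)) := by
  rw [mem_closedBall, pow, Complex.normSq_eq_norm_sq, Complex.normSq_eq_norm_sq, dist_eq_norm,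
    dist_eq_norm, sub_nonpos, sq_le_sq₀ (norm_nonneg _) (norm_nonneg _)]

theorem isOpen_disk (f : F) : IsOpen {z | G.pow f z < 0} :=
  isOpen_lt (G.continuous_pow f) continuous_const

end Gluing

/-! ### Opposite angles and termination of the unfolding. -/

namespace Gluing

variable {F : Type*} (G : Gluing F)

/-- The third corner of the face containing a side, in the normalized coordinate. -/
noncomputable def apex (s : F × Fin 3) : ℂ := G.coord s (G.corner s.1 (s.2 + 2))

theorem apex_im_pos (s : F × Fin 3) : 0 < (G.apex s).im := G.im_coord_apex s.1 s.2

theorem frame_apex (s : F × Fin 3) : G.frame s (G.apex s) = G.corner s.1 (s.2 + 2) := by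
  simp [apex]

theorem apex_circle (s : F × Fin 3) :
    (G.apex s).re ^ 2 + (G.apex s).im ^ 2 = 2 * G.height s * (G.apex s).im + 1 := by
  have h := G.pow_eq s (G.corner s.1 (s.2 + 2))
  rw [pow_corner] at h
  have := (mul_eq_zero.1 h.symm).resolve_left (G.normSq_half_pos s).ne'
  unfold apex; linarith

theorem mem_face_iff_coord (s : F × Fin 3) (z : ℂ) :
    z ∈ G.face s.1 ↔ 0 ≤ (G.coord s z).im ∧
      (1 - (G.apex s).re) * (G.coord s z).im ≤ (G.apex s).im * (1 - (G.coord s z).re) ∧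
      (1 + (G.apex s).re) * (G.coord s z).im ≤ (G.apex s).im * (1 + (G.coord s z).re) := by
  have hn := G.normSq_half_pos s
  have h3 : ∀ j : Fin 3, j + 2 + 1 = j := by decide
  have h2 : ∀ j : Fin 3, j + 1 + 1 = j + 2 := by decide
  have e1 : 0 ≤ (G.coord (s.1, s.2 + 1) z).im ↔
      (1 - (G.apex s).re) * (G.coord s z).im ≤ (G.apex s).im * (1 - (G.coord s z).re) := by
    rw [im_coord_nonneg_iff]
    dsimp only
    rw [h2, ← frame_one, ← frame_apex]
    conv_lhs => rw [← G.frame_coord s z]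
    unfold frame
    rw [orient_affine, mul_nonneg_iff_of_pos_left hn]
    simp only [orient, Complex.sub_re, Complex.sub_im, Complex.one_re, Complex.one_im]
    constructor <;> intro h <;> linarith
  have e2 : 0 ≤ (G.coord (s.1, s.2 + 2) z).im ↔
      (1 + (G.apex s).re) * (G.coord s z).im ≤ (G.apex s).im * (1 + (G.coord s z).re) := by
    rw [im_coord_nonneg_iff]
    dsimp only
    rw [h3, ← frame_neg_one, ← frame_apex]
    conv_lhs => rw [← G.frame_coord s z]
    unfold frame
    rw [orient_affine, mul_nonneg_iff_of_pos_left hn]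
    simp only [orient, Complex.sub_re, Complex.sub_im, Complex.one_re, Complex.one_im,
      Complex.neg_re, Complex.neg_im]
    constructor <;> intro h <;> linarith
  rw [mem_face_iff, ← e1, ← e2]
  constructor
  · exact fun h => ⟨h _, h _, h _⟩
  · rintro ⟨h0, h1, h2⟩ i
    have : ∀ i j : Fin 3, i = j ∨ i = j + 1 ∨ i = j + 2 := by decide
    rcases this i s.2 with h | h | h <;> rw [h] <;> assumption

/-- The inscribed angle is half the central one, so its cotangent is the height `h`. Concretely its
cosine is `h / √(1 + h ^ 2)`, the sine of `arctan h`; the circle equation of the third corner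
simplifies both the inner product and the norms. -/
theorem oppositeAngle_eq (s : F × Fin 3) :
    G.oppositeAngle s = Real.pi / 2 - Real.arctan (G.height s) := by
  have hy := G.apex_im_pos s
  have hc := G.apex_circle s
  have hn := G.normSq_half_pos s
  set p := G.apex s
  set h := G.height s
  have e1 : G.corner s.1 s.2 - G.corner s.1 (s.2 + 2) = G.half s * (-1 - p) := by
    rw [← frame_neg_one, ← frame_apex]; unfold frame; ring
  have e2 : G.corner s.1 (s.2 + 1) - G.corner s.1 (s.2 + 2) = G.half s * (1 - p) := by
    rw [← frame_one, ← frame_apex]; unfold frame; ring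
  rw [oppositeAngle, EuclideanGeometry.angle, InnerProductGeometry.angle, vsub_eq_sub,
    vsub_eq_sub, e1, e2, Real.arccos, Real.arctan_eq_arcsin]
  congr 2
  have hs : 0 < √(1 + h ^ 2) := Real.sqrt_pos.2 (by positivity)
  have hin : inner ℝ (G.half s * (-1 - p)) (G.half s * (1 - p)) =
      Complex.normSq (G.half s) * (2 * h * p.im) := by
    rw [Complex.inner, map_mul]
    have : G.half s * (1 - p) * ((starRingEnd ℂ) (G.half s) * (starRingEnd ℂ) (-1 - p)) =
        (Complex.normSq (G.half s) : ℂ) * ((1 - p) * (starRingEnd ℂ) (-1 - p)) := by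
      rw [Complex.normSq_eq_conj_mul_self]; ring
    rw [this, Complex.re_ofReal_mul]
    congr 1
    simp
    linarith
  have hnorm : ‖G.half s * (-1 - p)‖ * ‖G.half s * (1 - p)‖ =
      Complex.normSq (G.half s) * (2 * p.im * √(1 + h ^ 2)) := by
    rw [← sq_eq_sq₀ (by positivity) (by positivity), mul_pow, ← Complex.normSq_eq_norm_sq,
      ← Complex.normSq_eq_norm_sq, Complex.normSq_mul, Complex.normSq_mul, mul_pow, mul_pow,
      Real.sq_sqrt (by positivity)]
    have e3 : Complex.normSq (-1 - p) = 2 * h * p.im + 2 + 2 * p.re := by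
      simp [Complex.normSq_apply]; linarith
    have e4 : Complex.normSq (1 - p) = 2 * h * p.im + 2 - 2 * p.re := by
      simp [Complex.normSq_apply]; linarith
    rw [e3, e4]
    linear_combination (-4) * (Complex.normSq (G.half s)) ^ 2 * hc
  rw [hin, hnorm]
  field_simp

/-- Two sides of a face meet only outside the open circumscribed disk, on the outer side. -/
theorem pow_nonneg_of_beyond_succ {f : F} {z : ℂ} (i : Fin 3)
    (h1 : (G.coord (f, i) z).im < 0) (h2 : (G.coord (f, i + 1) z).im < 0) : 0 ≤ G.pow f z := by
  have r1 : orient (G.corner f i) (G.corner f (i + 1)) z < 0 := by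
    by_contra! h; exact absurd ((G.im_coord_nonneg_iff (f, i) z).2 h) (not_le.2 h1)
  have r2 : orient (G.corner f (i + 1)) (G.corner f (i + 2)) z < 0 := by
    have h22 : ∀ j : Fin 3, j + 1 + 1 = j + 2 := by decide
    by_contra! h
    refine absurd ((G.im_coord_nonneg_iff (f, i + 1) z).2 ?_) (not_le.2 h2)
    dsimp only; rwa [h22]
  have hO := G.orient_corner f i
  have n0 := G.normSq_corner_sub_center f i
  have n1 := G.normSq_corner_sub_center f (i + 1)
  have n2 := G.normSq_corner_sub_center f (i + 2)
  have hp : G.pow f z = Complex.normSq (z - G.center f) -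
      Complex.normSq (G.corner f (i + 1) - G.center f) := by rw [n1]; rfl
  rw [← n1] at n0 n2
  set a := G.corner f i
  set b := G.corner f (i + 1)
  set c := G.corner f (i + 2)
  set o := G.center f
  -- The power is `normSq (z - b)` minus a linear form in `z - b`. As it vanishes at `a` and `c`,
  -- the form takes the values `normSq (a - b)` and `normSq (c - b)` there; expand `z - b` in the
  -- basis `a - b, c - b`. Beyond both sides the two coefficients are negative.
  have key : orient a b c * G.pow f z = orient a b c * Complex.normSq (z - b) -
      orient b c z * Complex.normSq (a - b) - orient a b z * Complex.normSq (c - b) := by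
    rw [hp]
    simp only [Complex.normSq_apply, orient, Complex.sub_re, Complex.sub_im] at n0 n2 ⊢
    linear_combination ((c.re - b.re) * (z.im - b.im) - (c.im - b.im) * (z.re - b.re)) * n0 +
      ((b.re - a.re) * (z.im - a.im) - (b.im - a.im) * (z.re - a.re)) * n2
  have : 0 ≤ orient a b c * G.pow f z := by
    rw [key]
    have := Complex.normSq_nonneg (z - b)
    have := Complex.normSq_nonneg (a - b)
    have := Complex.normSq_nonneg (c - b)
    have := mul_nonneg hO.le (Complex.normSq_nonneg (z - b))
    have := mul_nonneg (neg_pos.2 r2).le (Complex.normSq_nonneg (a - b))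
    have := mul_nonneg (neg_pos.2 r1).le (Complex.normSq_nonneg (c - b))
    linarith
  exact (mul_nonneg_iff_of_pos_left hO).1 this

/-- Any two sides of a triangle are consecutive, so the previous lemma applies. Consequently the
unfolding of a point of the open disk never involves a choice. -/
theorem eq_of_beyond {f : F} {z : ℂ} (hz : G.pow f z < 0) {i j : Fin 3}
    (h1 : (G.coord (f, i) z).im < 0) (h2 : (G.coord (f, j) z).im < 0) : i = j := by
  have : ∀ i j : Fin 3, i = j ∨ j = i + 1 ∨ i = j + 1 := by decide
  rcases this i j with h | h | h
  · exact h
  · subst h; exact absurd (G.pow_nonneg_of_beyond_succ i h1 h2) (not_le.2 hz)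
  · subst h; exact absurd (G.pow_nonneg_of_beyond_succ j h2 h1) (not_le.2 hz)

section Delaunay

variable {G} (hH : ∀ s, 0 < G.height s + G.height (G.opp s))
include hH

theorem pow_transfer_lt {s : F × Fin 3} {z : ℂ} (h : (G.coord s z).im < 0) :
    G.pow (G.opp s).1 (G.transfer s z) < G.pow s.1 z := by
  rw [pow_transfer]
  have := mul_pos (mul_pos two_pos (G.normSq_half_pos s)) (hH s)
  nlinarith

theorem pow_transfer_le {s : F × Fin 3} {z : ℂ} (h : (G.coord s z).im ≤ 0) :
    G.pow (G.opp s).1 (G.transfer s z) ≤ G.pow s.1 z := by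
  rw [pow_transfer]
  have := mul_pos (mul_pos two_pos (G.normSq_half_pos s)) (hH s)
  nlinarith

/-- The drop of the power is proportional to the depth below the side, so it is bounded below except
near the side. There, the bound `-δ` on the power keeps the abscissa away from the ends, and a
shallow point is already in the adjacent face. -/
theorem exists_drop (s : F × Fin 3) {δ : ℝ} (hδ : 0 < δ) : ∃ ε > 0, ∀ z, G.pow s.1 z ≤ -δ →
    (G.coord s z).im < 0 → G.transfer s z ∈ G.face (G.opp s).1 ∨
      G.pow (G.opp s).1 (G.transfer s z) ≤ G.pow s.1 z - ε := by
  have hn := G.normSq_half_pos s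
  have hk := hH s
  set w := Complex.normSq (G.half s)
  set h := G.height s
  have hy := G.apex_im_pos (G.opp s)
  set p := G.apex (G.opp s)
  set d := δ / w with hd
  have hdp : 0 < d := div_pos hδ hn
  -- The first bound gives `|x| ≤ 1 - d / 4` for the abscissa `x`; the second then makes a point of
  -- depth less than `η` satisfy the inequalities of the two other sides of the adjacent face.
  set η := min (d / (4 * (|h| + 1))) (p.im * d / (4 * (1 + |p.re|))) with hη
  have hηp : 0 < η := lt_min (by positivity) (by positivity)
  have η1 : 4 * (|h| + 1) * η ≤ d := by
    have := min_le_left (d / (4 * (|h| + 1))) (p.im * d / (4 * (1 + |p.re|)))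
    rw [← hη, le_div_iff₀ (by positivity)] at this; linarith
  have η2 : 4 * (1 + |p.re|) * η ≤ p.im * d := by
    have := min_le_right (d / (4 * (|h| + 1))) (p.im * d / (4 * (1 + |p.re|)))
    rw [← hη, le_div_iff₀ (by positivity)] at this; linarith
  refine ⟨2 * w * (h + G.height (G.opp s)) * η, by positivity, fun z hz hzy => ?_⟩
  by_cases hyη : -η < (G.coord s z).im
  · left
    rw [mem_face_iff_coord, coord_transfer]
    rw [pow_eq] at hz
    have hz' : (G.coord s z).re ^ 2 + (G.coord s z).im ^ 2 - 2 * h * (G.coord s z).im - 1 ≤ -d := by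
      rw [hd, ← neg_div, le_div_iff₀ hn]; linarith
    generalize G.coord s z = ζ at *
    simp only [Complex.neg_re, Complex.neg_im]
    have hx2 : ζ.re ^ 2 ≤ 1 - d / 2 := by
      have : 2 * h * ζ.im ≤ 2 * |h| * η := by
        have h1 : h * ζ.im ≤ |h| * |ζ.im| := by rw [← abs_mul]; exact le_abs_self _
        have h2 : |ζ.im| ≤ η := by rw [abs_of_neg hzy]; linarith
        have := mul_le_mul_of_nonneg_left h2 (abs_nonneg h)
        linarith
      nlinarith [sq_nonneg ζ.im, abs_nonneg h]
    have hx : |ζ.re| ≤ 1 - d / 4 := by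
      apply abs_le_of_sq_le_sq
      · nlinarith
      · nlinarith [sq_nonneg ζ.re]
    obtain ⟨hx1, hx2⟩ := abs_le.1 hx
    have a1 := le_abs_self p.re
    have a2 := neg_abs_le p.re
    have m1 : (1 - p.re) * -ζ.im ≤ (1 + |p.re|) * η := by
      have : (1 - p.re) * -ζ.im ≤ (1 + |p.re|) * -ζ.im :=
        mul_le_mul_of_nonneg_right (by linarith) (by linarith)
      have : (1 + |p.re|) * -ζ.im ≤ (1 + |p.re|) * η :=
        mul_le_mul_of_nonneg_left (by linarith) (by positivity)
      linarith
    have m2 : (1 + p.re) * -ζ.im ≤ (1 + |p.re|) * η := by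
      have : (1 + p.re) * -ζ.im ≤ (1 + |p.re|) * -ζ.im :=
        mul_le_mul_of_nonneg_right (by linarith) (by linarith)
      have : (1 + |p.re|) * -ζ.im ≤ (1 + |p.re|) * η :=
        mul_le_mul_of_nonneg_left (by linarith) (by positivity)
      linarith
    have m3 : p.im * (d / 4) ≤ p.im * (1 - -ζ.re) := mul_le_mul_of_nonneg_left (by linarith) hy.le
    have m4 : p.im * (d / 4) ≤ p.im * (1 + -ζ.re) := mul_le_mul_of_nonneg_left (by linarith) hy.le
    exact ⟨by linarith, by linarith, by linarith⟩
  · right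
    rw [pow_transfer]
    have : 0 < 2 * w * (h + G.height (G.opp s)) := by positivity
    have := mul_le_mul_of_nonneg_left (not_lt.1 hyη) this.le
    linarith

/-- Induction on the development of an open circumscribed disk: each point of the disk gets into
a face after finitely many unfoldings. -/
theorem disk_induction [Finite F] {P : F → ℂ → Prop}
    (base : ∀ f z, z ∈ G.face f → G.pow f z < 0 → P f z)
    (step : ∀ f i z, G.pow f z < 0 → (G.coord (f, i) z).im < 0 →
      P (G.opp (f, i)).1 (G.transfer (f, i) z) → P f z)
    (f : F) (z : ℂ) (hz : G.pow f z < 0) : P f z := by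
  obtain ⟨δ, hδ, hzδ⟩ : ∃ δ > 0, G.pow f z ≤ -δ := ⟨-G.pow f z, by linarith, by linarith⟩
  choose ε hε hdrop using fun s => exists_drop hH s hδ
  obtain ⟨ε₀, hε₀, hle⟩ : ∃ ε₀ > 0, ∀ s, ε₀ ≤ ε s := by
    cases isEmpty_or_nonempty (F × Fin 3)
    · exact ⟨1, one_pos, fun s => isEmptyElim s⟩
    · obtain ⟨s, hs⟩ := Finite.exists_min ε
      exact ⟨ε s, hε s, hs⟩
  obtain ⟨R, hR⟩ : ∃ R : ℝ, ∀ f, Complex.normSq (G.corner f 0 - G.center f) < R := by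
    obtain ⟨R, hR⟩ := (Set.finite_range
      fun f => Complex.normSq (G.corner f 0 - G.center f)).bddAbove
    exact ⟨R + 1, fun f => by linarith [hR (mem_range_self f)]⟩
  -- Every power exceeds `-R`, so `n = 0` is impossible. An unfolding that does not end in a face
  -- lowers the power by `ε₀`, and the bound `-δ` persists because powers only decrease.
  have key : ∀ n : ℕ, ∀ f z, G.pow f z ≤ -δ → G.pow f z < -R + n * ε₀ → P f z := by
    intro n
    induction n with
    | zero =>
      intro f z _ h
      have h1 := hR f
      have h2 := Complex.normSq_nonneg (z - G.center f)
      simp only [pow, Nat.cast_zero, zero_mul] at h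
      linarith
    | succ n ih =>
      intro f z h1 h2
      have hneg : G.pow f z < 0 := by linarith
      by_cases hf : z ∈ G.face f
      · exact base f z hf hneg
      · rw [mem_face_iff] at hf
        push Not at hf
        obtain ⟨i, hi⟩ := hf
        have hlt := pow_transfer_lt hH hi
        apply step f i z hneg hi
        rcases hdrop (f, i) z h1 hi with h | h
        · exact base _ _ h (hlt.trans hneg)
        · apply ih
          · exact hlt.le.trans h1
          · have := hle (f, i)
            push_cast at h2
            dsimp only at h
            linarith
  obtain ⟨n, hn⟩ := exists_nat_gt ((G.pow f z + R) / ε₀)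
  rw [div_lt_iff₀ hε₀] at hn
  exact key n f z hzδ (by linarith)

end Delaunay

end Gluing

/-- The two angles add up to `π - arctan h - arctan k`, and `arctan` is odd and strictly increasing.
-/
theorem GeodesicTriangulation.height_add_pos {S : Type*} [MetricSpace S] {F : Type*}
    (T : GeodesicTriangulation S F) (hD : T.ConditionD) (s : F × Fin 3) :
    0 < T.height s + T.height (T.opp s) := by
  obtain ⟨C, hC, h⟩ := hD
  have h := h s
  rw [T.oppositeAngle_eq, T.oppositeAngle_eq] at h
  have : 0 < 1 / C := by positivity
  have h2 : Real.arctan (-T.height (T.opp s)) < Real.arctan (T.height s) := by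
    rw [Real.arctan_neg]; linarith
  have := Real.arctan_lt_arctan_iff.1 h2
  linarith

/-! ### Points on the sides and the gluing relation. -/

namespace Gluing

variable {F : Type*} (G : Gluing F)

theorem im_coord_succ (s : F × Fin 3) (z : ℂ) :
    (G.coord (s.1, s.2 + 1) z).im = Complex.normSq (G.half s) /
      (2 * Complex.normSq (G.half (s.1, s.2 + 1))) *
      ((G.apex s).im * (1 - (G.coord s z).re) - (1 - (G.apex s).re) * (G.coord s z).im) := by
  have h2 : ∀ j : Fin 3, j + 1 + 1 = j + 2 := by decide
  rw [im_coord]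
  dsimp only
  rw [h2, ← frame_one, ← frame_apex]
  conv_lhs => rw [← G.frame_coord s z]
  unfold frame
  rw [orient_affine]
  simp only [orient, Complex.sub_re, Complex.sub_im, Complex.one_re, Complex.one_im]
  ring

theorem im_coord_succ_succ (s : F × Fin 3) (z : ℂ) :
    (G.coord (s.1, s.2 + 2) z).im = Complex.normSq (G.half s) /
      (2 * Complex.normSq (G.half (s.1, s.2 + 2))) *
      ((G.apex s).im * (1 + (G.coord s z).re) - (1 + (G.apex s).re) * (G.coord s z).im) := by
  have h3 : ∀ j : Fin 3, j + 2 + 1 = j := by decide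
  rw [im_coord]
  dsimp only
  rw [h3, ← frame_neg_one, ← frame_apex]
  conv_lhs => rw [← G.frame_coord s z]
  unfold frame
  rw [orient_affine]
  simp only [orient, Complex.sub_re, Complex.sub_im, Complex.one_re, Complex.one_im,
    Complex.neg_re, Complex.neg_im]
  ring

theorem im_coord_pos_of_ne {s : F × Fin 3} {z : ℂ} (h0 : (G.coord s z).im = 0)
    (h1 : (G.coord s z).re ^ 2 < 1) {j : Fin 3} (hj : j ≠ s.2) :
    0 < (G.coord (s.1, j) z).im := by
  have hy := G.apex_im_pos s
  have ha : ∀ i j : Fin 3, i ≠ j → i = j + 1 ∨ i = j + 2 := by decide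
  have h2 : -1 < (G.coord s z).re := by nlinarith
  have h3 : (G.coord s z).re < 1 := by nlinarith
  have hn := G.normSq_half_pos s
  rcases ha j s.2 hj with rfl | rfl
  · have := G.normSq_half_pos (s.1, s.2 + 1)
    rw [im_coord_succ, h0, mul_zero, sub_zero]
    have : 0 < 1 - (G.coord s z).re := by linarith
    positivity
  · have := G.normSq_half_pos (s.1, s.2 + 2)
    rw [im_coord_succ_succ, h0, mul_zero, sub_zero]
    have : 0 < 1 + (G.coord s z).re := by linarith
    positivity

theorem re_sq_lt_one {s : F × Fin 3} {z : ℂ} (h0 : (G.coord s z).im = 0)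
    (h1 : G.pow s.1 z < 0) : (G.coord s z).re ^ 2 < 1 := by
  rw [pow_neg_iff, h0] at h1
  linarith

theorem mem_face_of_im_eq_zero {s : F × Fin 3} {z : ℂ} (h0 : (G.coord s z).im = 0)
    (h1 : (G.coord s z).re ^ 2 ≤ 1) : z ∈ G.face s.1 := by
  have hy := G.apex_im_pos s
  have h2 : -1 ≤ (G.coord s z).re := by nlinarith
  have h3 : (G.coord s z).re ≤ 1 := by nlinarith
  rw [mem_face_iff_coord, h0, mul_zero, mul_zero]
  exact ⟨le_rfl, mul_nonneg hy.le (by linarith), mul_nonneg hy.le (by linarith)⟩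

theorem re_sq_le_one {s : F × Fin 3} {z : ℂ} (h0 : (G.coord s z).im = 0)
    (h1 : z ∈ G.face s.1) : (G.coord s z).re ^ 2 ≤ 1 := by
  have hy := G.apex_im_pos s
  rw [mem_face_iff_coord, h0, mul_zero, mul_zero] at h1
  obtain ⟨-, h2, h3⟩ := h1
  have h2 := (mul_nonneg_iff_of_pos_left hy).1 h2
  have h3 := (mul_nonneg_iff_of_pos_left hy).1 h3
  nlinarith

theorem lineMap_eq_frame (s : F × Fin 3) (t : ℝ) :
    AffineMap.lineMap (G.corner s.1 s.2) (G.corner s.1 (s.2 + 1)) t =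
      G.frame s ((2 * t - 1 : ℝ) : ℂ) := by
  rw [← frame_one, ← frame_neg_one, AffineMap.lineMap_apply]
  simp [frame]
  ring

theorem lineMap_eq_frame' (s : F × Fin 3) (t : ℝ) :
    AffineMap.lineMap (G.corner s.1 (s.2 + 1)) (G.corner s.1 s.2) t =
      G.frame s ((1 - 2 * t : ℝ) : ℂ) := by
  rw [← frame_one, ← frame_neg_one, AffineMap.lineMap_apply]
  simp [frame]
  ring

/-- Both reverse the side isometrically, so the gluing is the restriction of the unfolding
`transfer` to points of zero ordinate. -/
theorem Glued.exists_side {G : Gluing F} {p q : F × ℂ} (h : G.Glued p q) :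
    ∃ s, p.1 = s.1 ∧ q.1 = (G.opp s).1 ∧ q.2 = G.transfer s p.2 ∧ (G.coord s p.2).im = 0 ∧
      p.2 ∈ G.face s.1 ∧ q.2 ∈ G.face (G.opp s).1 := by
  obtain ⟨s, t, ht⟩ := h
  have h1 : (2 * t - 1) ^ 2 ≤ 1 := by nlinarith [ht.1, ht.2]
  refine ⟨s, rfl, rfl, ?_, ?_, ?_, ?_⟩ <;> dsimp only
  · rw [lineMap_eq_frame, lineMap_eq_frame', transfer, coord_frame]
    congr 1; push_cast; ring
  · rw [lineMap_eq_frame, coord_frame, Complex.ofReal_im]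
  · apply mem_face_of_im_eq_zero
    · rw [lineMap_eq_frame, coord_frame, Complex.ofReal_im]
    · rw [lineMap_eq_frame, coord_frame, Complex.ofReal_re]
      exact h1
  · apply mem_face_of_im_eq_zero
    · rw [lineMap_eq_frame', coord_frame, Complex.ofReal_im]
    · rw [lineMap_eq_frame', coord_frame, Complex.ofReal_re]
      nlinarith

theorem transfer_mem_face {s : F × Fin 3} {z : ℂ} (hz : z ∈ G.face s.1)
    (h0 : (G.coord s z).im = 0) : G.transfer s z ∈ G.face (G.opp s).1 := by
  apply mem_face_of_im_eq_zero
  · rw [coord_transfer, Complex.neg_im, h0, neg_zero]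
  · rw [coord_transfer, Complex.neg_re, neg_sq]
    exact G.re_sq_le_one h0 hz

theorem glued_transfer {s : F × Fin 3} {z : ℂ} (hz : z ∈ G.face s.1)
    (h0 : (G.coord s z).im = 0) : G.Glued (s.1, z) ((G.opp s).1, G.transfer s z) := by
  have h1 := G.re_sq_le_one h0 hz
  have h2 : -1 ≤ (G.coord s z).re := by nlinarith
  have h3 : (G.coord s z).re ≤ 1 := by nlinarith
  have := Glued.side (G := G) s (((G.coord s z).re + 1) / 2)
    ⟨by linarith, by linarith⟩
  rw [lineMap_eq_frame, lineMap_eq_frame'] at this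
  have e : ((2 * (((G.coord s z).re + 1) / 2) - 1 : ℝ) : ℂ) = G.coord s z := by
    apply Complex.ext
    · rw [Complex.ofReal_re]; ring
    · rw [Complex.ofReal_im, h0]
  have e' : ((1 - 2 * (((G.coord s z).re + 1) / 2) : ℝ) : ℂ) = -G.coord s z := by
    have : ((1 - 2 * (((G.coord s z).re + 1) / 2) : ℝ) : ℂ) =
        -((2 * (((G.coord s z).re + 1) / 2) - 1 : ℝ) : ℂ) := by push_cast; ring
    rw [this, e]
  rwa [e, e', frame_coord] at this

/-- The change of the power in `pow_transfer` vanishes on the common side. Hence the power is a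
function on the surface; being zero at the corners, it tells vertices from the points inside the
disks. -/
theorem pow_eq_of_eqvGen {p q : F × ℂ} (h : Relation.EqvGen G.Glued p q) :
    G.pow p.1 p.2 = G.pow q.1 q.2 := by
  induction h with
  | rel p q h =>
    obtain ⟨s, h1, h2, h3, h4, -⟩ := h.exists_side
    rw [h1, h2, h3, pow_transfer, h4, mul_zero, add_zero]
  | refl => rfl
  | symm _ _ _ ih => exact ih.symm
  | trans _ _ _ _ _ ih1 ih2 => exact ih1.trans ih2

theorem eq_of_eqvGen {p q : F × ℂ} (h : Relation.EqvGen G.Glued p q) :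
    p = q ∨ ((∃ i, (G.coord (p.1, i) p.2).im = 0) ∧ ∃ i, (G.coord (q.1, i) q.2).im = 0) := by
  induction h with
  | rel p q h =>
    obtain ⟨s, h1, h2, h3, h4, -⟩ := h.exists_side
    refine Or.inr ⟨⟨s.2, by rw [h1]; exact h4⟩, ⟨(G.opp s).2, ?_⟩⟩
    rw [h2, h3]
    change (G.coord (G.opp s) _).im = 0
    rw [coord_transfer, Complex.neg_im, h4, neg_zero]
  | refl => exact Or.inl rfl
  | symm p q _ ih =>
    rcases ih with rfl | ⟨h1, h2⟩
    · exact Or.inl rfl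
    · exact Or.inr ⟨h2, h1⟩
  | trans p q r _ _ ih1 ih2 =>
    rcases ih1 with rfl | ⟨h1, h2⟩
    · exact ih2
    · rcases ih2 with rfl | ⟨h3, h4⟩
      · exact Or.inr ⟨h1, h2⟩
      · exact Or.inr ⟨h1, h4⟩

end Gluing

/-! ### The metric of the gluing and the development of a disk. -/

namespace GeodesicTriangulation

variable {S : Type*} [MetricSpace S] {F : Type*} (T : GeodesicTriangulation S F)

theorem param_eq_transfer {s : F × Fin 3} {z : ℂ} (hz : z ∈ T.face s.1)
    (h0 : (T.coord s z).im = 0) :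
    T.param s.1 z = T.param (T.opp s).1 (T.transfer s z) :=
  (T.param_eq_iff _ _ _ hz _ (T.transfer_mem_face hz h0)).2
    (Relation.EqvGen.rel _ _ (T.glued_transfer hz h0))

theorem pow_eq_of_param_eq {f f' : F} {z z' : ℂ} (hz : z ∈ T.face f) (hz' : z' ∈ T.face f')
    (h : T.param f z = T.param f' z') : T.pow f z = T.pow f' z' :=
  T.pow_eq_of_eqvGen ((T.param_eq_iff _ _ _ hz _ hz').1 h)

theorem eq_of_param_eq {f f' : F} {z z' : ℂ} (hz : z ∈ T.face f)
    (hz' : z' ∈ interior (T.face f')) (h : T.param f z = T.param f' z') : f = f' ∧ z = z' := by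
  rcases T.eq_of_eqvGen ((T.param_eq_iff _ _ _ hz _ (interior_subset hz')).1 h) with
    h | ⟨-, i, hi⟩
  · exact Prod.mk.inj h
  · exact absurd hi (T.im_coord_pos_of_mem_interior hz' i).ne'

theorem continuousOn_param (f : F) : ContinuousOn (T.param f) (T.face f) := by
  have : LipschitzOnWith 1 (T.param f) (T.face f) :=
    LipschitzOnWith.of_dist_le_mul fun x hx y hy => by
      simpa using T.dist_param_le f x hx y hy
  exact this.continuousOn

/-- A function on the disjoint union of the faces that respects the gluing and is 1-Lipschitz on
each face is 1-Lipschitz on the surface. -/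
theorem sub_le_dist (v : F × ℂ → ℝ) (hglue : ∀ p q, T.Glued p q → v p = v q)
    (hlip : ∀ f, ∀ z ∈ T.face f, ∀ z' ∈ T.face f, v (f, z) - v (f, z') ≤ dist z z')
    {f f' : F} {z z' : ℂ} (hz : z ∈ T.face f) (hz' : z' ∈ T.face f') :
    v (f, z) - v (f', z') ≤ dist (T.param f z) (T.param f' z') := by
  choose pf pz hpz hp using T.param_surjective
  have hv : ∀ p q, Relation.EqvGen T.Glued p q → v p = v q := by
    intro p q h
    induction h with
    | rel p q h => exact hglue p q h
    | refl => rfl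
    | symm _ _ _ ih => exact ih.symm
    | trans _ _ _ _ _ ih1 ih2 => exact ih1.trans ih2
  have hu : ∀ f, ∀ z ∈ T.face f, v (pf (T.param f z), pz (T.param f z)) = v (f, z) :=
    fun f z hz => hv _ _ ((T.param_eq_iff _ _ _ (hpz _) _ hz).1 (hp _))
  -- The function `v` descends to the surface, and its pullback of the metric of the line is a
  -- pseudometric that competes with the metric of the gluing.
  have := T.dist_largest (fun x y => |v (pf x, pz x) - v (pf y, pz y)|) (by simp)
    (fun x y => abs_sub_comm _ _) (fun x y z => abs_sub_le _ _ _)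
    (fun f z hz z' hz' => by
      rw [hu f z hz, hu f z' hz']
      exact abs_le.2 ⟨by have := hlip f z' hz' z hz; rw [dist_comm] at this; linarith,
        hlip f z hz z' hz'⟩) (T.param f z) (T.param f' z')
  rw [hu f z hz, hu f' z' hz'] at this
  exact (le_abs_self _).trans this

/-- The development of the plane of a face over the surface, as a relation. -/
inductive Dev : F → ℂ → S → Prop
  | base (f : F) (z : ℂ) (hz : z ∈ T.face f) : Dev f z (T.param f z)
  | step (f : F) (i : Fin 3) (z : ℂ) (p : S) (hz : (T.coord (f, i) z).im < 0)
      (h : Dev (T.opp (f, i)).1 (T.transfer (f, i) z) p) : Dev f z p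

open Classical in
/-- The development of the open circumscribed disk of a face. -/
noncomputable def dev (f : F) (z : ℂ) : S :=
  if h : ∃ p, T.Dev f z p then h.choose else T.param f z

variable {T} (hH : ∀ s, 0 < T.height s + T.height (T.opp s))
include hH

/-- At each stage the point is in the face or beyond exactly one side, and the power stays negative
along the unfolding, so `eq_of_beyond` keeps applying. -/
theorem Dev.unique {f : F} {z : ℂ} {p q : S} (h : T.Dev f z p) (h' : T.Dev f z q)
    (hz : T.pow f z < 0) : p = q := by
  induction h with
  | base f z hf =>
    cases h' with
    | base => rfl
    | step _ i _ _ hi => exact absurd ((T.mem_face_iff f z).1 hf i) (not_le.2 hi)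
  | step f i z p hi _ ih =>
    cases h' with
    | base _ _ hf => exact absurd ((T.mem_face_iff f z).1 hf i) (not_le.2 hi)
    | step _ j _ _ hj h' =>
      obtain rfl := T.eq_of_beyond hz hi hj
      exact ih h' ((Gluing.pow_transfer_lt hH hi).trans hz)

variable [Finite F]

theorem Dev.exists {f : F} {z : ℂ} (hz : T.pow f z < 0) : ∃ p, T.Dev f z p := by
  refine Gluing.disk_induction hH (P := fun f z => ∃ p, T.Dev f z p) ?_ ?_ f z hz
  · exact fun f z hf _ => ⟨_, Dev.base f z hf⟩
  · exact fun f i z _ hi ih => ⟨_, Dev.step f i z _ hi ih.choose_spec⟩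

theorem dev_spec {f : F} {z : ℂ} (hz : T.pow f z < 0) : T.Dev f z (T.dev f z) := by
  have h := Dev.exists hH hz
  rw [dev, dif_pos h]
  exact h.choose_spec

theorem dev_face {f : F} {z : ℂ} (hf : z ∈ T.face f) (hz : T.pow f z < 0) :
    T.dev f z = T.param f z :=
  (dev_spec hH hz).unique hH (Dev.base f z hf) hz

theorem dev_step {s : F × Fin 3} {z : ℂ} (hz : T.pow s.1 z < 0) (hs : (T.coord s z).im < 0) :
    T.dev s.1 z = T.dev (T.opp s).1 (T.transfer s z) :=
  (dev_spec hH hz).unique hH (Dev.step s.1 s.2 z _ hs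
    (dev_spec hH ((Gluing.pow_transfer_lt hH hs).trans hz))) hz

/-- Developments of adjacent disks agree on the overlap: below the side this is an unfolding step,
above it the same step seen from the other face, and on the side it is the gluing. -/
theorem dev_transfer {s : F × Fin 3} {z : ℂ} (hz : T.pow s.1 z < 0)
    (hz' : T.pow (T.opp s).1 (T.transfer s z) < 0) :
    T.dev s.1 z = T.dev (T.opp s).1 (T.transfer s z) := by
  rcases lt_trichotomy (T.coord s z).im 0 with h | h | h
  · exact dev_step hH hz h
  · have hf := T.mem_face_of_im_eq_zero h (T.re_sq_lt_one h hz).le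
    rw [dev_face hH hf hz, dev_face hH (T.transfer_mem_face hf h) hz', T.param_eq_transfer hf h]
  · have := dev_step hH hz' (by rw [T.coord_transfer]; simpa using h)
    rw [T.transfer_transfer, T.opp_opp] at this
    exact this.symm

end GeodesicTriangulation

/-! ### The development is a local isometry. -/

namespace GeodesicTriangulation

variable {S : Type*} [MetricSpace S] {F : Type*} {T : GeodesicTriangulation S F}

/-- Negative power excludes the corners, so the point is on at most one side. -/
theorem exists_side_of_mem_face {f : F} {z : ℂ} (hz : z ∈ T.face f) (hp : T.pow f z < 0) :
    ∃ i, ∀ j, j ≠ i → 0 < (T.coord (f, j) z).im := by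
  by_cases h : ∃ i, (T.coord (f, i) z).im = 0
  · obtain ⟨i, hi⟩ := h
    exact ⟨i, fun j hj => T.im_coord_pos_of_ne hi (T.re_sq_lt_one hi hp) hj⟩
  · push Not at h
    exact ⟨0, fun j _ => lt_of_le_of_ne ((T.mem_face_iff f z).1 hz j) (h j).symm⟩

/-- Near a point of a face other than a vertex, only one side of the face and the adjacent face
are visible. -/
theorem exists_unfolding_ball {s : F × Fin 3} {z : ℂ} (hz : z ∈ T.face s.1)
    (hp : T.pow s.1 z < 0) (hs : ∀ j, j ≠ s.2 → 0 < (T.coord (s.1, j) z).im) :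
    ∃ R > 0, ∀ x ∈ ball z R, T.pow s.1 x < 0 ∧ (∀ j, j ≠ s.2 → 0 < (T.coord (s.1, j) x).im) ∧
      ((T.coord s x).im ≤ 0 →
        ∀ j, j ≠ (T.opp s).2 → 0 < (T.coord ((T.opp s).1, j) (T.transfer s x)).im) := by
  have hc : ∀ s, Continuous fun x => (T.coord s x).im := fun s =>
    Complex.continuous_im.comp (T.continuous_coord s)
  have h1 : ∀ᶠ x in 𝓝 z, T.pow s.1 x < 0 :=
    (T.continuous_pow s.1).continuousAt.eventually_lt_const hp
  have h2 : ∀ᶠ x in 𝓝 z, ∀ j, j ≠ s.2 → 0 < (T.coord (s.1, j) x).im := by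
    rw [Filter.eventually_all]
    intro j
    by_cases hj : j = s.2
    · simp [hj]
    · filter_upwards [(hc (s.1, j)).continuousAt.eventually_const_lt (hs j hj)] with x hx _
      exact hx
  have h3 : ∀ᶠ x in 𝓝 z, ((T.coord s x).im ≤ 0 →
      ∀ j, j ≠ (T.opp s).2 → 0 < (T.coord ((T.opp s).1, j) (T.transfer s x)).im) := by
    rcases ((T.mem_face_iff s.1 z).1 hz s.2).lt_or_eq with h | h
    · filter_upwards [(hc s).continuousAt.eventually_const_lt h] with x hx hx'
      exact absurd hx' (not_le.2 hx)
    · have h0 : (T.coord s z).im = 0 := h.symm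
      have : ∀ᶠ x in 𝓝 z, ∀ j, j ≠ (T.opp s).2 →
          0 < (T.coord ((T.opp s).1, j) (T.transfer s x)).im := by
        rw [Filter.eventually_all]
        intro j
        by_cases hj : j = (T.opp s).2
        · simp [hj]
        · have hpos : 0 < (T.coord ((T.opp s).1, j) (T.transfer s z)).im := by
            apply T.im_coord_pos_of_ne _ _ hj
            · rw [T.coord_transfer, Complex.neg_im, h0, neg_zero]
            · rw [T.coord_transfer, Complex.neg_re, neg_sq]
              exact T.re_sq_lt_one h0 hp
          filter_upwards [((hc ((T.opp s).1, j)).comp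
            (T.continuous_transfer s)).continuousAt.eventually_const_lt hpos] with x hx _
          exact hx
      filter_upwards [this] with x hx _
      exact hx
  obtain ⟨R, hR, h⟩ := Metric.eventually_nhds_iff_ball.1 (h1.and (h2.and h3))
  exact ⟨R, hR, h⟩

/-- If both faces adjacent to a side coincide, then the two copies of a point of the open face or
of the open side in the unfolding are at a positive distance. -/
theorem exists_separation {s : F × Fin 3} {z : ℂ} (hz : z ∈ T.face s.1)
    (hs : ∀ j, j ≠ s.2 → 0 < (T.coord (s.1, j) z).im) :
    ∃ ε > 0, ((T.opp s).1 = s.1 → ∀ x ∈ ball z ε, ∀ w ∈ ball z ε,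
      2 * ε ≤ dist (T.transfer (T.opp s) x) w ∧
      ((T.coord s x).im < 0 → 2 * ε ≤ dist (T.transfer s x) w)) := by
  by_cases hf : (T.opp s).1 = s.1
  swap
  · exact ⟨1, one_pos, fun h => absurd h hf⟩
  have hj : (T.opp s).2 ≠ s.2 := fun h => T.opp_ne s (Prod.ext hf h)
  have hpos : 0 < (T.coord (T.opp s) z).im := by
    have := hs _ hj
    rwa [← hf] at this
  have tri : ∀ t : F × Fin 3, ∀ ε : ℝ, 4 * ε ≤ dist (T.transfer t z) z → ∀ x ∈ ball z ε,
      ∀ w ∈ ball z ε, 2 * ε ≤ dist (T.transfer t x) w := by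
    intro t ε h x hx w hw
    have h1 := dist_triangle4 (T.transfer t z) (T.transfer t x) w z
    rw [T.dist_transfer, dist_comm z x] at h1
    rw [mem_ball] at hx hw
    linarith
  -- The unfolding changes the sign of the ordinate, while `z` is above both sides, strictly above
  -- `opp s`.
  have e1 : 0 < dist (T.transfer (T.opp s) z) z := by
    rw [dist_pos]
    intro h
    have h1 := T.coord_transfer (T.opp s) z
    rw [T.opp_opp, h] at h1
    have h2 := congrArg Complex.im h1
    rw [Complex.neg_im] at h2
    have := (T.mem_face_iff s.1 z).1 hz s.2
    change 0 ≤ (T.coord s z).im at this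
    linarith
  obtain ⟨ε₂, hε₂, h2⟩ : ∃ ε₂ > 0, ∀ ε, 0 < ε → ε ≤ ε₂ → ∀ x ∈ ball z ε, ∀ w ∈ ball z ε,
      (T.coord s x).im < 0 → 2 * ε ≤ dist (T.transfer s x) w := by
    rcases ((T.mem_face_iff s.1 z).1 hz s.2).lt_or_eq with h | h
    · have : ∀ᶠ x in 𝓝 z, 0 < (T.coord s x).im :=
        (Complex.continuous_im.comp (T.continuous_coord s)).continuousAt.eventually_const_lt h
      obtain ⟨r, hr, hr'⟩ := Metric.eventually_nhds_iff_ball.1 this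
      exact ⟨r, hr, fun ε _ hε x hx w hw hx' =>
        absurd hx' (not_lt.2 (hr' x (ball_subset_ball hε hx)).le)⟩
    · have h0 : 0 = (T.coord s z).im := h
      have e2 : 0 < dist (T.transfer s z) z := by
        rw [dist_pos]
        intro h
        have h1 := T.coord_transfer s z
        rw [h] at h1
        have h2 := congrArg Complex.im h1
        rw [Complex.neg_im] at h2
        linarith
      exact ⟨dist (T.transfer s z) z / 4, by positivity, fun ε _ hε x hx w hw _ =>
        tri s ε (by linarith) x hx w hw⟩
  refine ⟨min (dist (T.transfer (T.opp s) z) z / 4) ε₂, by positivity,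
    fun _ x hx w hw => ⟨tri _ _ ?_ x hx w hw, fun hx' => h2 _ (by positivity)
      (min_le_right _ _) x hx w hw hx'⟩⟩
  have := min_le_left (dist (T.transfer (T.opp s) z) z / 4) ε₂
  linarith

theorem exists_mem_segment_of_im {g : ℂ → ℝ} (hg : Continuous g) {x y : ℂ} (hx : 0 ≤ g x)
    (hy : g y ≤ 0) : ∃ c ∈ segment ℝ x y, g c = 0 := by
  have hc : ContinuousOn (fun t : ℝ => g (AffineMap.lineMap x y t)) (Icc 0 1) :=
    (hg.comp (AffineMap.lineMap_continuous)).continuousOn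
  obtain ⟨t, ht, h⟩ := intermediate_value_Icc' zero_le_one hc
    (show (0 : ℝ) ∈ Icc _ _ by simpa using ⟨hy, hx⟩)
  exact ⟨_, by rw [segment_eq_image_lineMap]; exact mem_image_of_mem _ ht, h⟩

variable (hH : ∀ s, 0 < T.height s + T.height (T.opp s)) [Finite F]
include hH

open Classical in
/-- The development is an isometry near each point of a face that is not a vertex. -/
theorem exists_isometric_of_mem_face {f : F} {z : ℂ} (hz : z ∈ T.face f) (hp : T.pow f z < 0) :
    ∃ ε > 0, (∀ x ∈ ball z ε, ∀ w ∈ ball z ε, dist (T.dev f x) (T.dev f w) = dist x w) ∧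
      ∀ p ∈ ball (T.dev f z) ε, ∃ x ∈ ball z ε, T.dev f x = p := by
  obtain ⟨i, hi⟩ := exists_side_of_mem_face hz hp
  obtain ⟨s, rfl, rfl⟩ : ∃ s : F × Fin 3, s.1 = f ∧ s.2 = i := ⟨(f, i), rfl, rfl⟩
  obtain ⟨R, hR, hball⟩ := exists_unfolding_ball hz hp hi
  obtain ⟨ε₁, hε₁, hsep⟩ := exists_separation hz hi
  have hin : ∀ x ∈ ball z R, 0 ≤ (T.coord s x).im →
      x ∈ T.face s.1 ∧ T.dev s.1 x = T.param s.1 x := by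
    intro x hx h
    have hf : x ∈ T.face s.1 := by
      rw [T.mem_face_iff]
      intro j
      by_cases hj : j = s.2
      · rw [hj]; exact h
      · exact ((hball x hx).2.1 j hj).le
    exact ⟨hf, dev_face hH hf (hball x hx).1⟩
  have hout : ∀ x ∈ ball z R, (T.coord s x).im ≤ 0 → T.transfer s x ∈ T.face (T.opp s).1 ∧
      T.dev s.1 x = T.param (T.opp s).1 (T.transfer s x) := by
    intro x hx h
    have hf : T.transfer s x ∈ T.face (T.opp s).1 := by
      rw [T.mem_face_iff]
      intro j
      by_cases hj : j = (T.opp s).2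
      · rw [hj]
        change 0 ≤ (T.coord (T.opp s) _).im
        rw [T.coord_transfer, Complex.neg_im]; linarith
      · exact ((hball x hx).2.2 h j hj).le
    have hp' := (Gluing.pow_transfer_le hH h).trans_lt (hball x hx).1
    exact ⟨hf, by rw [dev_transfer hH (hball x hx).1 hp', dev_face hH hf hp']⟩
  -- Lower bounds on distances come from `sub_le_dist` with a test function `v w`: the distance to
  -- `w` in the unfolded pair of faces, truncated at `R - dist w z`. The branch `A` reads it in the
  -- face of `s`, and `B` in the face of `opp s`. Gluing along `s` exchanges the branches; on the
  -- other sides the truncation takes over, since no point of them is in the visible ball.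
  let A : ℂ → ℝ → F × ℂ → ℝ := fun w c q => if q.1 = s.1 then dist q.2 w else c
  let B : ℂ → ℝ → F × ℂ → ℝ := fun w c q =>
    if q.1 = (T.opp s).1 then dist (T.transfer (T.opp s) q.2) w else c
  let v : ℂ → F × ℂ → ℝ := fun w q =>
    min (R - dist w z) (min (A w (R - dist w z) q) (B w (R - dist w z) q))
  have hA : ∀ w s₀ ξ, (T.coord s₀ ξ).im = 0 → s₀ ≠ s →
      R - dist w z ≤ A w (R - dist w z) (s₀.1, ξ) := by
    intro w s₀ ξ h0 hne
    dsimp only [A]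
    split_ifs with h
    · by_contra! hlt
      have hb : ξ ∈ ball z R := by
        have := dist_triangle ξ w z
        rw [mem_ball]; linarith
      have hj : s₀.2 ≠ s.2 := fun h' => hne (Prod.ext h h')
      have := (hball ξ hb).2.1 _ hj
      rw [← h] at this
      exact absurd h0 this.ne'
    · exact le_rfl
  have hB : ∀ w s₀ ξ, ξ ∈ T.face s₀.1 → (T.coord s₀ ξ).im = 0 → s₀ ≠ T.opp s →
      R - dist w z ≤ B w (R - dist w z) (s₀.1, ξ) := by
    intro w s₀ ξ hξ h0 hne
    dsimp only [B]
    split_ifs with h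
    · by_contra! hlt
      have hb : T.transfer (T.opp s) ξ ∈ ball z R := by
        have := dist_triangle (T.transfer (T.opp s) ξ) w z
        rw [mem_ball]; linarith
      have hj : s₀.2 ≠ (T.opp s).2 := fun h' => hne (Prod.ext h h')
      have hle : (T.coord s (T.transfer (T.opp s) ξ)).im ≤ 0 := by
        have h1 := T.coord_transfer (T.opp s) ξ
        rw [T.opp_opp] at h1
        rw [h1, Complex.neg_im]
        rw [h] at hξ
        have h2 := (T.mem_face_iff _ _).1 hξ (T.opp s).2
        change 0 ≤ (T.coord (T.opp s) ξ).im at h2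
        linarith
      have := (hball _ hb).2.2 hle _ hj
      rw [T.transfer_transfer', ← h] at this
      exact absurd h0 this.ne'
    · exact le_rfl
  have hglue : ∀ w p q, T.Glued p q → v w p = v w q := by
    intro w p q hpq
    obtain ⟨s₀, h1, h2, h3, h4, h5, h6⟩ := hpq.exists_side
    obtain ⟨p1, ξ⟩ := p
    obtain ⟨q1, ξ'⟩ := q
    dsimp only at h1 h2 h3 h4 h5 h6
    subst h1 h2 h3
    have h4' : (T.coord (T.opp s₀) (T.transfer s₀ ξ)).im = 0 := by
      rw [T.coord_transfer, Complex.neg_im, h4, neg_zero]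
    dsimp only [v]
    set c := R - dist w z
    by_cases e1 : s₀ = s
    · subst e1
      have b1 := hB w s₀ ξ h5 h4 (T.opp_ne s₀).symm
      have a1 := hA w (T.opp s₀) _ h4' (T.opp_ne s₀)
      have e : A w c (s₀.1, ξ) = B w c ((T.opp s₀).1, T.transfer s₀ ξ) := by
        simp only [A, B, if_true, T.transfer_transfer]
      rw [← e, min_comm (A w c (s₀.1, ξ)) (B w c (s₀.1, ξ)), ← min_assoc, min_eq_left b1,
        ← min_assoc, min_eq_left a1]
    · have a1 := hA w s₀ ξ h4 e1
      by_cases e2 : s₀ = T.opp s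
      · have b1 := hB w (T.opp s₀) _ h6 h4' (by
          rw [e2, T.opp_opp]; exact (T.opp_ne s).symm)
        have e : B w c (s₀.1, ξ) = A w c ((T.opp s₀).1, T.transfer s₀ ξ) := by
          simp only [A, B, e2, if_true, T.opp_opp]
        rw [← e, min_comm (B w c (s₀.1, ξ)) (B w c ((T.opp s₀).1, _)), ← min_assoc,
          min_eq_left a1, ← min_assoc, min_eq_left b1]
      · have b1 := hB w s₀ ξ h5 h4 e2
        have a2 := hA w (T.opp s₀) _ h4' (fun h => e2 (by rw [← h, T.opp_opp]))
        have b2 := hB w (T.opp s₀) _ h6 h4' (fun h => e1 (by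
          rw [← T.opp_opp s₀, h, T.opp_opp]))
        rw [min_eq_left (le_min a1 b1), min_eq_left (le_min a2 b2)]
  have hlip : ∀ w f, ∀ ξ ∈ T.face f, ∀ ξ' ∈ T.face f, v w (f, ξ) - v w (f, ξ') ≤ dist ξ ξ' := by
    intro w f ξ _ ξ' _
    have hd := dist_nonneg (x := ξ) (y := ξ')
    have hAl : A w (R - dist w z) (f, ξ) ≤ dist ξ ξ' + A w (R - dist w z) (f, ξ') := by
      dsimp only [A]
      split_ifs
      · exact dist_triangle _ _ _
      · linarith
    have hBl : B w (R - dist w z) (f, ξ) ≤ dist ξ ξ' + B w (R - dist w z) (f, ξ') := by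
      dsimp only [B]
      split_ifs
      · have := dist_triangle (T.transfer (T.opp s) ξ) (T.transfer (T.opp s) ξ') w
        rwa [T.dist_transfer] at this
      · linarith
    rw [sub_le_iff_le_add]
    dsimp only [v]
    rw [← min_add_add_left, ← min_add_add_left]
    exact min_le_min (by linarith) (min_le_min hAl hBl)
  have hdist : ∀ w {f f' : F} {ξ ξ' : ℂ}, ξ ∈ T.face f → ξ' ∈ T.face f' →
      v w (f, ξ) - v w (f', ξ') ≤ dist (T.param f ξ) (T.param f' ξ') :=
    fun w _ _ _ _ hξ hξ' => T.sub_le_dist (v w) (hglue w) (hlip w) hξ hξ'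
  have hzero : ∀ w ∈ ball z R, ∃ f', ∃ ξ ∈ T.face f', T.dev s.1 w = T.param f' ξ ∧
      v w (f', ξ) ≤ 0 := by
    intro w hw
    rcases le_total 0 (T.coord s w).im with h | h
    · refine ⟨s.1, w, (hin w hw h).1, (hin w hw h).2, ?_⟩
      exact (min_le_right _ _).trans ((min_le_left _ _).trans (by simp [A]))
    · refine ⟨_, _, (hout w hw h).1, (hout w hw h).2, ?_⟩
      exact (min_le_right _ _).trans ((min_le_right _ _).trans (by simp [B]))
  -- With `R / 3`, two points of the small ball are at distance at most `2 * ε ≤ R - dist w z`, so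
  -- the truncation does not interfere. The bound `ε₁` handles a face glued to itself, where both
  -- branches of `v` are active.
  set ε := min (R / 3) ε₁ with hεdef
  have hε : 0 < ε := lt_min (by positivity) hε₁
  have hεR : ε ≤ R / 3 := min_le_left _ _
  have hε1 : ε ≤ ε₁ := min_le_right _ _
  have hbR : ball z ε ⊆ ball z R := ball_subset_ball (by linarith)
  have hb1 : ball z ε ⊆ ball z ε₁ := ball_subset_ball hε1
  have hbig : ∀ w ∈ ball z ε, ∀ x ∈ ball z ε, ∃ f', ∃ ξ ∈ T.face f', T.dev s.1 x = T.param f' ξ ∧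
      dist x w ≤ v w (f', ξ) := by
    intro w hw x hx
    have hw' := hw
    have hx' := hx
    rw [mem_ball] at hw' hx'
    have hxw : dist x w ≤ 2 * ε := by
      have := dist_triangle_right x w z; linarith
    have hc : dist x w ≤ R - dist w z := by linarith
    rcases le_or_gt 0 (T.coord s x).im with h | h
    · refine ⟨s.1, x, (hin x (hbR hx) h).1, (hin x (hbR hx) h).2, le_min hc (le_min ?_ ?_)⟩
      · simp [A]
      · dsimp only [B]
        split_ifs with hf
        · have := (hsep hf.symm x (hb1 hx) w (hb1 hw)).1
          linarith
        · exact hc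
    · refine ⟨_, _, (hout x (hbR hx) h.le).1, (hout x (hbR hx) h.le).2,
        le_min hc (le_min ?_ ?_)⟩
      · dsimp only [A]
        split_ifs with hf
        · have := (hsep hf x (hb1 hx) w (hb1 hw)).2 h
          linarith
        · exact hc
      · simp [B]
  -- Upper bound for points in different faces: cut the planar segment where it crosses the common
  -- side.
  have hsub : ∀ x ∈ ball z ε, ∀ w ∈ ball z ε, 0 ≤ (T.coord s x).im → (T.coord s w).im ≤ 0 →
      dist (T.dev s.1 x) (T.dev s.1 w) ≤ dist x w := by
    intro x hx w hw h1 h2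
    obtain ⟨y, hy, h0⟩ := exists_mem_segment_of_im (g := fun x => (T.coord s x).im)
      (Complex.continuous_im.comp (T.continuous_coord s)) h1 h2
    have hyb : y ∈ ball z R := hbR ((convex_ball z ε).segment_subset hx hw hy)
    have d1 := T.dist_param_le s.1 x (hin x (hbR hx) h1).1 y (hin y hyb h0.ge).1
    have d2 := T.dist_param_le (T.opp s).1 _ (hout y hyb h0.le).1 _ (hout w (hbR hw) h2).1
    rw [← (hin x (hbR hx) h1).2, ← (hin y hyb h0.ge).2] at d1
    rw [← (hout y hyb h0.le).2, ← (hout w (hbR hw) h2).2, T.dist_transfer] at d2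
    rw [← dist_add_dist_of_mem_segment hy]
    exact (dist_triangle _ _ _).trans (add_le_add d1 d2)
  refine ⟨ε, hε, fun x hx w hw => le_antisymm ?_ ?_, fun p hpp => ?_⟩
  · rcases le_total 0 (T.coord s x).im with h1 | h1 <;>
      rcases le_total 0 (T.coord s w).im with h2 | h2
    · rw [(hin x (hbR hx) h1).2, (hin w (hbR hw) h2).2]
      exact T.dist_param_le _ _ (hin x (hbR hx) h1).1 _ (hin w (hbR hw) h2).1
    · exact hsub x hx w hw h1 h2
    · rw [dist_comm, dist_comm x]
      exact hsub w hw x hx h2 h1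
    · rw [(hout x (hbR hx) h1).2, (hout w (hbR hw) h2).2, ← T.dist_transfer s x w]
      exact T.dist_param_le _ _ (hout x (hbR hx) h1).1 _ (hout w (hbR hw) h2).1
  · obtain ⟨f₁, ξ₁, hξ₁, e₁, h1⟩ := hbig w hw x hx
    obtain ⟨f₂, ξ₂, hξ₂, e₂, h2⟩ := hzero w (hbR hw)
    rw [e₁, e₂]
    have := hdist w hξ₁ hξ₂
    linarith
  · obtain ⟨f₁, ξ, hξ, rfl⟩ := T.param_surjective p
    obtain ⟨f₂, ξ₂, hξ₂, e₂, h2⟩ := hzero z (mem_ball_self hR)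
    have hd := hdist z hξ hξ₂
    rw [mem_ball, e₂] at hpp
    have hv : v z (f₁, ξ) < ε := by linarith
    have hc : ε ≤ R - dist z z := by rw [dist_self]; linarith
    simp only [v, min_lt_iff] at hv
    rcases hv with h | h | h
    · linarith
    · dsimp only [A] at h
      split_ifs at h with hf
      · subst hf
        have h0 : 0 ≤ (T.coord s ξ).im := (T.mem_face_iff _ _).1 hξ s.2
        exact ⟨ξ, h, (hin ξ (hbR h) h0).2⟩
      · linarith
    · dsimp only [B] at h
      split_ifs at h with hf
      · subst hf
        have h0 : (T.coord s (T.transfer (T.opp s) ξ)).im ≤ 0 := by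
          have h1 := T.coord_transfer (T.opp s) ξ
          rw [T.opp_opp] at h1
          rw [h1, Complex.neg_im, neg_nonpos]
          exact (T.mem_face_iff _ _).1 hξ (T.opp s).2
        refine ⟨_, h, ?_⟩
        rw [(hout _ (hbR h) h0).2, T.transfer_transfer']
      · linarith

end GeodesicTriangulation

/-! ### Existence and uniqueness of the circumscribed disks. -/

namespace Gluing

variable {F : Type*} (G : Gluing F)

theorem face_subset_closedBall (f : F) :
    G.face f ⊆ closedBall (G.center f) (dist (G.corner f 0) (G.center f)) := by
  refine convexHull_min ?_ (convex_closedBall _ _)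
  rintro x (rfl | rfl | rfl) <;> rw [← pow_nonpos_iff_mem_closedBall, pow_corner]

theorem pow_neg_of_mem_interior {f : F} {z : ℂ} (hz : z ∈ interior (G.face f)) :
    G.pow f z < 0 := by
  have h := interior_mono (G.face_subset_closedBall f) hz
  rw [interior_closedBall _ (by
    rw [dist_ne_zero]
    intro h
    have := G.normSq_corner_pos f
    rw [h] at this
    simp at this), ← pow_neg_iff_mem_ball] at h
  exact h

theorem nonempty_interior_face (f : F) : (interior (G.face f)).Nonempty := by
  -- The centroid: in this coordinate the corners are `-1`, `1` and the apex.
  refine ⟨G.frame (f, 0) (G.apex (f, 0) / 3), ?_⟩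
  have hy := G.apex_im_pos (f, 0)
  have e1 : (G.apex (f, 0) / 3).im = (G.apex (f, 0)).im / 3 := by simp
  have e2 : (G.apex (f, 0) / 3).re = (G.apex (f, 0)).re / 3 := by simp
  rw [mem_interior_face_iff]
  intro i
  have hi : ∀ i : Fin 3, i = 0 ∨ i = 0 + 1 ∨ i = 0 + 2 := by decide
  rcases hi i with h | h | h <;> rw [h]
  · rw [coord_frame, e1]; positivity
  · have h1 := G.normSq_half_pos (f, 0)
    have h2 := G.normSq_half_pos (f, 0 + 1)
    have := G.im_coord_succ (f, 0) (G.frame (f, 0) (G.apex (f, 0) / 3))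
    dsimp only at this
    rw [this, coord_frame, e1, e2]
    refine mul_pos (by positivity) ?_
    linarith
  · have h1 := G.normSq_half_pos (f, 0)
    have h2 := G.normSq_half_pos (f, 0 + 2)
    have := G.im_coord_succ_succ (f, 0) (G.frame (f, 0) (G.apex (f, 0) / 3))
    dsimp only at this
    rw [this, coord_frame, e1, e2]
    refine mul_pos (by positivity) ?_
    linarith

theorem face_subset_closure_interior (f : F) : G.face f ⊆ closure (interior (G.face f)) := by
  rw [(G.convex_face f).closure_interior_eq_closure_of_nonempty_interior
    (G.nonempty_interior_face f)]
  exact subset_closure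

end Gluing

/-- A planar point is determined by its distances to the points of a disk. -/
theorem eq_of_dist_eq {x y c : ℂ} {r : ℝ} (hr : 0 < r)
    (h : ∀ q ∈ ball c r, dist x q = dist y q) : x = y := by
  have h0 := h c (mem_ball_self hr)
  have h1 := h (c + (r / 2 : ℝ)) (by
    rw [mem_ball, dist_eq_norm, add_sub_cancel_left, Complex.norm_real, Real.norm_of_nonneg]
    <;> linarith)
  have h2 := h (c + (r / 2 : ℝ) * Complex.I) (by
    rw [mem_ball, dist_eq_norm, add_sub_cancel_left, norm_mul, Complex.norm_real,
      Real.norm_of_nonneg, Complex.norm_I]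
    <;> linarith)
  have key : ∀ q, dist x q = dist y q → Complex.normSq (x - q) = Complex.normSq (y - q) := by
    intro q hq
    rw [Complex.normSq_eq_norm_sq, Complex.normSq_eq_norm_sq, ← dist_eq_norm, ← dist_eq_norm, hq]
  have h0 := key _ h0
  have h1 := key _ h1
  have h2 := key _ h2
  simp [Complex.normSq_apply] at h0 h1 h2
  have hr' := hr.ne'
  apply Complex.ext
  · have : r * x.re = r * y.re := by linarith
    exact mul_left_cancel₀ hr' this
  · have : r * x.im = r * y.im := by linarith
    exact mul_left_cancel₀ hr' this

/-- A map of a convex set that is an isometry near each point does not increase distances. -/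
theorem dist_le_of_locally_isometric {S : Type*} [MetricSpace S] {g : ℂ → S} {U : Set ℂ}
    (hU : Convex ℝ U)
    (hg : ∀ x ∈ U, ∃ ε > 0, ∀ a ∈ ball x ε, ∀ b ∈ ball x ε, dist (g a) (g b) = dist a b)
    {x y : ℂ} (hx : x ∈ U) (hy : y ∈ U) : dist (g x) (g y) ≤ dist x y := by
  have hcont : ∀ x ∈ U, ContinuousAt g x := by
    intro x hx
    obtain ⟨ε, hε, h⟩ := hg x hx
    rw [Metric.continuousAt_iff]
    intro δ hδ
    refine ⟨min ε δ, lt_min hε hδ, fun {z} hz => ?_⟩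
    rw [h z (hz.trans_le (min_le_left _ _)) x (mem_ball_self hε)]
    exact hz.trans_le (min_le_right _ _)
  let γ : ℝ → ℂ := fun t => AffineMap.lineMap x y t
  have hγU : ∀ t ∈ Icc (0 : ℝ) 1, γ t ∈ U := fun t ht =>
    hU.segment_subset hx hy (by rw [segment_eq_image_lineMap]; exact mem_image_of_mem _ ht)
  have hγ : Continuous γ := AffineMap.lineMap_continuous
  have hγd : ∀ t t', dist (γ t) (γ t') = dist t t' * dist x y := fun t t' => by
    simp [γ]
  -- Continuity induction along the segment: the set is closed in the interval, and the local
  -- isometry prolongs the estimate beyond each of its points.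
  let A : Set ℝ := {t | dist (g x) (g (γ t)) ≤ t * dist x y}
  have hA : Icc (0 : ℝ) 1 ⊆ A := by
    refine IsClosed.Icc_subset_of_forall_exists_gt ?_ (by simp [A, γ]) ?_
    · have : ContinuousOn (fun t => t * dist x y - dist (g x) (g (γ t))) (Icc 0 1) := by
        refine ContinuousOn.sub (by fun_prop) (fun t ht => ?_)
        have : ContinuousAt (fun t => dist (g x) (g (γ t))) t :=
          continuousAt_const.dist (((hcont _ (hγU t ht)).comp hγ.continuousAt))
        exact this.continuousWithinAt
      have := this.preimage_isClosed_of_isClosed isClosed_Icc (isClosed_Ici (a := (0 : ℝ)))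
      convert this using 1
      ext t
      simp [A, and_comm]
    · rintro t ⟨htA, ht⟩ t' ht'
      obtain ⟨ε, hε, h⟩ := hg _ (hγU t ⟨ht.1, ht.2.le⟩)
      have hd := dist_nonneg (x := x) (y := y)
      -- The added `1` covers the case `x = y`; the displacement along the segment stays below `ε`.
      refine ⟨min t' (t + ε / (2 * (dist x y + 1))), ?_, ?_, min_le_left _ _⟩
      · set τ := min t' (t + ε / (2 * (dist x y + 1))) with hτ
        have h1 : t < τ := lt_min ht' (by linarith [div_pos hε (by positivity :
          0 < 2 * (dist x y + 1))])
        have h2 : τ - t ≤ ε / (2 * (dist x y + 1)) := by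
          have := min_le_right t' (t + ε / (2 * (dist x y + 1)))
          linarith
        have h3 : dist (γ τ) (γ t) = (τ - t) * dist x y := by
          rw [hγd, Real.dist_eq, abs_of_pos (by linarith)]
        have h4 : (τ - t) * dist x y < ε := by
          rw [le_div_iff₀ (by positivity)] at h2
          nlinarith
        have h5 := h (γ t) (mem_ball_self hε) (γ τ) (by rw [mem_ball, h3]; exact h4)
        have h6 := dist_triangle (g x) (g (γ t)) (g (γ τ))
        rw [h5, dist_comm, dist_comm (γ t), h3] at h6
        change dist (g x) (g (γ τ)) ≤ _
        have : dist (g x) (g (γ t)) ≤ t * dist x y := htA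
        rw [dist_comm]
        linarith
      · exact lt_min ht' (by linarith [div_pos hε (by positivity :
          0 < 2 * (dist x y + 1))])
  have := hA ⟨zero_le_one, le_rfl⟩
  simpa [A, γ] using this

namespace GeodesicTriangulation

variable {S : Type*} [MetricSpace S] {F : Type*} (T : GeodesicTriangulation S F)

/-- `g` is an orientation-preserving isometry of a planar disk centered at `x` onto a disk of the
surface, centered at a point other than a vertex. -/
structure FlatAt (g : ℂ → S) (x : ℂ) : Prop where
  iso : ∃ ε > 0, (∀ a ∈ ball x ε, ∀ b ∈ ball x ε, dist (g a) (g b) = dist a b) ∧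
    ∀ p ∈ ball (g x) ε, ∃ a ∈ ball x ε, g a = p
  orient : ∀ f, ∀ y ∈ interior (T.face f), g x = T.param f y →
    ∃ u : ℂ, ‖u‖ = 1 ∧ ∀ᶠ z in 𝓝 x, g z = T.param f (y + u * (z - x))
  not_vertex : g x ∉ T.vertices

variable {T}

/-- An isometry preserves the distance to the center, so surjectivity onto a ball passes to all
smaller concentric balls, and the radius may be shrunk at will. -/
theorem FlatAt.exists_ball {g : ℂ → S} {x : ℂ} (h : T.FlatAt g x) {P : ℂ → Prop}
    (hP : ∀ᶠ z in 𝓝 x, P z) : ∃ ε > 0, (∀ z ∈ ball x ε, P z) ∧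
      (∀ a ∈ ball x ε, ∀ b ∈ ball x ε, dist (g a) (g b) = dist a b) ∧
      ∀ δ ≤ ε, ∀ p ∈ ball (g x) δ, ∃ a ∈ ball x δ, g a = p := by
  obtain ⟨ε, hε, hiso, honto⟩ := h.iso
  obtain ⟨ε', hε', h'⟩ := Metric.eventually_nhds_iff_ball.1 hP
  refine ⟨min ε ε', lt_min hε hε', fun z hz => h' z (ball_subset_ball (min_le_right _ _) hz),
    fun a ha b hb => hiso a (ball_subset_ball (min_le_left _ _) ha) b
      (ball_subset_ball (min_le_left _ _) hb), fun δ hδ p hp => ?_⟩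
  have hδ' := hδ.trans (min_le_left _ _)
  obtain ⟨a, ha, rfl⟩ := honto p (ball_subset_ball hδ' hp)
  refine ⟨a, ?_, rfl⟩
  rwa [mem_ball, hiso a ha x (mem_ball_self hε)] at hp

theorem FlatAt.congr {g g' : ℂ → S} {x : ℂ} (h : T.FlatAt g x) (he : g' =ᶠ[𝓝 x] g) :
    T.FlatAt g' x := by
  obtain ⟨ε, hε, h1, h2, h3⟩ := h.exists_ball he
  have hx := h1 x (mem_ball_self hε)
  refine ⟨⟨ε, hε, fun a ha b hb => by rw [h1 a ha, h1 b hb, h2 a ha b hb], fun p hp => ?_⟩, ?_, ?_⟩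
  · rw [hx] at hp
    obtain ⟨a, ha, rfl⟩ := h3 ε le_rfl p hp
    exact ⟨a, ha, h1 a ha⟩
  · intro f y hy hxy
    obtain ⟨u, hu, hu'⟩ := h.orient f y hy (hx ▸ hxy)
    refine ⟨u, hu, ?_⟩
    filter_upwards [hu', he] with z hz hz'
    rw [hz', hz]
  · rw [hx]; exact h.not_vertex

theorem FlatAt.comp_transfer {g : ℂ → S} {s : F × Fin 3} {x : ℂ}
    (h : T.FlatAt g (T.transfer s x)) : T.FlatAt (fun z => g (T.transfer s z)) x := by
  obtain ⟨ε, hε, h1, h2⟩ := h.iso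
  have hb : ∀ a ∈ ball x ε, T.transfer s a ∈ ball (T.transfer s x) ε := by
    intro a ha
    rwa [mem_ball, T.dist_transfer]
  refine ⟨⟨ε, hε, fun a ha b hb' => ?_, fun p hp => ?_⟩, ?_, h.not_vertex⟩
  · rw [h1 _ (hb a ha) _ (hb b hb'), T.dist_transfer]
  · obtain ⟨a, ha, rfl⟩ := h2 p hp
    refine ⟨T.transfer (T.opp s) a, ?_, by rw [T.transfer_transfer']⟩
    rw [mem_ball, ← T.dist_transfer s, T.transfer_transfer']
    exact ha
  · intro f y hy hxy
    obtain ⟨u, hu, hu'⟩ := h.orient f y hy hxy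
    refine ⟨u * T.rot s, by rw [norm_mul, hu, T.norm_rot, one_mul], ?_⟩
    filter_upwards [(T.continuous_transfer s).continuousAt.eventually hu'] with z hz
    rw [hz, T.transfer_sub s z x]
    congr 1
    ring

theorem FlatAt.continuousAt {g : ℂ → S} {x : ℂ} (h : T.FlatAt g x) : ContinuousAt g x := by
  obtain ⟨ε, hε, h, -⟩ := h.iso
  rw [Metric.continuousAt_iff]
  intro δ hδ
  refine ⟨min ε δ, lt_min hε hδ, fun {z} hz => ?_⟩
  rw [h z (hz.trans_le (min_le_left _ _)) x (mem_ball_self hε)]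
  exact hz.trans_le (min_le_right _ _)

theorem isFlatImmersionOn_of_flatAt {g : ℂ → S} {U : Set ℂ} (hU : IsOpen U)
    (h : ∀ x ∈ U, T.FlatAt g x) : T.IsFlatImmersionOn g U := by
  refine ⟨fun x hx => ?_, fun x hx => (h x hx).orient⟩
  obtain ⟨ε, hε, h1, h2, -⟩ := (h x hx).exists_ball (hU.eventually_mem hx)
  exact ⟨ε, hε, h1, h2⟩

/-- The power is well defined on the surface and vanishes at the vertices. -/
theorem param_not_vertex {f : F} {z : ℂ} (hz : z ∈ T.face f) (hp : T.pow f z < 0) :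
    T.param f z ∉ T.vertices := by
  rintro ⟨f', i, h⟩
  have := T.pow_eq_of_param_eq (T.corner_mem_face f' i) hz h
  rw [T.pow_corner] at this
  linarith

theorem compactSpace [Finite F] (T : GeodesicTriangulation S F) : CompactSpace S := by
  refine ⟨?_⟩
  have : (univ : Set S) = ⋃ f, T.param f '' T.face f := by
    symm
    rw [eq_univ_iff_forall]
    intro x
    obtain ⟨f, z, hz, rfl⟩ := T.param_surjective x
    exact mem_iUnion.2 ⟨f, z, hz, rfl⟩
  rw [this]
  exact isCompact_iUnion fun f => (T.isCompact_face f).image_of_continuousOn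
    (T.continuousOn_param f)

theorem closure_disk (f : F) : closure {z | T.pow f z < 0} =
    closedBall (T.center f) (dist (T.corner f 0) (T.center f)) := by
  have : {z | T.pow f z < 0} = ball (T.center f) (dist (T.corner f 0) (T.center f)) := by
    ext z; exact T.pow_neg_iff_mem_ball f z
  rw [this, closure_ball]
  rw [dist_ne_zero]
  intro h
  have := T.normSq_corner_pos f
  rw [h] at this
  simp at this

section

variable (hH : ∀ s, 0 < T.height s + T.height (T.opp s)) [Finite F]
include hH

/-- By `disk_induction`: on the face this is the local isometry statement, and beyond a side the
development is that of the adjacent disk composed with a direct planar isometry. -/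
theorem flatAt_dev {f : F} {z : ℂ} (hz : T.pow f z < 0) : T.FlatAt (T.dev f) z := by
  refine Gluing.disk_induction hH (P := fun f z => T.FlatAt (T.dev f) z) ?_ ?_ f z hz
  · intro f z hf hz
    refine ⟨exists_isometric_of_mem_face hH hf hz, fun f' y hy h => ?_, ?_⟩
    · rw [dev_face hH hf hz] at h
      obtain ⟨rfl, rfl⟩ := T.eq_of_param_eq hf hy h
      refine ⟨1, norm_one, ?_⟩
      filter_upwards [mem_interior_iff_mem_nhds.1 hy, (T.isOpen_disk f).mem_nhds hz] with x hx hx'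
      rw [one_mul, add_sub_cancel, dev_face hH hx hx']
    · rw [dev_face hH hf hz]
      exact param_not_vertex hf hz
  · intro f i z hz hi h
    refine h.comp_transfer.congr ?_
    have h1 : ∀ᶠ x in 𝓝 z, (T.coord (f, i) x).im < 0 :=
      (Complex.continuous_im.comp (T.continuous_coord (f, i))).continuousAt.eventually_lt_const hi
    filter_upwards [(T.isOpen_disk f).mem_nhds hz, h1] with x hx hx'
    exact dev_step hH (s := (f, i)) hx hx'

theorem dist_dev_le {f : F} {z z' : ℂ} (hz : T.pow f z < 0) (hz' : T.pow f z' < 0) :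
    dist (T.dev f z) (T.dev f z') ≤ dist z z' := by
  refine dist_le_of_locally_isometric (U := {z | T.pow f z < 0}) ?_ ?_ hz hz'
  · have : {z | T.pow f z < 0} = ball (T.center f) (dist (T.corner f 0) (T.center f)) := by
      ext z; exact T.pow_neg_iff_mem_ball f z
    rw [this]
    exact convex_ball _ _
  · intro x hx
    obtain ⟨ε, hε, h, -⟩ := (flatAt_dev hH hx).iso
    exact ⟨ε, hε, h⟩

theorem lipschitzOnWith_dev (f : F) : LipschitzOnWith 1 (T.dev f) {z | T.pow f z < 0} :=
  LipschitzOnWith.of_dist_le_mul fun x hx y hy => by simpa using dist_dev_le hH hx hy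

/-- The open disk is convex, so the development does not increase distances there and takes points
converging to `x` to a Cauchy filter; the compact surface is complete. -/
theorem exists_tendsto_dev {f : F} {x : ℂ} (hx : x ∈ closure {z | T.pow f z < 0}) :
    ∃ p, Filter.Tendsto (T.dev f) (𝓝[{z | T.pow f z < 0}] x) (𝓝 p) := by
  have := compactSpace T
  have hne := mem_closure_iff_nhdsWithin_neBot.1 hx
  apply cauchy_iff_exists_le_nhds.1
  rw [Metric.cauchy_iff]
  refine ⟨hne.map _, fun ε hε => ?_⟩
  refine ⟨T.dev f '' ({z | T.pow f z < 0} ∩ ball x (ε / 2)), Filter.image_mem_map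
    (Filter.inter_mem self_mem_nhdsWithin
      (mem_nhdsWithin_of_mem_nhds (ball_mem_nhds x (by positivity)))), ?_⟩
  rintro _ ⟨a, ⟨ha, ha'⟩, rfl⟩ _ ⟨b, ⟨hb, hb'⟩, rfl⟩
  have h1 := dist_dev_le hH ha hb
  have h2 := dist_triangle_right a b x
  rw [mem_ball] at ha' hb'
  linarith

/-- The map is the continuous extension of the development to the closed disk. It agrees with the
parametrization on the interior of the face, which is dense in the face. -/
theorem nonempty_circumdisk (f : F) : Nonempty (T.Circumdisk f) := by
  have hcont : ContinuousOn (extendFrom {z | T.pow f z < 0} (T.dev f))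
      (closedBall (T.center f) (dist (T.corner f 0) (T.center f))) := by
    rw [← closure_disk]
    exact continuousOn_extendFrom subset_rfl fun x hx => exists_tendsto_dev hH hx
  have heq : ∀ x, T.pow f x < 0 → extendFrom {z | T.pow f z < 0} (T.dev f) x = T.dev f x := by
    intro x hx
    refine extendFrom_eq (subset_closure hx) ?_
    exact (flatAt_dev hH hx).continuousAt.continuousWithinAt
  refine ⟨⟨T.center f, dist (T.corner f 0) (T.center f), fun i => ?_,
    extendFrom {z | T.pow f z < 0} (T.dev f), hcont, ?_, ?_⟩⟩
  · have := T.normSq_corner_sub_center f i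
    rw [Complex.normSq_eq_norm_sq, Complex.normSq_eq_norm_sq,
      sq_eq_sq₀ (norm_nonneg _) (norm_nonneg _)] at this
    rw [dist_eq_norm, dist_eq_norm, this]
  · refine isFlatImmersionOn_of_flatAt isOpen_ball fun x hx => ?_
    rw [← T.pow_neg_iff_mem_ball] at hx
    refine (flatAt_dev hH hx).congr ?_
    filter_upwards [(T.isOpen_disk f).mem_nhds hx] with y hy
    exact heq y hy
  · have h1 : EqOn (extendFrom {z | T.pow f z < 0} (T.dev f)) (T.param f)
        (interior (T.face f)) := by
      intro x hx
      have hp := T.pow_neg_of_mem_interior hx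
      rw [heq x hp, dev_face hH (interior_subset hx) hp]
    exact h1.of_subset_closure (hcont.mono (T.face_subset_closedBall f)) (T.continuousOn_param f)
      interior_subset (T.face_subset_closure_interior f)

end

namespace Circumdisk

variable {f : F} (D : T.Circumdisk f)

theorem center_eq : D.center = T.center f := by
  have h : ∀ i, Complex.normSq (T.corner f i - D.center) =
      Complex.normSq (T.corner f 0 - D.center) := by
    intro i
    rw [Complex.normSq_eq_norm_sq, Complex.normSq_eq_norm_sq, ← dist_eq_norm, ← dist_eq_norm,
      D.dist_corner, D.dist_corner]
  have h1 := h 1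
  have h2 := h 2
  have k1 := T.normSq_corner_sub_center f 1
  have k2 := T.normSq_corner_sub_center f 2
  have hO := (T.corner_ccw f).ne'
  simp only [Complex.normSq_apply, Complex.sub_re, Complex.sub_im] at h1 h2 k1 k2
  apply Complex.ext
  · apply mul_left_cancel₀ hO
    simp only [orient, Complex.sub_re, Complex.sub_im]
    linear_combination (-1 / 2) * ((T.corner f 2).im - (T.corner f 0).im) * (h1 - k1) +
      (1 / 2) * ((T.corner f 1).im - (T.corner f 0).im) * (h2 - k2)
  · apply mul_left_cancel₀ hO
    simp only [orient, Complex.sub_re, Complex.sub_im]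
    linear_combination (1 / 2) * ((T.corner f 2).re - (T.corner f 0).re) * (h1 - k1) -
      (1 / 2) * ((T.corner f 1).re - (T.corner f 0).re) * (h2 - k2)

theorem radius_eq : D.radius = dist (T.corner f 0) (T.center f) := by
  rw [← D.dist_corner 0, D.center_eq]

theorem continuousOn_closedDisk : ContinuousOn D.map {z | T.pow f z ≤ 0} := by
  have h := D.continuousOn_map
  rw [D.center_eq, D.radius_eq] at h
  exact h.mono fun z hz => (T.pow_nonpos_iff_mem_closedBall f z).1 hz

/-- An identity principle: two local isometries that agree near a point of the face agree on the
connected disk. The set where they agree locally is open; it is relatively closed because a planar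
isometry is determined on any small disk. -/
theorem map_eq_dev (hH : ∀ s, 0 < T.height s + T.height (T.opp s)) [Finite F] {z : ℂ}
    (hz : T.pow f z < 0) : D.map z = T.dev f z := by
  have hball : {z | T.pow f z < 0} = ball (T.center f) (dist (T.corner f 0) (T.center f)) := by
    ext z; exact T.pow_neg_iff_mem_ball f z
  let u : Set ℂ := {x | T.pow f x < 0 ∧ ∀ᶠ z in 𝓝 x, D.map z = T.dev f z}
  have hcont : ∀ x, T.pow f x < 0 → ContinuousAt D.map x := fun x hx =>
    D.continuousOn_closedDisk.continuousAt
      (Filter.mem_of_superset ((T.isOpen_disk f).mem_nhds hx) fun y hy => le_of_lt (show T.pow f y < 0 from hy))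
  have hu : IsOpen u := (T.isOpen_disk f).inter isOpen_setOfPred_eventually_nhds
  have hne : ({z | T.pow f z < 0} ∩ u).Nonempty := by
    obtain ⟨x, hx⟩ := T.nonempty_interior_face f
    have hp := T.pow_neg_of_mem_interior hx
    refine ⟨x, hp, hp, ?_⟩
    filter_upwards [mem_interior_iff_mem_nhds.1 hx, (T.isOpen_disk f).mem_nhds hp] with y hy hy'
    rw [dev_face hH hy hy', D.map_eq_param hy]
  have hpre : IsPreconnected {z | T.pow f z < 0} := by
    rw [hball]; exact (convex_ball _ _).isPreconnected
  suffices h : {z | T.pow f z < 0} ⊆ u from (h hz).2.self_of_nhds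
  refine hpre.subset_of_closure_inter_subset hu hne ?_
  rintro x ⟨hx, hxp⟩
  refine ⟨hxp, ?_⟩
  have hdx := flatAt_dev hH hxp
  have hxe : D.map x = T.dev f x := by
    have hne : (𝓝[u] x).NeBot := mem_closure_iff_nhdsWithin_neBot.1 hx
    have h1 : Filter.Tendsto D.map (𝓝[u] x) (𝓝 (D.map x)) := (hcont x hxp).continuousWithinAt
    have h2 : Filter.Tendsto (T.dev f) (𝓝[u] x) (𝓝 (T.dev f x)) :=
      hdx.continuousAt.continuousWithinAt
    refine tendsto_nhds_unique (h1.congr' ?_) h2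
    filter_upwards [self_mem_nhdsWithin] with y hy
    exact hy.2.self_of_nhds
  obtain ⟨ε₁, hε₁, -, hiso₁⟩ := D.flat_map.1 x (by
    rw [D.center_eq, D.radius_eq, ← T.pow_neg_iff_mem_ball]; exact hxp)
  obtain ⟨ε, hε, hP, hiso, honto⟩ := hdx.exists_ball (ball_mem_nhds x hε₁)
  obtain ⟨x₀, hx₀u, hx₀⟩ := Metric.mem_closure_iff.1 hx ε hε
  have hx₀b : ball x ε ∈ 𝓝 x₀ := isOpen_ball.mem_nhds (by rwa [mem_ball, dist_comm])
  obtain ⟨η, hη, hη'⟩ := Metric.eventually_nhds_iff_ball.1 (hx₀u.2.and hx₀b)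
  filter_upwards [ball_mem_nhds x hε] with z hz
  have h1 : D.map z ∈ ball (T.dev f x) ε := by
    rw [mem_ball, ← hxe, hiso₁ z (hP z hz) x (mem_ball_self hε₁)]
    exact hz
  obtain ⟨y, hy, hyz⟩ := honto ε le_rfl _ h1
  -- Near the limit point `x` both maps are isometric, and they coincide on a small disk around
  -- `x₀`. So `y` and `z` have equal distances to all points of that disk.
  have : y = z := by
    refine eq_of_dist_eq (c := x₀) hη fun q hq => ?_
    obtain ⟨hq1, hq2⟩ := hη' q hq
    rw [← hiso y hy q hq2, hyz, ← hq1, hiso₁ z (hP z hz) q (hP q hq2)]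
  rw [← hyz, this]

end Circumdisk

end GeodesicTriangulation

/-! ### Signed indicators of triangles and the kite in normalized coordinates. -/

/-- `1` if the three numbers are positive, `-1` if they are negative, `0` otherwise. -/
noncomputable def commonSign (x y w : ℝ) : ℤ :=
  if 0 < x ∧ 0 < y ∧ 0 < w then 1 else if x < 0 ∧ y < 0 ∧ w < 0 then -1 else 0

/-- The signed indicator of the open triangle `a b c`. -/
noncomputable def chi (a b c z : ℂ) : ℤ :=
  commonSign (orient a b z) (orient b c z) (orient c a z)

theorem commonSign_neg (x y w : ℝ) : commonSign (-x) (-y) (-w) = -commonSign x y w := by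
  unfold commonSign
  simp only [Left.neg_pos_iff, Left.neg_neg_iff]
  split_ifs with h1 h2
  · linarith [h1.1, h2.1]
  all_goals rfl

theorem commonSign_swap (x y w : ℝ) : commonSign x w y = commonSign x y w := by
  unfold commonSign
  congr 1
  · exact propext ⟨fun h => ⟨h.1, h.2.2, h.2.1⟩, fun h => ⟨h.1, h.2.2, h.2.1⟩⟩
  · congr 1
    exact propext ⟨fun h => ⟨h.1, h.2.2, h.2.1⟩, fun h => ⟨h.1, h.2.2, h.2.1⟩⟩

theorem orient_swap (a b z : ℂ) : orient b a z = -orient a b z := by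
  unfold orient; simp only [Complex.sub_re, Complex.sub_im]; ring

theorem chi_swap (a b c z : ℂ) : chi b a c z = -chi a b c z := by
  unfold chi
  rw [orient_swap a b, orient_swap c a, orient_swap b c, commonSign_neg, commonSign_swap]

/-- The sign form of the cone decomposition of a triangle. The hypothesis `h` is the Plücker
relation among the six orientations; in each of the 64 sign patterns either the counts agree or this
relation is violated. -/
theorem commonSign_cocycle {x y w p q r : ℝ} (hx : x ≠ 0) (hy : y ≠ 0) (hw : w ≠ 0)
    (hp : p ≠ 0) (hq : q ≠ 0) (hr : r ≠ 0) (h : x * r + y * p + w * q = 0) :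
    commonSign x y w = commonSign x q (-p) + commonSign y r (-q) + commonSign w p (-r) := by
  rcases lt_or_gt_of_ne hx with hx | hx <;> rcases lt_or_gt_of_ne hy with hy | hy <;>
  rcases lt_or_gt_of_ne hw with hw | hw <;> rcases lt_or_gt_of_ne hp with hp | hp <;>
  rcases lt_or_gt_of_ne hq with hq | hq <;> rcases lt_or_gt_of_ne hr with hr | hr <;>
  first
  | (simp [commonSign, hx, hy, hw, hp, hq, hr, not_lt.2 hx.le, not_lt.2 hy.le, not_lt.2 hw.le,
      not_lt.2 hp.le, not_lt.2 hq.le, not_lt.2 hr.le]; done)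
  | (exfalso; clear * - h hx hy hw hp hq hr; nlinarith)

/-- A triangle is the signed sum of the triangles joining its sides to `o`, wherever `o` is. This is
what permits circumcenters outside their faces. -/
theorem chi_cocycle {a b c o z : ℂ} (hab : orient a b z ≠ 0) (hbc : orient b c z ≠ 0)
    (hca : orient c a z ≠ 0) (hao : orient a o z ≠ 0) (hbo : orient b o z ≠ 0)
    (hco : orient c o z ≠ 0) : chi a b c z = chi a b o z + chi b c o z + chi c a o z := by
  unfold chi
  rw [orient_swap a o, orient_swap b o, orient_swap c o]
  refine commonSign_cocycle hab hbc hca hao hbo hco ?_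
  unfold orient; simp only [Complex.sub_re, Complex.sub_im]; ring

theorem chi_affine {m w : ℂ} (hw : w ≠ 0) (a b c z : ℂ) :
    chi (m + w * a) (m + w * b) (m + w * c) (m + w * z) = chi a b c z := by
  have := Complex.normSq_pos.2 hw
  have hneg : ∀ t, Complex.normSq w * t < 0 ↔ t < 0 := fun t => by
    rw [← neg_pos, ← mul_neg, mul_pos_iff_of_pos_left this, neg_pos]
  unfold chi commonSign
  simp only [orient_affine, mul_pos_iff_of_pos_left this, hneg]

/-- General position of a point in the normalized coordinate of a side, with respect to the
corners and the two circumcenters. -/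
def InGeneralPosition (h k : ℝ) (ζ : ℂ) : Prop :=
  ζ.re ≠ 0 ∧ ζ.im ≠ 0 ∧ ζ.im ≠ h * (1 - ζ.re) ∧ ζ.im ≠ h * (1 + ζ.re) ∧
    ζ.im ≠ -k * (1 - ζ.re) ∧ ζ.im ≠ -k * (1 + ζ.re)

theorem InGeneralPosition.neg {h k : ℝ} {ζ : ℂ} (hζ : InGeneralPosition h k ζ) :
    InGeneralPosition k h (-ζ) := by
  obtain ⟨h1, h2, h3, h4, h5, h6⟩ := hζ
  simp only [InGeneralPosition, Complex.neg_re, Complex.neg_im, ne_eq, neg_eq_zero]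
  refine ⟨h1, h2, fun h => h6 (by linarith), fun h => h5 (by linarith), fun h => h4 (by linarith),
    fun h => h3 (by linarith)⟩

/-- The signed indicator of the isosceles triangle with base `[-1, 1]` and apex `h * I`. -/
noncomputable def isoscelesSign (h : ℝ) (ζ : ℂ) : ℤ := chi (-1) 1 (h * Complex.I) ζ

theorem isoscelesSign_eq (h : ℝ) (ζ : ℂ) : isoscelesSign h ζ =
    commonSign (2 * ζ.im) (h * (1 - ζ.re) - ζ.im) (h * (1 + ζ.re) - ζ.im) := by
  unfold isoscelesSign chi orient
  congr 1 <;>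
    simp only [Complex.sub_re, Complex.sub_im, Complex.neg_re, Complex.neg_im, Complex.mul_re,
      Complex.mul_im, Complex.ofReal_re, Complex.ofReal_im, Complex.I_re, Complex.I_im,
      Complex.one_re, Complex.one_im] <;> ring

theorem isoscelesSign_ne_zero {h : ℝ} {ζ : ℂ} (hζ : isoscelesSign h ζ ≠ 0) :
    0 < ζ.im * (h * (1 - ζ.re) - ζ.im) ∧ 0 < ζ.im * (h * (1 + ζ.re) - ζ.im) := by
  rw [isoscelesSign_eq, commonSign] at hζ
  split_ifs at hζ with h1 h2
  · exact ⟨mul_pos (by linarith [h1.1]) h1.2.1, mul_pos (by linarith [h1.1]) h1.2.2⟩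
  · exact ⟨mul_pos_of_neg_of_neg (by linarith [h2.1]) h2.2.1,
      mul_pos_of_neg_of_neg (by linarith [h2.1]) h2.2.2⟩
  · exact absurd rfl hζ

/-- The isosceles triangle with apex at the circumcenter is inside the circle, and reaches it only
on the base. Off the base line, adding `h1` and `h2` gives `y ^ 2 ≤ h * y`, so `h3` forces `|x| >
1`, against one of `h1`, `h2`. -/
theorem im_eq_zero_of_isosceles {h : ℝ} {ζ : ℂ} (h1 : 0 ≤ ζ.im * (h * (1 - ζ.re) - ζ.im))
    (h2 : 0 ≤ ζ.im * (h * (1 + ζ.re) - ζ.im))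
    (h3 : 2 * h * ζ.im + 1 ≤ ζ.re ^ 2 + ζ.im ^ 2) : ζ.im = 0 := by
  by_contra hne
  have hpos : 0 < ζ.im ^ 2 := by positivity
  have hhy : ζ.im ^ 2 ≤ h * ζ.im := by nlinarith
  have hx : 1 < ζ.re ^ 2 := by nlinarith
  rcases lt_or_ge 0 ζ.re with hr | hr
  · have : 1 < ζ.re := by nlinarith
    nlinarith
  · have : ζ.re < -1 := by nlinarith
    nlinarith

/-- The open kite in the normalized coordinate. -/
def IsInOpenKite (h k : ℝ) (ζ : ℂ) : Prop :=
  |ζ.re| < 1 ∧ -k * (1 - |ζ.re|) < ζ.im ∧ ζ.im < h * (1 - |ζ.re|)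

/-- The closed kite in the normalized coordinate. -/
def IsInKite (h k : ℝ) (ζ : ℂ) : Prop :=
  |ζ.re| ≤ 1 ∧ -k * (1 - |ζ.re|) ≤ ζ.im ∧ ζ.im ≤ h * (1 - |ζ.re|)

theorem isInOpenKite_neg {h k : ℝ} {ζ : ℂ} : IsInOpenKite k h (-ζ) ↔ IsInOpenKite h k ζ := by
  simp only [IsInOpenKite, Complex.neg_re, Complex.neg_im, abs_neg]
  constructor <;> rintro ⟨h1, h2, h3⟩ <;> exact ⟨h1, by linarith, by linarith⟩

theorem isInKite_neg {h k : ℝ} {ζ : ℂ} : IsInKite k h (-ζ) ↔ IsInKite h k ζ := by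
  simp only [IsInKite, Complex.neg_re, Complex.neg_im, abs_neg]
  constructor <;> rintro ⟨h1, h2, h3⟩ <;> exact ⟨h1, by linarith, by linarith⟩

/-- The part of the kite above the side is in the open disk of the upper face: either the point is
on the side, or `0 < y ≤ h` and hence `y ^ 2 ≤ h * y`. -/
theorem IsInKite.re_sq_add_im_sq_lt {h k : ℝ} {ζ : ℂ} (hζ : IsInKite h k ζ) (h1 : |ζ.re| < 1)
    (h0 : 0 ≤ ζ.im) : ζ.re ^ 2 + ζ.im ^ 2 < 2 * h * ζ.im + 1 := by
  obtain ⟨-, -, h3⟩ := hζ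
  have ha := abs_nonneg ζ.re
  have hx : ζ.re ^ 2 < 1 := by rw [← sq_abs]; nlinarith
  rcases h0.eq_or_lt with h0 | h0
  · rw [← h0]; linarith
  · have hh : 0 < h := by
      by_contra! hh
      nlinarith
    have : ζ.im ≤ h := by nlinarith
    nlinarith

-- Decompose the upper isosceles triangle as a cone from the lower apex `-k * I`. One of the three
-- pieces cancels the lower isosceles triangle. The two others are the halves of the kite on either
-- side of the line of centers, both positively oriented since `h + k > 0`, even when the kite is
-- not convex.
open Classical in
theorem kite_indicator {h k : ℝ} (hhk : 0 < h + k) {ζ : ℂ} (hζ : InGeneralPosition h k ζ) :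
    (if IsInOpenKite h k ζ then 1 else 0 : ℤ) = isoscelesSign h ζ + isoscelesSign k (-ζ) := by
  obtain ⟨h1, h2, h3, h4, h5, h6⟩ := hζ
  have e1 : isoscelesSign k (-ζ) = chi 1 (-1) (-(k * Complex.I)) ζ := by
    have := chi_affine (m := 0) (w := -1) (by norm_num) (-1) 1 (k * Complex.I) (-ζ)
    unfold isoscelesSign
    rw [← this]
    simp
  have e2 : chi (-1) 1 (h * Complex.I) ζ = chi (-1) 1 (-(k * Complex.I)) ζ +
      chi 1 (h * Complex.I) (-(k * Complex.I)) ζ +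
      chi (h * Complex.I) (-1) (-(k * Complex.I)) ζ := by
    apply chi_cocycle <;> unfold orient <;>
      simp only [Complex.sub_re, Complex.sub_im, Complex.neg_re, Complex.neg_im, Complex.mul_re,
        Complex.mul_im, Complex.ofReal_re, Complex.ofReal_im, Complex.I_re, Complex.I_im,
        Complex.one_re, Complex.one_im] <;> intro h <;> first
      | exact h2 (by linarith)
      | exact h3 (by linarith)
      | exact h4 (by linarith)
      | exact h5 (by linarith)
      | exact h6 (by linarith)
      | exact h1 (mul_left_cancel₀ hhk.ne' (by linarith))
  rw [e1, isoscelesSign, e2, chi_swap (-1) 1]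
  have e3 : chi 1 (h * Complex.I) (-(k * Complex.I)) ζ = commonSign (h * (1 - ζ.re) - ζ.im)
      ((h + k) * ζ.re) (ζ.im + k * (1 - ζ.re)) := by
    unfold chi orient
    congr 1 <;>
      simp only [Complex.sub_re, Complex.sub_im, Complex.neg_re, Complex.neg_im, Complex.mul_re,
        Complex.mul_im, Complex.ofReal_re, Complex.ofReal_im, Complex.I_re, Complex.I_im,
        Complex.one_re, Complex.one_im] <;> ring
  have e4 : chi (h * Complex.I) (-1) (-(k * Complex.I)) ζ = commonSign (h * (1 + ζ.re) - ζ.im)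
      (ζ.im + k * (1 + ζ.re)) (-((h + k) * ζ.re)) := by
    unfold chi orient
    congr 1 <;>
      simp only [Complex.sub_re, Complex.sub_im, Complex.neg_re, Complex.neg_im, Complex.mul_re,
        Complex.mul_im, Complex.ofReal_re, Complex.ofReal_im, Complex.I_re, Complex.I_im,
        Complex.one_re, Complex.one_im] <;> ring
  rw [e3, e4]
  rcases lt_or_gt_of_ne h1 with hx | hx
  · have hs : (h + k) * ζ.re < 0 := mul_neg_of_pos_of_neg hhk hx
    have ha : |ζ.re| = -ζ.re := abs_of_neg hx
    unfold commonSign IsInOpenKite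
    rw [ha]
    have c1 : ¬ (h * (1 - ζ.re) - ζ.im < 0 ∧ (h + k) * ζ.re < 0 ∧ ζ.im + k * (1 - ζ.re) < 0) := by
      rintro ⟨g1, -, g3⟩
      nlinarith
    have c2 : ¬ (0 < h * (1 - ζ.re) - ζ.im ∧ 0 < (h + k) * ζ.re ∧ 0 < ζ.im + k * (1 - ζ.re)) :=
      fun h => absurd h.2.1 (not_lt.2 hs.le)
    have c3 : ¬ (h * (1 + ζ.re) - ζ.im < 0 ∧ ζ.im + k * (1 + ζ.re) < 0 ∧
        -((h + k) * ζ.re) < 0) := fun h => by linarith [h.2.2]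
    rw [if_neg c2, if_neg c1, if_neg c3]
    have c4 : (-ζ.re < 1 ∧ -k * (1 - -ζ.re) < ζ.im ∧ ζ.im < h * (1 - -ζ.re)) ↔
        (0 < h * (1 + ζ.re) - ζ.im ∧ 0 < ζ.im + k * (1 + ζ.re) ∧ 0 < -((h + k) * ζ.re)) := by
      constructor
      · rintro ⟨g1, g2, g3⟩
        exact ⟨by linarith, by linarith, by linarith⟩
      · rintro ⟨g1, g2, -⟩
        refine ⟨?_, by linarith, by linarith⟩
        have : 0 < (h + k) * (1 + ζ.re) := by linarith
        have := (mul_pos_iff_of_pos_left hhk).1 this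
        linarith
    simp only [c4]
    split_ifs <;> simp
  · have hs : 0 < (h + k) * ζ.re := mul_pos hhk hx
    have ha : |ζ.re| = ζ.re := abs_of_pos hx
    unfold commonSign IsInOpenKite
    rw [ha]
    have c1 : ¬ (h * (1 + ζ.re) - ζ.im < 0 ∧ ζ.im + k * (1 + ζ.re) < 0 ∧
        -((h + k) * ζ.re) < 0) := by
      rintro ⟨g1, g2, -⟩
      nlinarith
    have c2 : ¬ (0 < h * (1 + ζ.re) - ζ.im ∧ 0 < ζ.im + k * (1 + ζ.re) ∧
        0 < -((h + k) * ζ.re)) := fun h => by linarith [h.2.2]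
    have c3 : ¬ (h * (1 - ζ.re) - ζ.im < 0 ∧ (h + k) * ζ.re < 0 ∧ ζ.im + k * (1 - ζ.re) < 0) :=
      fun h => by linarith [h.2.1]
    rw [if_neg c3, if_neg c2, if_neg c1]
    have c4 : (ζ.re < 1 ∧ -k * (1 - ζ.re) < ζ.im ∧ ζ.im < h * (1 - ζ.re)) ↔
        (0 < h * (1 - ζ.re) - ζ.im ∧ 0 < (h + k) * ζ.re ∧ 0 < ζ.im + k * (1 - ζ.re)) := by
      constructor
      · rintro ⟨g1, g2, g3⟩
        exact ⟨by linarith, by linarith, by linarith⟩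
      · rintro ⟨g1, -, g2⟩
        refine ⟨?_, by linarith, by linarith⟩
        have : 0 < (h + k) * (1 - ζ.re) := by linarith
        have := (mul_pos_iff_of_pos_left hhk).1 this
        linarith
    simp only [c4]
    split_ifs <;> simp

/-! ### Kites and their development. -/

namespace Gluing

variable {F : Type*} (G : Gluing F)

/-- The closed kite, in the plane of the face of `s`, spanned by the side `s` and by the
circumcenters of the two adjacent faces. -/
def kite (s : F × Fin 3) : Set ℂ := {z | IsInKite (G.height s) (G.height (G.opp s)) (G.coord s z)}

/-- The open kite. -/
def openKite (s : F × Fin 3) : Set ℂ :=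
  {z | IsInOpenKite (G.height s) (G.height (G.opp s)) (G.coord s z)}

/-- The union of the open circumscribed disks of two unfolded adjacent faces. -/
def twoDisks (s : F × Fin 3) : Set ℂ :=
  {z | G.pow s.1 z < 0 ∨ G.pow (G.opp s).1 (G.transfer s z) < 0}

theorem transfer_mem_openKite {s : F × Fin 3} {z : ℂ} :
    G.transfer s z ∈ G.openKite (G.opp s) ↔ z ∈ G.openKite s := by
  simp only [openKite, mem_ofPred_eq, G.coord_transfer, G.opp_opp, isInOpenKite_neg]

theorem transfer_mem_kite {s : F × Fin 3} {z : ℂ} :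
    G.transfer s z ∈ G.kite (G.opp s) ↔ z ∈ G.kite s := by
  simp only [kite, mem_ofPred_eq, G.coord_transfer, G.opp_opp, isInKite_neg]

theorem openKite_subset_kite (s : F × Fin 3) : G.openKite s ⊆ G.kite s :=
  fun _ h => ⟨h.1.le, h.2.1.le, h.2.2.le⟩

theorem pow_neg_of_mem_kite {s : F × Fin 3} {z : ℂ} (hz : z ∈ G.kite s)
    (h1 : |(G.coord s z).re| < 1) (h0 : 0 ≤ (G.coord s z).im) : G.pow s.1 z < 0 :=
  (G.pow_neg_iff s z).2 (IsInKite.re_sq_add_im_sq_lt hz h1 h0)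

theorem pow_transfer_neg_of_mem_kite {s : F × Fin 3} {z : ℂ} (hz : z ∈ G.kite s)
    (h1 : |(G.coord s z).re| < 1) (h0 : (G.coord s z).im ≤ 0) :
    G.pow (G.opp s).1 (G.transfer s z) < 0 := by
  refine G.pow_neg_of_mem_kite (G.transfer_mem_kite.2 hz) ?_ ?_
  · rwa [coord_transfer, Complex.neg_re, abs_neg]
  · rw [coord_transfer, Complex.neg_im]; linarith

theorem mem_twoDisks_of_mem_kite {s : F × Fin 3} {z : ℂ} (hz : z ∈ G.kite s)
    (h1 : |(G.coord s z).re| < 1) : z ∈ G.twoDisks s := by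
  rcases le_total 0 (G.coord s z).im with h | h
  · exact Or.inl (G.pow_neg_of_mem_kite hz h1 h)
  · exact Or.inr (G.pow_transfer_neg_of_mem_kite hz h1 h)

theorem openKite_subset_twoDisks (s : F × Fin 3) : G.openKite s ⊆ G.twoDisks s :=
  fun _ h => G.mem_twoDisks_of_mem_kite (G.openKite_subset_kite s h) h.1

theorem isOpen_openKite (s : F × Fin 3) : IsOpen (G.openKite s) := by
  have h1 : Continuous fun z => (G.coord s z).re :=
    Complex.continuous_re.comp (G.continuous_coord s)
  have h2 : Continuous fun z => (G.coord s z).im :=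
    Complex.continuous_im.comp (G.continuous_coord s)
  have e1 : IsOpen {z | |(G.coord s z).re| < 1} := isOpen_lt (by fun_prop) (by fun_prop)
  have e2 : IsOpen {z | -G.height (G.opp s) * (1 - |(G.coord s z).re|) < (G.coord s z).im} :=
    isOpen_lt (by fun_prop) (by fun_prop)
  have e3 : IsOpen {z | (G.coord s z).im < G.height s * (1 - |(G.coord s z).re|)} :=
    isOpen_lt (by fun_prop) (by fun_prop)
  exact e1.inter (e2.inter e3)

theorem isClosed_kite (s : F × Fin 3) : IsClosed (G.kite s) := by
  have h1 : Continuous fun z => (G.coord s z).re :=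
    Complex.continuous_re.comp (G.continuous_coord s)
  have h2 : Continuous fun z => (G.coord s z).im :=
    Complex.continuous_im.comp (G.continuous_coord s)
  have e1 : IsClosed {z | |(G.coord s z).re| ≤ 1} := isClosed_le (by fun_prop) (by fun_prop)
  have e2 : IsClosed {z | -G.height (G.opp s) * (1 - |(G.coord s z).re|) ≤ (G.coord s z).im} :=
    isClosed_le (by fun_prop) (by fun_prop)
  have e3 : IsClosed {z | (G.coord s z).im ≤ G.height s * (1 - |(G.coord s z).re|)} :=
    isClosed_le (by fun_prop) (by fun_prop)
  exact e1.inter (e2.inter e3)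

end Gluing

namespace GeodesicTriangulation

variable {S : Type*} [MetricSpace S] {F : Type*} (T : GeodesicTriangulation S F)

open Classical in
/-- The development of the union of the open circumscribed disks of two adjacent faces. -/
noncomputable def kiteDev (s : F × Fin 3) (z : ℂ) : S :=
  if 0 ≤ (T.coord s z).im then T.dev s.1 z else T.dev (T.opp s).1 (T.transfer s z)

variable {T} (hH : ∀ s, 0 < T.height s + T.height (T.opp s)) [Finite F]
include hH

theorem kiteDev_of_left {s : F × Fin 3} {z : ℂ} (hz : T.pow s.1 z < 0) :
    T.kiteDev s z = T.dev s.1 z := by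
  unfold kiteDev
  split_ifs with h
  · rfl
  · exact (dev_step hH hz (not_le.1 h)).symm

/-- A point above the side that belongs to the second disk belongs also to the first one, as powers
drop across the side; there `dev_transfer` compares the developments. -/
theorem kiteDev_of_right {s : F × Fin 3} {z : ℂ}
    (hz : T.pow (T.opp s).1 (T.transfer s z) < 0) :
    T.kiteDev s z = T.dev (T.opp s).1 (T.transfer s z) := by
  unfold kiteDev
  split_ifs with h
  · refine dev_transfer hH ?_ hz
    have := Gluing.pow_transfer_le hH (s := T.opp s) (z := T.transfer s z)
      (by rw [T.coord_transfer, Complex.neg_im]; linarith)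
    rw [T.transfer_transfer, T.opp_opp] at this
    exact this.trans_lt hz
  · rfl

theorem kiteDev_opp {s : F × Fin 3} {z : ℂ} (hz : z ∈ T.twoDisks s) :
    T.kiteDev (T.opp s) (T.transfer s z) = T.kiteDev s z := by
  rcases hz with h | h
  · rw [kiteDev_of_left hH h, kiteDev_of_right hH (by rwa [T.transfer_transfer, T.opp_opp]),
      T.transfer_transfer, T.opp_opp]
  · rw [kiteDev_of_right hH h, kiteDev_of_left hH h]

theorem flatAt_kiteDev {s : F × Fin 3} {z : ℂ} (hz : z ∈ T.twoDisks s) :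
    T.FlatAt (T.kiteDev s) z := by
  rcases hz with h | h
  · refine (flatAt_dev hH h).congr ?_
    filter_upwards [(T.isOpen_disk s.1).mem_nhds h] with y hy
    exact kiteDev_of_left hH hy
  · refine (flatAt_dev hH h).comp_transfer.congr ?_
    filter_upwards [((T.isOpen_disk (T.opp s).1).preimage
      (T.continuous_transfer s)).mem_nhds h] with y hy
    exact kiteDev_of_right hH hy

end GeodesicTriangulation

/-! ### Counting the developments of a generic point. -/

namespace Gluing

variable {F : Type*} (G : Gluing F)

theorem isoscelesSign_coord (s : F × Fin 3) (z : ℂ) :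
    isoscelesSign (G.height s) (G.coord s z) =
      chi (G.corner s.1 s.2) (G.corner s.1 (s.2 + 1)) (G.center s.1) z := by
  have := chi_affine (m := G.mid s) (G.half_ne_zero s) (-1) 1 (G.height s * Complex.I)
    (G.coord s z)
  change chi (G.frame s (-1)) (G.frame s 1) (G.frame s (G.height s * Complex.I))
    (G.frame s (G.coord s z)) = _ at this
  rw [frame_neg_one, frame_one, ← center_eq_frame, frame_coord] at this
  exact this.symm

theorem orient_corner_ne_zero {s : F × Fin 3} {z : ℂ}
    (h : InGeneralPosition (G.height s) (G.height (G.opp s)) (G.coord s z)) :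
    orient (G.corner s.1 s.2) (G.corner s.1 (s.2 + 1)) z ≠ 0 := by
  intro h0
  exact h.2.1 (by rw [im_coord, h0, zero_div])

theorem orient_center_ne_zero {s : F × Fin 3} {z : ℂ}
    (h : InGeneralPosition (G.height s) (G.height (G.opp s)) (G.coord s z)) :
    orient (G.corner s.1 s.2) (G.center s.1) z ≠ 0 := by
  intro h0
  have h1 := orient_affine (G.mid s) (G.half s) (-1) (G.height s * Complex.I) (G.coord s z)
  change orient (G.frame s (-1)) (G.frame s (G.height s * Complex.I))
    (G.frame s (G.coord s z)) = _ at h1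
  rw [frame_neg_one, ← center_eq_frame, frame_coord, h0] at h1
  have h2 := (mul_eq_zero.1 h1.symm).resolve_left (G.normSq_half_pos s).ne'
  refine h.2.2.2.1 ?_
  simp only [orient, Complex.sub_re, Complex.sub_im, Complex.neg_re, Complex.neg_im,
    Complex.mul_re, Complex.mul_im, Complex.ofReal_re, Complex.ofReal_im, Complex.I_re,
    Complex.I_im, Complex.one_re, Complex.one_im] at h2
  linarith

open Classical in
/-- The signed isosceles triangles with a common apex in the circumcenter of a face add up to the
face. -/
theorem sum_isoscelesSign {f : F} {z : ℂ} (h : ∀ i : Fin 3,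
    InGeneralPosition (G.height (f, i)) (G.height (G.opp (f, i))) (G.coord (f, i) z)) :
    ∑ i : Fin 3, isoscelesSign (G.height (f, i)) (G.coord (f, i) z) =
      if z ∈ interior (G.face f) then 1 else 0 := by
  have e : chi (G.corner f 0) (G.corner f 1) (G.corner f 2) z =
      chi (G.corner f 0) (G.corner f 1) (G.center f) z +
      chi (G.corner f 1) (G.corner f 2) (G.center f) z +
      chi (G.corner f 2) (G.corner f 0) (G.center f) z :=
    chi_cocycle (G.orient_corner_ne_zero (h 0)) (G.orient_corner_ne_zero (h 1))
      (G.orient_corner_ne_zero (h 2)) (G.orient_center_ne_zero (h 0))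
      (G.orient_center_ne_zero (h 1)) (G.orient_center_ne_zero (h 2))
  simp only [Fin.sum_univ_three, isoscelesSign_coord]
  refine e.symm.trans ?_
  have hO := G.corner_ccw f
  have hsum : orient (G.corner f 0) (G.corner f 1) z + orient (G.corner f 1) (G.corner f 2) z +
      orient (G.corner f 2) (G.corner f 0) z =
      orient (G.corner f 0) (G.corner f 1) (G.corner f 2) := by
    simp only [orient, Complex.sub_re, Complex.sub_im]; ring
  have hiff : z ∈ interior (G.face f) ↔ 0 < orient (G.corner f 0) (G.corner f 1) z ∧
      0 < orient (G.corner f 1) (G.corner f 2) z ∧ 0 < orient (G.corner f 2) (G.corner f 0) z := by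
    have hi : ∀ i, 0 < (G.coord (f, i) z).im ↔
        0 < orient (G.corner f i) (G.corner f (i + 1)) z := by
      intro i
      have := G.normSq_half_pos (f, i)
      rw [im_coord, lt_div_iff₀ (by positivity), zero_mul]
    rw [mem_interior_face_iff]
    simp only [hi]
    exact ⟨fun h => ⟨h 0, h 1, h 2⟩, fun h i => by
      fin_cases i
      exacts [h.1, h.2.1, h.2.2]⟩
  simp only [hiff]
  unfold chi commonSign
  split_ifs with h1 h2
  · rfl
  · linarith [h2.1, h2.2.1, h2.2.2]
  · rfl

end Gluing

theorem finsum_ite_eq_ncard {α : Type*} {N : Set α} (hN : N.Finite) [DecidablePred (· ∈ N)] :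
    (∑ᶠ z, if z ∈ N then 1 else 0 : ℤ) = N.ncard := by
  classical
  rw [finsum_eq_sum_of_support_subset (s := hN.toFinset) _ (by
    intro z hz
    rw [Function.mem_support] at hz
    simpa using hz), Set.ncard_eq_toFinset_card N hN, Finset.sum_boole,
    Finset.filter_true_of_mem fun x hx => hN.mem_toFinset.1 hx]

namespace GeodesicTriangulation

variable {S : Type*} [MetricSpace S] {F : Type*} (T : GeodesicTriangulation S F)

/-- A point of the surface is generic if it lies in an open face, and all its developments are in
general position with respect to the corners and the circumcenters. -/
def IsGeneric (p : S) : Prop :=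
  (∃ f, ∃ z ∈ interior (T.face f), T.param f z = p) ∧
  ∀ s z, T.pow s.1 z < 0 → T.dev s.1 z = p →
    InGeneralPosition (T.height s) (T.height (T.opp s)) (T.coord s z)

open Classical in
/-- The signed isosceles triangle over a side, restricted to the developments of a point. -/
noncomputable def signedFiber (s : F × Fin 3) (p : S) (z : ℂ) : ℤ :=
  if T.pow s.1 z < 0 ∧ T.dev s.1 z = p then isoscelesSign (T.height s) (T.coord s z) else 0

/-- The developments of a point in the open kite of a side. -/
def kiteFiber (s : F × Fin 3) (p : S) : Set ℂ := {z | z ∈ T.openKite s ∧ T.kiteDev s z = p}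

variable {T}

theorem IsGeneric.not_vertex {p : S} (hp : T.IsGeneric p) : p ∉ T.vertices := by
  obtain ⟨⟨f, z, hz, rfl⟩, -⟩ := hp
  exact param_not_vertex (interior_subset hz) (T.pow_neg_of_mem_interior hz)

variable (hH : ∀ s, 0 < T.height s + T.height (T.opp s)) [Finite F]
include hH

theorem IsGeneric.inGeneralPosition {p : S} (hp : T.IsGeneric p) {s : F × Fin 3} {z : ℂ}
    (hz : z ∈ T.twoDisks s) (h : T.kiteDev s z = p) :
    InGeneralPosition (T.height s) (T.height (T.opp s)) (T.coord s z) := by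
  rcases hz with hz | hz
  · exact hp.2 s z hz (by rw [← kiteDev_of_left hH hz, h])
  · have := (hp.2 (T.opp s) _ hz (by rw [← kiteDev_of_right hH hz, h])).neg
    rwa [T.coord_transfer, neg_neg, T.opp_opp] at this

/-- An infinite fiber would accumulate in the closed disk. An accumulation point inside contradicts
local injectivity; one on the circle is in the closed isosceles triangle, hence a corner, and then
`p` is a vertex. -/
theorem finite_support_signedFiber {p : S} (hp : p ∉ T.vertices) (s : F × Fin 3) :
    (Function.support (T.signedFiber s p)).Finite := by
  obtain ⟨D⟩ := nonempty_circumdisk hH s.1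
  by_contra hinf
  set N := Function.support (T.signedFiber s p)
  have hN : ∀ z ∈ N, T.pow s.1 z < 0 ∧ T.dev s.1 z = p ∧
      isoscelesSign (T.height s) (T.coord s z) ≠ 0 := by
    intro z hz
    rw [Function.mem_support, signedFiber] at hz
    split_ifs at hz with h
    · exact ⟨h.1, h.2, hz⟩
    · exact absurd rfl hz
  have hK : IsCompact {z | T.pow s.1 z ≤ 0} := by
    have : {z | T.pow s.1 z ≤ 0} =
        closedBall (T.center s.1) (dist (T.corner s.1 0) (T.center s.1)) := by
      ext z; exact T.pow_nonpos_iff_mem_closedBall s.1 z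
    rw [this]
    exact isCompact_closedBall _ _
  obtain ⟨x, hxK, hx⟩ := Set.Infinite.exists_accPt_of_subset_isCompact hinf hK
    fun z hz => (hN z hz).1.le
  rw [accPt_iff_frequently] at hx
  have hclos : x ∈ closure N := mem_closure_iff_frequently.2 (hx.mono fun y hy => hy.2)
  have hxp : D.map x = p := by
    have hne : (𝓝[N] x).NeBot := mem_closure_iff_nhdsWithin_neBot.1 hclos
    have h1 : Filter.Tendsto D.map (𝓝[N] x) (𝓝 (D.map x)) :=
      (D.continuousOn_closedDisk x hxK).mono_left
        (nhdsWithin_mono _ fun z hz => (hN z hz).1.le)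
    refine tendsto_nhds_unique (h1.congr' ?_) tendsto_const_nhds
    filter_upwards [self_mem_nhdsWithin] with y hy
    rw [D.map_eq_dev hH (hN y hy).1, (hN y hy).2.1]
  rcases lt_or_eq_of_le (show T.pow s.1 x ≤ 0 from hxK) with hlt | heq
  · rw [D.map_eq_dev hH hlt] at hxp
    obtain ⟨ε, hε, hiso, -⟩ := (flatAt_dev hH hlt).iso
    obtain ⟨y, ⟨hyx, hyN⟩, hy⟩ := (hx.and_eventually (ball_mem_nhds x hε)).exists
    have := hiso y hy x (mem_ball_self hε)
    rw [(hN y hyN).2.1, hxp, dist_self] at this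
    exact hyx (dist_eq_zero.1 this.symm)
  · have c1 : Continuous fun z => (T.coord s z).re :=
      Complex.continuous_re.comp (T.continuous_coord s)
    have c2 : Continuous fun z => (T.coord s z).im :=
      Complex.continuous_im.comp (T.continuous_coord s)
    have e1 : IsClosed {z | 0 ≤ (T.coord s z).im *
        (T.height s * (1 - (T.coord s z).re) - (T.coord s z).im)} :=
      isClosed_le (by fun_prop) (by fun_prop)
    have e2 : IsClosed {z | 0 ≤ (T.coord s z).im *
        (T.height s * (1 + (T.coord s z).re) - (T.coord s z).im)} :=
      isClosed_le (by fun_prop) (by fun_prop)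
    have h1 := closure_minimal (fun z hz => (isoscelesSign_ne_zero (hN z hz).2.2).1.le) e1 hclos
    have h2 := closure_minimal (fun z hz => (isoscelesSign_ne_zero (hN z hz).2.2).2.le) e2 hclos
    rw [T.pow_eq] at heq
    have h3 := (mul_eq_zero.1 heq).resolve_left (T.normSq_half_pos s).ne'
    have h0 := im_eq_zero_of_isosceles h1 h2 (by linarith)
    rw [h0] at h3
    have h4 : ((T.coord s x).re - 1) * ((T.coord s x).re + 1) = 0 := by linarith
    have hcor : ∃ i, x = T.corner s.1 i := by
      rcases mul_eq_zero.1 h4 with h | h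
      · refine ⟨s.2 + 1, T.coord_injective s ?_⟩
        rw [T.coord_right]
        apply Complex.ext
        · rw [Complex.one_re]; linarith
        · rw [h0, Complex.one_im]
      · refine ⟨s.2, T.coord_injective s ?_⟩
        rw [T.coord_left]
        apply Complex.ext
        · rw [Complex.neg_re, Complex.one_re]; linarith
        · rw [h0, Complex.neg_im, Complex.one_im, neg_zero]
    obtain ⟨i, rfl⟩ := hcor
    rw [D.map_eq_param (T.corner_mem_face s.1 i)] at hxp
    exact hp ⟨s.1, i, hxp⟩

-- This is `kite_indicator` on the fiber over `p`. The restriction to the open disks in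
-- `signedFiber` costs nothing, since a nonzero isosceles sign already puts the point in the disk
-- (`hsign`).
open Classical in
theorem kiteFiber_indicator {p : S} (hp : T.IsGeneric p) (s : F × Fin 3) (z : ℂ) :
    (if z ∈ T.kiteFiber s p then 1 else 0 : ℤ) =
      T.signedFiber s p z + T.signedFiber (T.opp s) p (T.transfer s z) := by
  have hsign : ∀ t : F × Fin 3, ∀ x, isoscelesSign (T.height t) (T.coord t x) ≠ 0 →
      T.pow t.1 x < 0 := by
    intro t x hx
    by_contra! h
    obtain ⟨h1, h2⟩ := isoscelesSign_ne_zero hx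
    have := im_eq_zero_of_isosceles h1.le h2.le (by
      by_contra! h'
      exact absurd ((T.pow_neg_iff t x).2 h') (not_lt.2 h))
    rw [this, zero_mul] at h1
    exact lt_irrefl _ h1
  by_cases hz : z ∈ T.twoDisks s ∧ T.kiteDev s z = p
  · obtain ⟨hz, hzp⟩ := hz
    have h1 : T.signedFiber s p z = isoscelesSign (T.height s) (T.coord s z) := by
      unfold signedFiber
      split_ifs with h
      · rfl
      · by_contra hne
        have hpow := hsign s z (Ne.symm hne)
        exact h ⟨hpow, by rw [← kiteDev_of_left hH hpow, hzp]⟩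
    have h2 : T.signedFiber (T.opp s) p (T.transfer s z) =
        isoscelesSign (T.height (T.opp s)) (-T.coord s z) := by
      rw [← T.coord_transfer]
      unfold signedFiber
      split_ifs with h
      · rfl
      · by_contra hne
        have hpow := hsign (T.opp s) _ (Ne.symm hne)
        exact h ⟨hpow, by rw [← kiteDev_of_right hH hpow, hzp]⟩
    rw [h1, h2, ← kite_indicator (hH s) (hp.inGeneralPosition hH hz hzp)]
    congr 1
    exact propext ⟨fun h => h.1, fun h => ⟨h, hzp⟩⟩
  · have h1 : T.signedFiber s p z = 0 := by
      unfold signedFiber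
      split_ifs with h
      · exact absurd ⟨Or.inl h.1, by rw [kiteDev_of_left hH h.1, h.2]⟩ hz
      · rfl
    have h2 : T.signedFiber (T.opp s) p (T.transfer s z) = 0 := by
      unfold signedFiber
      split_ifs with h
      · exact absurd ⟨Or.inr h.1, by rw [kiteDev_of_right hH h.1, h.2]⟩ hz
      · rfl
    rw [h1, h2, if_neg, add_zero]
    exact fun h => hz ⟨T.openKite_subset_twoDisks s h.1, h.2⟩

theorem finite_support_signedFiber_transfer {p : S} (hp : p ∉ T.vertices) (s : F × Fin 3) :
    (Function.support fun z => T.signedFiber (T.opp s) p (T.transfer s z)).Finite := by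
  refine ((finite_support_signedFiber hH hp (T.opp s)).image (T.transfer (T.opp s))).subset ?_
  intro z hz
  exact ⟨T.transfer s z, hz, T.transfer_transfer s z⟩

theorem finite_kiteFiber {p : S} (hp : T.IsGeneric p) (s : F × Fin 3) :
    (T.kiteFiber s p).Finite := by
  classical
  refine ((finite_support_signedFiber hH hp.not_vertex s).union
    (finite_support_signedFiber_transfer hH hp.not_vertex s)).subset ?_
  intro z hz
  by_contra hne
  simp only [mem_union, Function.mem_support, not_or, not_not] at hne
  have := kiteFiber_indicator hH hp s z
  rw [if_pos hz, hne.1, hne.2] at this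
  norm_num at this

theorem ncard_kiteFiber {p : S} (hp : T.IsGeneric p) (s : F × Fin 3) :
    ((T.kiteFiber s p).ncard : ℤ) =
      ∑ᶠ z, T.signedFiber s p z + ∑ᶠ z, T.signedFiber (T.opp s) p z := by
  classical
  rw [← finsum_ite_eq_ncard (finite_kiteFiber hH hp s)]
  simp only [kiteFiber_indicator hH hp]
  rw [finsum_add_distrib (finite_support_signedFiber hH hp.not_vertex s)
    (finite_support_signedFiber_transfer hH hp.not_vertex s)]
  congr 1
  exact finsum_comp (g := T.signedFiber (T.opp s) p) (T.transfer s)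
    (Function.bijective_iff_has_inverse.2 ⟨T.transfer (T.opp s), T.transfer_transfer s,
      T.transfer_transfer' s⟩)

-- The three isosceles triangles of `f` add up to its indicator, so only a development of the point
-- inside the open face `f` itself contributes; the parametrizations being injective on open faces,
-- that is `z₀` in `f₀`.
open Classical in
theorem sum_signedFiber {f₀ : F} {z₀ : ℂ} (hz₀ : z₀ ∈ interior (T.face f₀))
    (hp : T.IsGeneric (T.param f₀ z₀)) (f : F) :
    ∑ i : Fin 3, ∑ᶠ z, T.signedFiber (f, i) (T.param f₀ z₀) z = if f = f₀ then 1 else 0 := by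
  rw [← finsum_sum_comm _ _ fun i _ => finite_support_signedFiber hH hp.not_vertex (f, i)]
  have h : ∀ z, ∑ i : Fin 3, T.signedFiber (f, i) (T.param f₀ z₀) z =
      if f = f₀ ∧ z = z₀ then 1 else 0 := by
    intro z
    by_cases hz : T.pow f z < 0 ∧ T.dev f z = T.param f₀ z₀
    · have : ∀ i : Fin 3, T.signedFiber (f, i) (T.param f₀ z₀) z =
          isoscelesSign (T.height (f, i)) (T.coord (f, i) z) := fun i => if_pos hz
      simp only [this]
      rw [T.sum_isoscelesSign fun i => hp.2 (f, i) z hz.1 hz.2]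
      congr 1
      refine propext ⟨fun h => ?_, ?_⟩
      · refine T.eq_of_param_eq (interior_subset h) hz₀ ?_
        rw [← dev_face hH (interior_subset h) hz.1, hz.2]
      · rintro ⟨rfl, rfl⟩
        exact hz₀
    · have : ∀ i : Fin 3, T.signedFiber (f, i) (T.param f₀ z₀) z = 0 := fun i => if_neg hz
      simp only [this, Finset.sum_const_zero]
      rw [if_neg]
      rintro ⟨rfl, rfl⟩
      have hpow := T.pow_neg_of_mem_interior hz₀
      exact hz ⟨hpow, dev_face hH (interior_subset hz₀) hpow⟩
  simp only [h]
  rw [finsum_eq_single _ z₀ fun x hx => if_neg fun h => hx h.2]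
  simp

/-- Each generic point has exactly two developments in the open kites, one for each of the two
orientations of a side. -/
theorem sum_ncard_kiteFiber [Fintype F] {p : S} (hp : T.IsGeneric p) :
    ∑ s : F × Fin 3, (T.kiteFiber s p).ncard = 2 := by
  classical
  obtain ⟨f₀, z₀, hz₀, rfl⟩ := hp.1
  have h1 : ∑ s : F × Fin 3, ∑ᶠ z, T.signedFiber s (T.param f₀ z₀) z = 1 := by
    rw [Fintype.sum_prod_type]
    simp only [sum_signedFiber hH hz₀ hp]
    simp
  have h2 : ∑ s : F × Fin 3, ∑ᶠ z, T.signedFiber (T.opp s) (T.param f₀ z₀) z = 1 := by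
    rw [← h1]
    exact Equiv.sum_comp (Function.Involutive.toPerm T.opp T.opp_opp)
      fun s => ∑ᶠ z, T.signedFiber s (T.param f₀ z₀) z
  have h3 : ((∑ s : F × Fin 3, (T.kiteFiber s (T.param f₀ z₀)).ncard : ℕ) : ℤ) = 2 := by
    push_cast
    simp only [ncard_kiteFiber hH hp, Finset.sum_add_distrib, h1, h2]
    norm_num
  exact_mod_cast h3

theorem exists_mem_openKite {p : S} (hp : T.IsGeneric p) :
    ∃ s, ∃ z ∈ T.openKite s, T.kiteDev s z = p := by
  have := Fintype.ofFinite F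
  by_contra! h
  have h0 : ∀ s, T.kiteFiber s p = ∅ := fun s =>
    eq_empty_of_forall_notMem fun z hz => h s z hz.1 hz.2
  have := sum_ncard_kiteFiber hH hp
  simp [h0] at this

/-- A development over `s` is accompanied by its transfer over `opp s`. These two already exhaust
the total count of two. -/
theorem eq_or_eq_of_mem_openKite {p : S} (hp : T.IsGeneric p) {s s' : F × Fin 3} {z z' : ℂ}
    (hz : z ∈ T.openKite s) (hzp : T.kiteDev s z = p) (hz' : z' ∈ T.openKite s')
    (hzp' : T.kiteDev s' z' = p) :
    (s' = s ∧ z' = z) ∨ (s' = T.opp s ∧ z' = T.transfer s z) := by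
  classical
  have := Fintype.ofFinite F
  have hsum := sum_ncard_kiteFiber hH hp
  have hpos : ∀ t : F × Fin 3, ∀ x ∈ T.kiteFiber t p, 1 ≤ (T.kiteFiber t p).ncard := by
    intro t x hx
    exact (Set.ncard_pos (finite_kiteFiber hH hp t)).2 ⟨x, hx⟩
  have hopp : ∀ t : F × Fin 3, ∀ x ∈ T.kiteFiber t p, T.transfer t x ∈ T.kiteFiber (T.opp t) p :=
    fun t x hx => ⟨T.transfer_mem_openKite.2 hx.1, by
      rw [kiteDev_opp hH (T.openKite_subset_twoDisks t hx.1), hx.2]⟩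
  have hm : z ∈ T.kiteFiber s p := ⟨hz, hzp⟩
  have hm' : z' ∈ T.kiteFiber s' p := ⟨hz', hzp'⟩
  have h1 := hpos s z hm
  have h2 := hpos (T.opp s) _ (hopp s z hm)
  have hne := T.opp_ne s
  have hle : (T.kiteFiber s p).ncard + (T.kiteFiber (T.opp s) p).ncard ≤ 2 := by
    rw [← hsum, ← Finset.sum_pair (f := fun t => (T.kiteFiber t p).ncard) hne.symm]
    exact Finset.sum_le_sum_of_subset (Finset.subset_univ _)
  have huniq : ∀ x ∈ T.kiteFiber s p, x = z := fun x hx =>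
    (Set.ncard_le_one (finite_kiteFiber hH hp s)).1 (by omega) x hx z hm
  by_cases e1 : s' = s
  · subst e1
    exact Or.inl ⟨rfl, huniq z' hm'⟩
  by_cases e2 : s' = T.opp s
  · subst e2
    have h3 := hopp _ _ hm'
    rw [T.opp_opp] at h3
    exact Or.inr ⟨rfl, by rw [← huniq _ h3, T.transfer_transfer']⟩
  have h3 := hpos s' z' hm'
  have : ∑ t ∈ ({s, T.opp s, s'} : Finset (F × Fin 3)), (T.kiteFiber t p).ncard ≤ 2 := by
    rw [← hsum]
    exact Finset.sum_le_sum_of_subset (Finset.subset_univ _)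
  rw [Finset.sum_insert (by simp [hne.symm, Ne.symm e1]),
    Finset.sum_pair (Ne.symm e2)] at this
  omega

end GeodesicTriangulation

/-! ### Density of generic points and passage to arbitrary points. -/

namespace Gluing

variable {F : Type*} (G : Gluing F)

theorem dimH_line_le (s : F × Fin 3) (c d : ℝ) :
    dimH {z | (G.coord s z).im = c + d * (G.coord s z).re} ≤ 1 := by
  have hsub : {z | (G.coord s z).im = c + d * (G.coord s z).re} ⊆
      range fun t : ℝ => G.mid s + G.half s * (Complex.ofRealCLM t +
        (c + d * Complex.ofRealCLM t) * Complex.I) := by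
    intro z hz
    refine ⟨(G.coord s z).re, ?_⟩
    dsimp only
    conv_rhs => rw [← G.frame_coord s z]
    unfold frame
    congr 2
    rw [mem_ofPred_eq] at hz
    apply Complex.ext <;> simp [hz]
  refine (dimH_mono hsub).trans ?_
  have := ContDiff.dimH_range_le (f := fun t : ℝ => G.mid s + G.half s * (Complex.ofRealCLM t +
        (c + d * Complex.ofRealCLM t) * Complex.I)) (by fun_prop)
  simpa using this

theorem dimH_axis_le (s : F × Fin 3) : dimH {z | (G.coord s z).re = 0} ≤ 1 := by
  have hsub : {z | (G.coord s z).re = 0} ⊆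
      range fun t : ℝ => G.mid s + G.half s * (Complex.ofRealCLM t * Complex.I) := by
    intro z hz
    refine ⟨(G.coord s z).im, ?_⟩
    dsimp only
    conv_rhs => rw [← G.frame_coord s z]
    unfold frame
    congr 2
    rw [mem_ofPred_eq] at hz
    apply Complex.ext <;> simp [hz]
  refine (dimH_mono hsub).trans ?_
  have := ContDiff.dimH_range_le (f := fun t : ℝ =>
    G.mid s + G.half s * (Complex.ofRealCLM t * Complex.I)) (by fun_prop)
  simpa using this

theorem dimH_not_inGeneralPosition_le (s : F × Fin 3) (h k : ℝ) :
    dimH {z | ¬InGeneralPosition h k (G.coord s z)} ≤ 1 := by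
  have hsub : {z | ¬InGeneralPosition h k (G.coord s z)} ⊆ {z | (G.coord s z).re = 0} ∪
      ({z | (G.coord s z).im = 0 + 0 * (G.coord s z).re} ∪
      ({z | (G.coord s z).im = h + -h * (G.coord s z).re} ∪
      ({z | (G.coord s z).im = h + h * (G.coord s z).re} ∪
      ({z | (G.coord s z).im = -k + k * (G.coord s z).re} ∪
      {z | (G.coord s z).im = -k + -k * (G.coord s z).re})))) := by
    intro z hz
    by_contra hne
    simp only [mem_union, mem_ofPred_eq, not_or] at hne
    obtain ⟨h1, h2, h3, h4, h5, h6⟩ := hne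
    exact hz ⟨h1, fun h => h2 (by linarith), fun h => h3 (by linarith), fun h => h4 (by linarith),
      fun h => h5 (by linarith), fun h => h6 (by linarith)⟩
  refine (dimH_mono hsub).trans ?_
  simp only [dimH_union]
  exact max_le (G.dimH_axis_le s) (max_le (G.dimH_line_le s _ _) (max_le (G.dimH_line_le s _ _)
    (max_le (G.dimH_line_le s _ _) (max_le (G.dimH_line_le s _ _) (G.dimH_line_le s _ _)))))

end Gluing

namespace GeodesicTriangulation

variable {S : Type*} [MetricSpace S] {F : Type*} {T : GeodesicTriangulation S F}
variable (hH : ∀ s, 0 < T.height s + T.height (T.opp s)) [Finite F]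
include hH

/-- Points with a development not in general position are in finitely many images of parts of lines
under 1-Lipschitz maps, a set of Hausdorff dimension at most one. It cannot contain an isometric
copy of a planar disk, and there is one near `p` inside an open face. -/
theorem exists_isGeneric (p : S) {ε : ℝ} (hε : 0 < ε) : ∃ q, T.IsGeneric q ∧ dist q p < ε := by
  obtain ⟨f, z, hz, rfl⟩ := T.param_surjective p
  obtain ⟨z', hz', hzz'⟩ := Metric.mem_closure_iff.1 (T.face_subset_closure_interior f hz)
    (ε / 2) (by positivity)
  have hpow := T.pow_neg_of_mem_interior hz'
  obtain ⟨δ, hδ, hP, hiso, -⟩ := (flatAt_dev hH hpow).exists_ball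
    ((isOpen_interior.eventually_mem hz').and (ball_mem_nhds z' (half_pos hε)))
  by_contra! hno
  let bad : Set S := ⋃ s : F × Fin 3, T.dev s.1 '' ({z | T.pow s.1 z < 0} ∩
    {z | ¬InGeneralPosition (T.height s) (T.height (T.opp s)) (T.coord s z)})
  have hbad : dimH bad ≤ 1 := by
    rw [dimH_iUnion]
    refine iSup_le fun s => ?_
    have hlip : LipschitzOnWith 1 (T.dev s.1) ({z | T.pow s.1 z < 0} ∩
      {z | ¬InGeneralPosition (T.height s) (T.height (T.opp s)) (T.coord s z)}) :=
      (lipschitzOnWith_dev hH s.1).mono inter_subset_left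
    exact hlip.dimH_image_le.trans ((dimH_mono inter_subset_right).trans
      (T.dimH_not_inGeneralPosition_le s _ _))
  have hsub : T.dev f '' ball z' δ ⊆ bad := by
    rintro _ ⟨x, hx, rfl⟩
    obtain ⟨hxi, hxd⟩ := hP x hx
    have hxp := T.pow_neg_of_mem_interior hxi
    have hdev := dev_face hH (interior_subset hxi) hxp
    by_contra hb
    have hgen : T.IsGeneric (T.dev f x) := by
      refine ⟨⟨f, x, hxi, hdev.symm⟩, fun s y hy hyx => ?_⟩
      by_contra hg
      exact hb (mem_iUnion.2 ⟨s, y, ⟨hy, hg⟩, hyx⟩)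
    have h1 := hno _ hgen
    have h2 := T.dist_param_le f x (interior_subset hxi) z hz
    rw [← hdev] at h2
    have h3 := dist_triangle x z' z
    rw [dist_comm z' z] at h3
    have h4 : dist x z' < ε / 2 := hxd
    linarith
  have hiso' : Isometry fun x : ball z' δ => T.dev f x :=
    Isometry.of_dist_eq fun a b => hiso a a.2 b b.2
  have h1 : dimH (T.dev f '' ball z' δ) = dimH (ball z' δ) := by
    have e1 := hiso'.dimH_image univ
    have e2 := (isometry_subtype_coe (s := ball z' δ)).dimH_image univ
    rw [image_univ, Subtype.range_coe] at e2
    rw [e2, ← e1]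
    congr 1
    ext p
    simp
  have h2 : dimH (ball z' δ) = 2 := by
    rw [Real.dimH_of_nonempty_interior (by
      rw [isOpen_ball.interior_eq]
      exact ⟨z', mem_ball_self hδ⟩), Complex.finrank_real_complex]
    norm_num
  have h3 := (dimH_mono hsub).trans hbad
  rw [h1, h2] at h3
  norm_num at h3

omit hH [Finite F] in
variable (T) in
/-- All generic points near `p` come from points of open kites near points of the finite set `A`. -/
def Covers (A : Set ((F × Fin 3) × ℂ)) (p : S) : Prop :=
  ∀ δ > 0, ∃ ε > 0, ∀ q, T.IsGeneric q → dist q p < ε →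
    ∃ a ∈ A, ∃ z ∈ T.openKite a.1, dist z a.2 < δ ∧ T.kiteDev a.1 z = q

/-- Otherwise the finitely many pairs are uniformly separated. A generic point close to `p` has a
development near a point of `A` and one near a point of `B`; by `eq_or_eq_of_mem_openKite` these are
the same up to transfer, which contradicts the separation. -/
theorem Covers.exists_eq {A B : Set ((F × Fin 3) × ℂ)} {p : S} (hA : A.Finite) (hB : B.Finite)
    (hAp : T.Covers A p) (hBp : T.Covers B p) :
    ∃ a ∈ A, ∃ b ∈ B, (b.1 = a.1 ∧ b.2 = a.2) ∨ (b.1 = T.opp a.1 ∧ b.2 = T.transfer a.1 a.2) := by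
  by_contra! hne
  have hsep : ∀ c : (A ×ˢ B : Set (((F × Fin 3) × ℂ) × ((F × Fin 3) × ℂ))), ∃ δ > 0,
      (c.1.2.1 = c.1.1.1 → 2 * δ ≤ dist c.1.2.2 c.1.1.2) ∧
      (c.1.2.1 = T.opp c.1.1.1 → 2 * δ ≤ dist c.1.2.2 (T.transfer c.1.1.1 c.1.1.2)) := by
    rintro ⟨⟨a, b⟩, ha, hb⟩
    dsimp only at ha hb ⊢
    obtain ⟨h1, h2⟩ := hne a ha b hb
    by_cases e1 : b.1 = a.1
    · have : 0 < dist b.2 a.2 := dist_pos.2 (h1 e1)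
      refine ⟨dist b.2 a.2 / 2, by positivity, fun _ => by linarith, fun e2 => ?_⟩
      exact absurd (e2.symm.trans e1) (T.opp_ne a.1)
    · by_cases e2 : b.1 = T.opp a.1
      · have : 0 < dist b.2 (T.transfer a.1 a.2) := dist_pos.2 (h2 e2)
        exact ⟨dist b.2 (T.transfer a.1 a.2) / 2, by positivity, fun h => absurd h e1,
          fun _ => by linarith⟩
      · exact ⟨1, one_pos, fun h => absurd h e1, fun h => absurd h e2⟩
  choose δ hδ h1 h2 using hsep
  have hfin : Finite (A ×ˢ B : Set (((F × Fin 3) × ℂ) × ((F × Fin 3) × ℂ))) :=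
    (hA.prod hB).to_subtype
  obtain ⟨δ₀, hδ₀, hle⟩ : ∃ δ₀ > 0, ∀ c, δ₀ ≤ δ c := by
    cases isEmpty_or_nonempty (A ×ˢ B : Set (((F × Fin 3) × ℂ) × ((F × Fin 3) × ℂ)))
    · exact ⟨1, one_pos, fun c => isEmptyElim c⟩
    · obtain ⟨c, hc⟩ := Finite.exists_min δ
      exact ⟨δ c, hδ c, hc⟩
  obtain ⟨ε₁, hε₁, hcovA⟩ := hAp δ₀ hδ₀
  obtain ⟨ε₂, hε₂, hcovB⟩ := hBp δ₀ hδ₀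
  obtain ⟨q, hq, hqp⟩ := exists_isGeneric hH p (lt_min hε₁ hε₂)
  obtain ⟨a, ha, z, hz, hza, hzq⟩ := hcovA q hq (hqp.trans_le (min_le_left _ _))
  obtain ⟨b, hb, z', hz', hzb, hzq'⟩ := hcovB q hq (hqp.trans_le (min_le_right _ _))
  have hle' := hle ⟨(a, b), ha, hb⟩
  rcases eq_or_eq_of_mem_openKite hH hq hz hzq hz' hzq' with ⟨e, rfl⟩ | ⟨e, rfl⟩
  · have := h1 ⟨(a, b), ha, hb⟩ e
    have := dist_triangle_left b.2 a.2 z'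
    linarith
  · have := h2 ⟨(a, b), ha, hb⟩ e
    have := dist_triangle_left b.2 (T.transfer a.1 a.2) (T.transfer a.1 z)
    rw [T.dist_transfer] at this
    dsimp only at *
    linarith

omit hH [Finite F] in
/-- A point of a developed disk is covered by the kites around it. -/
theorem covers_of_eventually {g : ℂ → S} {x : ℂ} (hg : T.FlatAt g x)
    {A : Set ((F × Fin 3) × ℂ)} (hA : ∀ᶠ z in 𝓝 x, T.IsGeneric (g z) →
      ∃ a ∈ A, a.2 = x ∧ z ∈ T.openKite a.1 ∧ T.kiteDev a.1 z = g z) : T.Covers A (g x) := by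
  intro δ hδ
  obtain ⟨ε, hε, hP, -, honto⟩ := hg.exists_ball hA
  refine ⟨min ε δ, lt_min hε hδ, fun q hq hqp => ?_⟩
  obtain ⟨z, hz, rfl⟩ := honto (min ε δ) (min_le_left _ _) q hqp
  obtain ⟨a, ha, rfl, hz', hzq⟩ := hP z (ball_subset_ball (min_le_left _ _) hz) hq
  exact ⟨a, ha, z, hz', ball_subset_ball (min_le_right _ _) hz, hzq⟩

theorem covers_interior {s : F × Fin 3} {z : ℂ} (hz : z ∈ T.openKite s) :
    T.Covers {(s, z)} (T.kiteDev s z) := by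
  refine covers_of_eventually (flatAt_kiteDev hH (T.openKite_subset_twoDisks s hz)) ?_
  filter_upwards [(T.isOpen_openKite s).mem_nhds hz] with y hy _
  exact ⟨(s, z), rfl, rfl, hy, rfl⟩

end GeodesicTriangulation

/-! ### The sides of the kites and the neighborhoods of the circumradii. -/

namespace Gluing

variable {F : Type*} (G : Gluing F)

theorem coord_lineMap (s : F × Fin 3) (x y : ℂ) (t : ℝ) :
    G.coord s (AffineMap.lineMap x y t) = (1 - t) * G.coord s x + t * G.coord s y := by
  have := G.half_ne_zero s
  rw [AffineMap.lineMap_apply]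
  unfold coord
  simp
  field_simp
  ring

/-- The normalized abscissa of an end of a side. -/
def endRe (β : Bool) : ℝ := if β then 1 else -1

/-- The normalized ordinate of the circumcenter of one of the two faces adjacent to a side. -/
noncomputable def apexIm (s : F × Fin 3) (ω : Bool) : ℝ :=
  if ω then -G.height (G.opp s) else G.height s

/-- The point of a side of the kite; `β` is the end of the side of the triangulation, and `ω` is
the circumcenter. -/
noncomputable def sidePoint (s : F × Fin 3) (β ω : Bool) (t : ℝ) : ℂ :=
  G.frame s ⟨endRe β * (1 - t), G.apexIm s ω * t⟩

/-- The circumradius that is a side of the kite. -/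
def sideEdge (s : F × Fin 3) (β : Bool) : Bool → F × Fin 3
  | false => if β then (s.1, s.2 + 1) else s
  -- Gluing reverses the side, so its right end is the starting corner of `opp s`.
  | true => if β then G.opp s else ((G.opp s).1, (G.opp s).2 + 1)

theorem endRe_not (β : Bool) : endRe (!β) = -endRe β := by cases β <;> simp [endRe]

theorem apexIm_not (s : F × Fin 3) (ω : Bool) : G.apexIm (G.opp s) (!ω) = -G.apexIm s ω := by
  cases ω <;> simp [apexIm, G.opp_opp]

theorem transfer_sidePoint (s : F × Fin 3) (β ω : Bool) (t : ℝ) :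
    G.transfer s (G.sidePoint s β ω t) = G.sidePoint (G.opp s) (!β) (!ω) t := by
  unfold transfer sidePoint
  rw [coord_frame, endRe_not, apexIm_not]
  congr 1
  apply Complex.ext <;> simp

theorem sideEdge_opp (s : F × Fin 3) (β ω : Bool) :
    G.sideEdge (G.opp s) (!β) (!ω) = G.sideEdge s β ω := by
  cases β <;> cases ω <;> simp [sideEdge, G.opp_opp]

theorem sidePoint_false (s : F × Fin 3) (β : Bool) (t : ℝ) :
    G.sidePoint s β false t = AffineMap.lineMap (G.corner s.1 (G.sideEdge s β false).2)
      (G.center s.1) t := by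
  apply G.coord_injective s
  rw [coord_lineMap, coord_center]
  unfold sidePoint
  cases β
  · have := G.coord_left s
    simp only [sideEdge, Bool.false_eq_true, if_false, this, coord_frame]
    apply Complex.ext <;> simp [endRe, apexIm]
    ring
  · have := G.coord_right s
    simp only [sideEdge, if_true, this, coord_frame]
    apply Complex.ext <;> simp [endRe, apexIm]
    ring

theorem sideEdge_false_fst (s : F × Fin 3) (β : Bool) : (G.sideEdge s β false).1 = s.1 := by
  cases β <;> rfl

theorem sideEdge_true_fst (s : F × Fin 3) (β : Bool) :
    (G.sideEdge s β true).1 = (G.opp s).1 := by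
  cases β <;> rfl

section

variable {G} (hH : ∀ s, 0 < G.height s + G.height (G.opp s))
include hH

/-- The abscissa `±(1 - t)` determines `t`, and also the end unless it is zero. The ordinate tells
the circumcenters apart, as `h ≠ -k`. -/
theorem eq_of_sidePoint_eq {s : F × Fin 3} {β ω β' ω' : Bool} {t t' : ℝ} (ht : t ≤ 1)
    (ht' : t' ≤ 1) (h : G.sidePoint s β ω t = G.sidePoint s β' ω' t') :
    t = t' ∧ (t ≠ 1 → β = β') ∧ (t ≠ 0 → ω = ω') := by
  have h1 := congrArg (G.coord s) h
  unfold sidePoint at h1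
  rw [coord_frame, coord_frame] at h1
  obtain ⟨hre, him⟩ := Complex.mk.inj h1
  have htt : t = t' := by
    cases β <;> cases β' <;> simp only [endRe, if_true, if_false, Bool.false_eq_true] at hre <;>
      linarith
  subst htt
  refine ⟨rfl, fun hne => ?_, fun hne => ?_⟩
  · have h0 : 1 - t ≠ 0 := fun h0 => hne (by linarith)
    have h2 := mul_right_cancel₀ h0 hre
    cases β <;> cases β' <;> simp only [endRe, if_true, if_false, Bool.false_eq_true] at h2 ⊢ <;>
      linarith
  · have h2 := mul_right_cancel₀ hne him
    have := hH s
    cases ω <;> cases ω' <;> simp only [apexIm, if_true, if_false, Bool.false_eq_true] at h2 ⊢ <;>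
      linarith

end

theorem sidePoint_notMem_openKite {s : F × Fin 3} {β ω : Bool} {t : ℝ} (ht : t ≤ 1) :
    G.sidePoint s β ω t ∉ G.openKite s := by
  intro h
  unfold sidePoint openKite IsInOpenKite at h
  simp only [mem_ofPred_eq, coord_frame] at h
  obtain ⟨-, h2, h3⟩ := h
  have habs : |endRe β * (1 - t)| = 1 - t := by
    rw [abs_mul, abs_of_nonneg (show 0 ≤ 1 - t by linarith)]
    cases β <;> simp [endRe]
  rw [habs] at h2 h3
  cases ω <;> simp only [apexIm, if_true, if_false, Bool.false_eq_true] at h2 h3 <;> linarith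

theorem pow_sidePoint_false_neg {s : F × Fin 3} {β : Bool} {t : ℝ} (h0 : 0 < t) (h1 : t ≤ 1) :
    G.pow s.1 (G.sidePoint s β false t) < 0 := by
  rw [pow_neg_iff]
  unfold sidePoint
  rw [coord_frame]
  have : endRe β ^ 2 = 1 := by cases β <;> simp [endRe]
  simp only [apexIm, Bool.false_eq_true, if_false]
  rw [mul_pow, this]
  nlinarith [mul_nonneg (sq_nonneg (G.height s)) (mul_nonneg h0.le (by linarith : 0 ≤ 2 - t))]

theorem sidePoint_mem_twoDisks {s : F × Fin 3} {β ω : Bool} {t : ℝ} (h0 : 0 < t) (h1 : t ≤ 1) :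
    G.sidePoint s β ω t ∈ G.twoDisks s := by
  cases ω
  · exact Or.inl (G.pow_sidePoint_false_neg h0 h1)
  · right
    rw [transfer_sidePoint]
    exact G.pow_sidePoint_false_neg h0 h1

theorem mem_kite_cases {s : F × Fin 3} {z : ℂ} (hz : z ∈ G.kite s) :
    z ∈ G.openKite s ∨ ∃ β ω, ∃ t ∈ Icc (0 : ℝ) 1, z = G.sidePoint s β ω t := by
  by_cases hopen : z ∈ G.openKite s
  · exact Or.inl hopen
  right
  obtain ⟨h1, h2, h3⟩ := hz
  have habs : ∃ β, (G.coord s z).re = endRe β * |(G.coord s z).re| := by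
    rcases le_total 0 (G.coord s z).re with h | h
    · exact ⟨true, by simp [endRe, abs_of_nonneg h]⟩
    · exact ⟨false, by simp [endRe, abs_of_nonpos h]⟩
  obtain ⟨β, hβ⟩ := habs
  have key : ∃ ω, (G.coord s z).im = G.apexIm s ω * (1 - |(G.coord s z).re|) := by
    rcases h3.eq_or_lt with h3' | h3'
    · exact ⟨false, by simpa [apexIm] using h3'⟩
    · rcases h2.eq_or_lt with h2' | h2'
      · exact ⟨true, by simpa [apexIm] using h2'.symm⟩
      · exfalso
        refine hopen ⟨lt_of_le_of_ne h1 fun he => ?_, h2', h3'⟩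
        rw [he, sub_self, mul_zero] at h2' h3'
        linarith
  obtain ⟨ω, hω⟩ := key
  refine ⟨β, ω, 1 - |(G.coord s z).re|, ⟨by linarith, by linarith [abs_nonneg (G.coord s z).re]⟩,
    G.coord_injective s ?_⟩
  unfold sidePoint
  rw [coord_frame]
  apply Complex.ext
  · rw [sub_sub_cancel, ← hβ]
  · rw [← hω]

theorem orient_left_center (s : F × Fin 3) (z : ℂ) :
    orient (G.corner s.1 s.2) (G.center s.1) z = Complex.normSq (G.half s) *
      ((G.coord s z).im - G.height s * (1 + (G.coord s z).re)) := by
  have h1 := orient_affine (G.mid s) (G.half s) (-1) (G.height s * Complex.I) (G.coord s z)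
  change orient (G.frame s (-1)) (G.frame s (G.height s * Complex.I))
    (G.frame s (G.coord s z)) = _ at h1
  rw [frame_neg_one, ← center_eq_frame, frame_coord] at h1
  rw [h1]
  congr 1
  simp only [orient, Complex.sub_re, Complex.sub_im, Complex.neg_re, Complex.neg_im,
    Complex.mul_re, Complex.mul_im, Complex.ofReal_re, Complex.ofReal_im, Complex.I_re,
    Complex.I_im, Complex.one_re, Complex.one_im]
  ring

theorem orient_right_center (s : F × Fin 3) (z : ℂ) :
    orient (G.corner s.1 (s.2 + 1)) (G.center s.1) z = Complex.normSq (G.half s) *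
      (G.height s * (1 - (G.coord s z).re) - (G.coord s z).im) := by
  have h1 := orient_affine (G.mid s) (G.half s) 1 (G.height s * Complex.I) (G.coord s z)
  change orient (G.frame s 1) (G.frame s (G.height s * Complex.I))
    (G.frame s (G.coord s z)) = _ at h1
  rw [frame_one, ← center_eq_frame, frame_coord] at h1
  rw [h1]
  congr 1
  simp only [orient, Complex.sub_re, Complex.sub_im, Complex.mul_re, Complex.mul_im,
    Complex.ofReal_re, Complex.ofReal_im, Complex.I_re, Complex.I_im, Complex.one_re,
    Complex.one_im]
  ring

/-- Each term is the inner product of `z - center` with half of a side vector, and these vectors add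
up to zero. So the three abscissae cannot all have the same strict sign. -/
theorem sum_normSq_mul_re (f : F) (z : ℂ) :
    ∑ i : Fin 3, Complex.normSq (G.half (f, i)) * (G.coord (f, i) z).re = 0 := by
  have h : ∀ i : Fin 3, Complex.normSq (G.half (f, i)) * (G.coord (f, i) z).re =
      ((z - G.center f) * (starRingEnd ℂ) (G.half (f, i))).re := by
    intro i
    have hn := G.half_ne_zero (f, i)
    have e : G.coord (f, i) z = G.height (f, i) * Complex.I +
        (z - G.center f) / G.half (f, i) := by
      rw [← G.coord_center (f, i)]
      unfold coord
      field_simp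
      ring
    have e2 : (z - G.center f) * (starRingEnd ℂ) (G.half (f, i)) =
        (Complex.normSq (G.half (f, i)) : ℂ) * ((z - G.center f) / G.half (f, i)) := by
      rw [← Complex.mul_conj]
      field_simp
    rw [e2, Complex.re_ofReal_mul, e]
    simp
  simp only [h]
  rw [Fin.sum_univ_three, ← Complex.add_re, ← Complex.add_re, ← mul_add, ← mul_add, ← map_add,
    ← map_add]
  have : G.half (f, 0) + G.half (f, 1) + G.half (f, 2) = 0 := by
    change (G.corner f 1 - G.corner f 0) / 2 + (G.corner f 2 - G.corner f 1) / 2 +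
      (G.corner f 0 - G.corner f 2) / 2 = 0
    ring
  rw [this]
  simp

end Gluing

namespace GeodesicTriangulation

variable {S : Type*} [MetricSpace S] {F : Type*} {T : GeodesicTriangulation S F}
variable (hH : ∀ s, 0 < T.height s + T.height (T.opp s)) [Finite F]
include hH

/-- The sides `e.2` and `e.2 + 2` of the face meet at the corner `e.2`, and their kites lie on
opposite sides of this circumradius. The other inequalities of both kites are strict nearby
(`near`), and a generic point is not on the line of the circumradius. -/
theorem covers_circumradius (e : F × Fin 3) {t : ℝ} (h0 : 0 < t) (h1 : t < 1) :
    T.Covers {(e, T.sidePoint e false false t),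
      ((e.1, e.2 + 2), T.sidePoint (e.1, e.2 + 2) true false t)}
      (T.dev e.1 (T.sidePoint e false false t)) := by
  have hpow := T.pow_sidePoint_false_neg (s := e) (β := false) h0 h1.le
  have h3 : ∀ j : Fin 3, j + 2 + 1 = j := by decide
  have hpt : T.sidePoint (e.1, e.2 + 2) true false t = T.sidePoint e false false t := by
    rw [T.sidePoint_false, T.sidePoint_false]
    simp [Gluing.sideEdge, h3]
  have c1 : ∀ s, Continuous fun z => (T.coord s z).re := fun s =>
    Complex.continuous_re.comp (T.continuous_coord s)
  have c2 : ∀ s, Continuous fun z => (T.coord s z).im := fun s =>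
    Complex.continuous_im.comp (T.continuous_coord s)
  have near : ∀ s β, ∀ᶠ z in 𝓝 (T.sidePoint s β false t), |(T.coord s z).re| < 1 ∧
      -T.height (T.opp s) * (1 - |(T.coord s z).re|) < (T.coord s z).im ∧
      (T.coord s z).re = Gluing.endRe β * |(T.coord s z).re| := by
    intro s β
    have k1 := c1 s
    have k2 := c2 s
    have habs : |Gluing.endRe β * (1 - t)| = 1 - t := by
      rw [abs_mul, abs_of_pos (show 0 < 1 - t by linarith)]
      cases β <;> simp [Gluing.endRe]
    have hs := hH s
    refine Filter.Eventually.and ?_ (Filter.Eventually.and ?_ ?_)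
    · refine (k1.abs.continuousAt).eventually_lt_const ?_
      simp only [Gluing.sidePoint, T.coord_frame, habs]
      linarith
    · refine Filter.Tendsto.eventually_lt (f := fun z =>
        -T.height (T.opp s) * (1 - |(T.coord s z).re|)) (g := fun z => (T.coord s z).im)
        (Continuous.continuousAt (by fun_prop)) (Continuous.continuousAt (by fun_prop)) ?_
      simp only [Gluing.sidePoint, T.coord_frame, habs, Gluing.apexIm, Bool.false_eq_true, if_false]
      nlinarith
    · have hpos : 0 < Gluing.endRe β * (T.coord s (T.sidePoint s β false t)).re := by
        simp only [Gluing.sidePoint, T.coord_frame]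
        cases β <;> simp [Gluing.endRe] <;> linarith
      have : Continuous fun z => Gluing.endRe β * (T.coord s z).re := by fun_prop
      filter_upwards [this.continuousAt.eventually_const_lt hpos] with z hz
      cases β
      · simp only [Gluing.endRe, Bool.false_eq_true, if_false] at hz ⊢
        rw [abs_of_neg (by linarith)]; ring
      · simp only [Gluing.endRe, if_true] at hz ⊢
        rw [abs_of_pos (by linarith)]; ring
  refine covers_of_eventually (flatAt_dev hH hpow) ?_
  have n2 := near (e.1, e.2 + 2) true
  rw [hpt] at n2
  filter_upwards [near e false, n2, (T.isOpen_disk e.1).mem_nhds hpow] with z ha hb hz hgen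
  obtain ⟨a1, a2, a3⟩ := ha
  obtain ⟨b1, b2, b3⟩ := hb
  have hne := T.orient_center_ne_zero (hgen.2 e z hz rfl)
  simp only [Gluing.endRe, Bool.false_eq_true, if_false, if_true, one_mul, neg_mul] at a3 b3
  rcases lt_or_gt_of_ne hne with hlt | hgt
  · refine ⟨_, Or.inl rfl, rfl, ⟨a1, a2, ?_⟩, kiteDev_of_left hH hz⟩
    dsimp only
    rw [T.orient_left_center, mul_neg_iff] at hlt
    have := (T.normSq_half_pos e)
    rcases hlt with ⟨-, h⟩ | ⟨h, -⟩
    · have : |(T.coord e z).re| = -(T.coord e z).re := by linarith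
      rw [this]; linarith
    · linarith
  · refine ⟨_, Or.inr rfl, hpt, ⟨b1, b2, ?_⟩, kiteDev_of_left hH hz⟩
    dsimp only
    have e1 := T.orient_right_center (e.1, e.2 + 2) z
    dsimp only at e1
    rw [h3] at e1
    rw [e1, mul_pos_iff_of_pos_left (T.normSq_half_pos _)] at hgt
    rw [← b3]; linarith

/-- Suppose that a generic point near the center is in none of the three kites. Then the sign of
each abscissa constrains the position of the point relative to the adjacent circumradii, and going
around the center all three abscissae get the same sign, contrary to `sum_normSq_mul_re`. -/
theorem covers_center (f : F) :
    T.Covers (range fun i : Fin 3 => ((f, i), T.center f)) (T.dev f (T.center f)) := by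
  have hpow : T.pow f (T.center f) < 0 := by
    have := T.normSq_corner_pos f
    unfold Gluing.pow
    simp only [sub_self, map_zero, zero_sub]
    linarith
  refine covers_of_eventually (flatAt_dev hH hpow) ?_
  have near : ∀ᶠ z in 𝓝 (T.center f), ∀ i : Fin 3, |(T.coord (f, i) z).re| < 1 ∧
      -T.height (T.opp (f, i)) * (1 - |(T.coord (f, i) z).re|) < (T.coord (f, i) z).im := by
    rw [Filter.eventually_all]
    intro i
    have k1 : Continuous fun z => (T.coord (f, i) z).re :=
      Complex.continuous_re.comp (T.continuous_coord (f, i))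
    have k2 : Continuous fun z => (T.coord (f, i) z).im :=
      Complex.continuous_im.comp (T.continuous_coord (f, i))
    have hc := T.coord_center (f, i)
    dsimp only at hc
    refine Filter.Eventually.and ?_ ?_
    · refine (k1.abs.continuousAt).eventually_lt_const ?_
      simp [hc]
    · refine Filter.Tendsto.eventually_lt (f := fun z =>
        -T.height (T.opp (f, i)) * (1 - |(T.coord (f, i) z).re|))
        (g := fun z => (T.coord (f, i) z).im)
        (Continuous.continuousAt (by fun_prop)) (Continuous.continuousAt (by fun_prop)) ?_
      have := hH (f, i)
      simp [hc]
      linarith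
  filter_upwards [near, (T.isOpen_disk f).mem_nhds hpow] with z hn hz hgen
  have hgp : ∀ i, InGeneralPosition (T.height (f, i)) (T.height (T.opp (f, i)))
      (T.coord (f, i) z) := fun i => hgen.2 (f, i) z hz rfl
  suffices h : ∃ i, z ∈ T.openKite (f, i) by
    obtain ⟨i, hi⟩ := h
    exact ⟨_, mem_range_self i, rfl, hi, kiteDev_of_left hH (s := (f, i)) hz⟩
  by_contra! hno
  have hP : ∀ i, orient (T.corner f i) (T.center f) z ≠ 0 := fun i =>
    T.orient_center_ne_zero (hgp i)
  have hpos : ∀ i, 0 < (T.coord (f, i) z).re →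
      orient (T.corner f (i + 1)) (T.center f) z < 0 := by
    intro i hi
    refine lt_of_le_of_ne ?_ (hP (i + 1))
    by_contra! h
    refine hno i ⟨(hn i).1, (hn i).2, ?_⟩
    rw [abs_of_pos hi]
    have e := T.orient_right_center (f, i) z
    dsimp only at e
    rw [e, mul_pos_iff_of_pos_left (T.normSq_half_pos _)] at h
    linarith
  have hneg : ∀ i, (T.coord (f, i) z).re < 0 → 0 < orient (T.corner f i) (T.center f) z := by
    intro i hi
    refine lt_of_le_of_ne ?_ (hP i).symm
    by_contra! h
    refine hno i ⟨(hn i).1, (hn i).2, ?_⟩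
    rw [abs_of_neg hi]
    have e := T.orient_left_center (f, i) z
    dsimp only at e
    rw [e, mul_neg_iff] at h
    have := T.normSq_half_pos (f, i)
    rcases h with ⟨-, h⟩ | ⟨h, -⟩ <;> linarith
  have hre : ∀ i, 0 < (T.coord (f, i) z).re ∨ (T.coord (f, i) z).re < 0 := fun i =>
    lt_or_gt_of_ne (hgp i).1.symm
  have hsum := T.sum_normSq_mul_re f z
  rw [Fin.sum_univ_three] at hsum
  have step1 : ∀ i, orient (T.corner f i) (T.center f) z < 0 →
      0 < (T.coord (f, i) z).re ∧ orient (T.corner f (i + 1)) (T.center f) z < 0 := by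
    intro i hi
    have : 0 < (T.coord (f, i) z).re := (hre i).resolve_right fun h => by
      linarith [hneg i h]
    exact ⟨this, hpos i this⟩
  have n0 := T.normSq_half_pos (f, 0)
  have n1 := T.normSq_half_pos (f, 1)
  have n2 := T.normSq_half_pos (f, 2)
  have fin : ∀ i j : Fin 3, j = i ∨ j = i + 1 ∨ j = i + 1 + 1 := by decide
  by_cases hex : ∃ i, orient (T.corner f i) (T.center f) z < 0
  · obtain ⟨i, hi⟩ := hex
    have hall : ∀ j, 0 < (T.coord (f, j) z).re := by
      intro j
      have s1 := step1 i hi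
      have s2 := step1 _ s1.2
      have s3 := step1 _ s2.2
      rcases fin i j with rfl | rfl | rfl
      exacts [s1.1, s2.1, s3.1]
    have m0 := mul_pos n0 (hall 0)
    have m1 := mul_pos n1 (hall 1)
    have m2 := mul_pos n2 (hall 2)
    linarith
  · push Not at hex
    have hall : ∀ j, (T.coord (f, j) z).re < 0 := fun j =>
      (hre j).resolve_left fun h => by linarith [hpos j h, hex (j + 1)]
    have m0 := mul_neg_of_pos_of_neg n0 (hall 0)
    have m1 := mul_neg_of_pos_of_neg n1 (hall 1)
    have m2 := mul_neg_of_pos_of_neg n2 (hall 2)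
    linarith

/-- A point of a half-open circumradius is covered by the kites with this side. -/
theorem exists_covers_circumradius (e : F × Fin 3) {t : ℝ} (h0 : 0 < t) (h1 : t ≤ 1) :
    ∃ A : Set ((F × Fin 3) × ℂ), A.Finite ∧
      T.Covers A (T.dev e.1 (AffineMap.lineMap (T.corner e.1 e.2) (T.center e.1) t)) ∧
      ∀ a ∈ A, ∃ β, a.2 = T.sidePoint a.1 β false t ∧ a.1.1 = e.1 ∧
        (t ≠ 1 → T.sideEdge a.1 β false = e) := by
  have h3 : ∀ j : Fin 3, j + 2 + 1 = j := by decide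
  rcases h1.lt_or_eq with h1 | rfl
  · have hc := covers_circumradius hH e h0 h1
    rw [T.sidePoint_false e false] at hc
    refine ⟨_, ?_, hc, ?_⟩
    · exact (Set.finite_singleton _).insert _
    · rintro a (rfl | rfl)
      · exact ⟨false, (T.sidePoint_false e false t).symm, rfl, fun _ => rfl⟩
      · exact ⟨true, rfl, rfl, fun _ => by simp [Gluing.sideEdge, h3]⟩
  · rw [AffineMap.lineMap_apply_one]
    refine ⟨_, Set.finite_range _, covers_center hH e.1, ?_⟩
    rintro _ ⟨i, rfl⟩
    exact ⟨false, by rw [T.sidePoint_false, AffineMap.lineMap_apply_one], rfl,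
      fun h => absurd rfl h⟩

/-- By `Covers.exists_eq` both points have the same position in a common kite, up to transfer. All
kites are chosen on the face of their circumradius, so the transferred alternative would identify
the two circumcenters of one kite. -/
theorem circumradius_eq_circumradius {e e' : F × Fin 3} {t t' : ℝ} (h0 : 0 < t) (h1 : t ≤ 1)
    (h0' : 0 < t') (h1' : t' ≤ 1)
    (h : T.dev e.1 (AffineMap.lineMap (T.corner e.1 e.2) (T.center e.1) t) =
      T.dev e'.1 (AffineMap.lineMap (T.corner e'.1 e'.2) (T.center e'.1) t')) :
    t = t' ∧ e.1 = e'.1 ∧ (t ≠ 1 → e = e') := by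
  obtain ⟨A, hA, hAc, hA'⟩ := exists_covers_circumradius hH e h0 h1
  obtain ⟨B, hB, hBc, hB'⟩ := exists_covers_circumradius hH e' h0' h1'
  rw [← h] at hBc
  obtain ⟨⟨s, z⟩, ha, ⟨s', z'⟩, hb, hab⟩ := Covers.exists_eq hH hA hB hAc hBc
  obtain ⟨β, hz, hf, hedge⟩ := hA' _ ha
  obtain ⟨β', hz', hf', hedge'⟩ := hB' _ hb
  dsimp only at hz hf hedge hz' hf' hedge' hab
  rcases hab with ⟨rfl, rfl⟩ | ⟨rfl, rfl⟩
  · rw [hz] at hz'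
    obtain ⟨rfl, h2, -⟩ := Gluing.eq_of_sidePoint_eq hH h1 h1' hz'
    refine ⟨rfl, hf.symm.trans hf', fun hne => ?_⟩
    rw [← hedge hne, h2 hne, hedge' hne]
  · rw [hz, T.transfer_sidePoint] at hz'
    obtain ⟨rfl, -, h2⟩ := Gluing.eq_of_sidePoint_eq hH h1 h1' hz'
    exact absurd (h2 h0.ne') (by simp)

theorem circumradius_ne_kiteDev {e s : F × Fin 3} {t : ℝ} {z : ℂ} (h0 : 0 < t) (h1 : t ≤ 1)
    (hz : z ∈ T.openKite s) :
    T.dev e.1 (AffineMap.lineMap (T.corner e.1 e.2) (T.center e.1) t) ≠ T.kiteDev s z := by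
  intro h
  obtain ⟨A, hA, hAc, hA'⟩ := exists_covers_circumradius hH e h0 h1
  have hB := covers_interior hH hz
  rw [← h] at hB
  obtain ⟨⟨s', z'⟩, ha, b, hb, hab⟩ := Covers.exists_eq hH hA (Set.finite_singleton _) hAc hB
  rw [mem_singleton_iff] at hb
  subst hb
  obtain ⟨β, hz', -, -⟩ := hA' _ ha
  dsimp only at hz' hab
  rcases hab with ⟨rfl, rfl⟩ | ⟨rfl, rfl⟩
  · rw [hz'] at hz
    exact T.sidePoint_notMem_openKite h1 hz
  · rw [T.transfer_mem_openKite, hz'] at hz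
    exact T.sidePoint_notMem_openKite h1 hz

theorem kiteDev_eq_kiteDev {s s' : F × Fin 3} {z z' : ℂ} (hz : z ∈ T.openKite s)
    (hz' : z' ∈ T.openKite s') (h : T.kiteDev s z = T.kiteDev s' z') :
    (s' = s ∧ z' = z) ∨ (s' = T.opp s ∧ z' = T.transfer s z) := by
  have hA := covers_interior hH hz
  have hB := covers_interior hH hz'
  rw [← h] at hB
  obtain ⟨a, ha, b, hb, hab⟩ :=
    Covers.exists_eq hH (Set.finite_singleton _) (Set.finite_singleton _) hA hB
  rw [mem_singleton_iff] at ha hb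
  subst ha hb
  exact hab

end GeodesicTriangulation

/-! ### The kite as a planar quadrilateral. -/

namespace Gluing

variable {F : Type*} (G : Gluing F)

/-- The vertices of the kite of a side, starting from an end of the side. -/
noncomputable def kiteVertex (s : F × Fin 3) : Fin 4 → ℂ :=
  ![G.frame s (-1), G.frame s (-(G.height (G.opp s) * Complex.I)), G.frame s 1,
    G.frame s (G.height s * Complex.I)]

theorem mem_triangle_frame_iff {s : F × Fin 3} {p q r : ℂ} (h : 0 < orient p q r) (z : ℂ) :
    z ∈ triangle (G.frame s p) (G.frame s q) (G.frame s r) ↔ 0 ≤ orient p q (G.coord s z) ∧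
      0 ≤ orient q r (G.coord s z) ∧ 0 ≤ orient r p (G.coord s z) := by
  have hn := G.normSq_half_pos s
  have e : ∀ x y w, orient (G.frame s x) (G.frame s y) (G.frame s w) =
      Complex.normSq (G.half s) * orient x y w := fun x y w => orient_affine _ _ _ _ _
  rw [mem_triangle_iff (by rw [e]; positivity)]
  conv_lhs => rw [← G.frame_coord s z]
  simp only [e, mul_nonneg_iff_of_pos_left hn]

section

variable {G} (hH : ∀ s, 0 < G.height s + G.height (G.opp s))
include hH

/-- The diagonal joining the circumcenters is always inner because `h + k > 0`, whatever the signs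
of `h` and `k`. -/
theorem isQuadrilateral_kiteVertex (s : F × Fin 3) : IsQuadrilateral (G.kiteVertex s) := by
  have hn := G.normSq_half_pos s
  have hs := mul_pos hn (hH s)
  have e : ∀ x y w, orient (G.frame s x) (G.frame s y) (G.frame s w) =
      Complex.normSq (G.half s) * orient x y w := fun x y w => orient_affine _ _ _ _ _
  refine Or.inr ⟨?_, ?_⟩
  · change 0 < orient (G.frame s (-(G.height (G.opp s) * Complex.I))) (G.frame s 1)
      (G.frame s (G.height s * Complex.I))
    rw [e]
    simp [orient]
    linarith
  · change 0 < orient (G.frame s (-(G.height (G.opp s) * Complex.I)))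
      (G.frame s (G.height s * Complex.I)) (G.frame s (-1))
    rw [e]
    simp [orient]
    linarith

/-- The cut along the line of centers gives exactly the kite (`hinner`). It remains to see that the
two triangles of the other cut cover it, although one of them may be degenerate or reversed. -/
theorem quadRegion_kiteVertex (s : F × Fin 3) : quadRegion (G.kiteVertex s) = G.kite s := by
  have hs := hH s
  ext z
  set h := G.height s with hh
  set k := G.height (G.opp s) with hk
  have t1 : z ∈ triangle (G.frame s (-(k * Complex.I))) (G.frame s 1)
      (G.frame s (h * Complex.I)) ↔ 0 ≤ (G.coord s z).im + k * (1 - (G.coord s z).re) ∧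
      0 ≤ h * (1 - (G.coord s z).re) - (G.coord s z).im ∧ 0 ≤ (h + k) * (G.coord s z).re := by
    rw [G.mem_triangle_frame_iff (by simp [orient]; linarith)]
    simp [orient]
    constructor <;> rintro ⟨a1, a2, a3⟩ <;> exact ⟨by linarith, by linarith, by linarith⟩
  have t2 : z ∈ triangle (G.frame s (-(k * Complex.I))) (G.frame s (h * Complex.I))
      (G.frame s (-1)) ↔ 0 ≤ -((h + k) * (G.coord s z).re) ∧
      0 ≤ h * (1 + (G.coord s z).re) - (G.coord s z).im ∧
      0 ≤ (G.coord s z).im + k * (1 + (G.coord s z).re) := by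
    rw [G.mem_triangle_frame_iff (by simp [orient]; linarith)]
    simp [orient]
    intro _
    constructor <;> rintro ⟨a1, a2⟩ <;> exact ⟨by linarith, by linarith⟩
  have hinner : z ∈ triangle (G.frame s (-(k * Complex.I))) (G.frame s 1)
        (G.frame s (h * Complex.I)) ∪ triangle (G.frame s (-(k * Complex.I)))
        (G.frame s (h * Complex.I)) (G.frame s (-1)) ↔ z ∈ G.kite s := by
    rw [mem_union, t1, t2]
    unfold kite IsInKite
    rw [mem_ofPred_eq, ← hh, ← hk]
    generalize G.coord s z = ζ
    constructor
    · rintro (⟨a1, a2, a3⟩ | ⟨a1, a2, a3⟩)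
      · have hx : 0 ≤ ζ.re := nonneg_of_mul_nonneg_right a3 hs
        rw [abs_of_nonneg hx]
        have : 0 ≤ 1 - ζ.re := nonneg_of_mul_nonneg_right (by linarith : 0 ≤ (h + k) * _) hs
        exact ⟨by linarith, by linarith, by linarith⟩
      · have hx : 0 ≤ -ζ.re := nonneg_of_mul_nonneg_right (by linarith : 0 ≤ (h + k) * _) hs
        rw [abs_of_nonpos (by linarith)]
        have : 0 ≤ 1 + ζ.re := nonneg_of_mul_nonneg_right (by linarith : 0 ≤ (h + k) * _) hs
        exact ⟨by linarith, by linarith, by linarith⟩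
    · rintro ⟨a1, a2, a3⟩
      rcases le_total 0 ζ.re with hx | hx
      · rw [abs_of_nonneg hx] at a1 a2 a3
        exact Or.inl ⟨by linarith, by linarith, mul_nonneg hs.le hx⟩
      · rw [abs_of_nonpos hx] at a1 a2 a3
        have := mul_nonneg hs.le (neg_nonneg.2 hx)
        exact Or.inr ⟨by linarith, by linarith, by linarith⟩
  change z ∈ _ ∩ (triangle (G.frame s (-(k * Complex.I))) (G.frame s 1)
      (G.frame s (h * Complex.I)) ∪ triangle (G.frame s (-(k * Complex.I)))
      (G.frame s (h * Complex.I)) (G.frame s (-1))) ↔ _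
  rw [mem_inter_iff, hinner, and_iff_right_iff_imp]
  rintro ⟨a1, a2, a3⟩
  change z ∈ triangle (G.frame s (-1)) (G.frame s (-(k * Complex.I))) (G.frame s 1) ∪
    triangle (G.frame s (-1)) (G.frame s 1) (G.frame s (h * Complex.I))
  rw [← hk] at a2
  rw [← hh] at a3
  have hu : 0 ≤ 1 - |(G.coord s z).re| := by linarith
  have b1 := le_abs_self (G.coord s z).re
  have b2 := neg_abs_le (G.coord s z).re
  -- A kite point strictly below the side forces `k > 0`, and one strictly above forces `h > 0`, so
  -- the triangle needed is correctly oriented. On the side itself only convexity is used.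
  rcases lt_trichotomy (G.coord s z).im 0 with hy | hy | hy
  · left
    have hkp : 0 < k := by
      by_contra! hk0
      nlinarith
    rw [G.mem_triangle_frame_iff (by simp [orient]; linarith)]
    simp [orient]
    exact ⟨by nlinarith, by nlinarith, by linarith⟩
  · right
    have hseg : z ∈ segment ℝ (G.frame s (-1)) (G.frame s 1) := by
      refine ⟨(1 - (G.coord s z).re) / 2, (1 + (G.coord s z).re) / 2, by linarith, by linarith,
        by ring, ?_⟩
      conv_rhs => rw [← G.frame_coord s z]
      unfold frame
      apply Complex.ext <;> simp [hy] <;> ring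
    exact segment_subset_convexHull (by simp) (by simp) hseg
  · right
    have hhp : 0 < h := by
      by_contra! hk0
      nlinarith
    rw [G.mem_triangle_frame_iff (by simp [orient]; linarith)]
    simp [orient]
    exact ⟨by linarith, by nlinarith, by nlinarith⟩

omit hH in
-- Small vertical moves in both directions make the two bounds on the ordinate strict, and strict
-- bounds exclude abscissae `±1`.
theorem interior_kite (s : F × Fin 3) : interior (G.kite s) = G.openKite s := by
  refine Subset.antisymm (fun z hz => ?_)
    (interior_maximal (G.openKite_subset_kite s) (G.isOpen_openKite s))
  have hmove : ∀ c : ℝ, ∃ ε > 0, ∀ t, |t| < ε →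
      G.frame s (G.coord s z + (c * t : ℝ) * Complex.I) ∈ G.kite s := by
    intro c
    have hc : Continuous fun t : ℝ => G.frame s (G.coord s z + (c * t : ℝ) * Complex.I) := by
      have := G.continuous_frame s
      fun_prop
    have hev : ∀ᶠ t : ℝ in 𝓝 0,
        G.frame s (G.coord s z + (c * t : ℝ) * Complex.I) ∈ G.kite s := by
      apply hc.continuousAt.eventually_mem
      simp only [mul_zero, Complex.ofReal_zero, zero_mul, add_zero, frame_coord]
      exact mem_interior_iff_mem_nhds.1 hz
    obtain ⟨ε, hε, h⟩ := Metric.eventually_nhds_iff.1 hev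
    exact ⟨ε, hε, fun t ht => h (by rwa [Real.dist_eq, sub_zero])⟩
  obtain ⟨h1, h2, h3⟩ := interior_subset hz
  obtain ⟨ε, hε, hup⟩ := hmove 1
  obtain ⟨ε', hε', hdown⟩ := hmove (-1)
  have u := hup (ε / 2) (by rw [abs_of_pos] <;> linarith)
  have d := hdown (ε' / 2) (by rw [abs_of_pos] <;> linarith)
  unfold kite IsInKite at u d
  simp only [mem_ofPred_eq, coord_frame, Complex.add_re, Complex.add_im, Complex.mul_re,
    Complex.mul_im, Complex.ofReal_re, Complex.ofReal_im, Complex.I_re, Complex.I_im, mul_zero,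
    sub_zero, mul_one, add_zero] at u d
  have h2' : -G.height (G.opp s) * (1 - |(G.coord s z).re|) < (G.coord s z).im := by
    linarith [d.2.1]
  have h3' : (G.coord s z).im < G.height s * (1 - |(G.coord s z).re|) := by
    linarith [u.2.2]
  refine ⟨lt_of_le_of_ne h1 fun he => ?_, h2', h3'⟩
  rw [he, sub_self, mul_zero] at h2' h3'
  linarith

end

theorem isCompact_kite (s : F × Fin 3) : IsCompact (G.kite s) := by
  have hb : IsCompact (G.frame s '' (Icc (-1) 1 ×ℂ Icc (-|G.height (G.opp s)|) |G.height s|)) :=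
    (isCompact_Icc.reProdIm isCompact_Icc).image (G.continuous_frame s)
  refine hb.of_isClosed_subset (G.isClosed_kite s) fun z hz => ⟨G.coord s z, ?_, G.frame_coord s z⟩
  obtain ⟨h1, h2, h3⟩ := hz
  have h0 := abs_nonneg (G.coord s z).re
  have a1 := le_abs_self (G.height s)
  have a2 := neg_abs_le (G.height s)
  have b1 := le_abs_self (G.height (G.opp s))
  rw [Complex.mem_reProdIm]
  refine ⟨abs_le.1 h1, ?_, ?_⟩
  · refine le_trans ?_ h2
    nlinarith [abs_nonneg (G.height (G.opp s))]
  · refine h3.trans ?_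
    nlinarith [abs_nonneg (G.height s)]

end Gluing

/-! ### Maps of the closed kites to the surface. -/

namespace GeodesicTriangulation

variable {S : Type*} [MetricSpace S] {F : Type*} {T : GeodesicTriangulation S F}

open Classical in
/-- The map of the closed kite of a side to the surface. -/
noncomputable def kiteMap (D : (f : F) → T.Circumdisk f) (s : F × Fin 3) (z : ℂ) : S :=
  if 0 ≤ (T.coord s z).im then (D s.1).map z else (D (T.opp s).1).map (T.transfer s z)

variable (D : (f : F) → T.Circumdisk f)

theorem circumradius_zero (f : F) (i : Fin 3) : (D f).circumradius i 0 = T.vertex f i := by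
  rw [Circumdisk.circumradius, AffineMap.lineMap_apply_zero,
    (D f).map_eq_param (T.corner_mem_face f i), vertex]

theorem circumradius_one (f : F) (i : Fin 3) :
    (D f).circumradius i 1 = (D f).circumcenter := by
  rw [Circumdisk.circumradius, AffineMap.lineMap_apply_one, Circumdisk.circumcenter]

theorem vertex_opp (s : F × Fin 3) :
    T.vertex (T.opp s).1 ((T.opp s).2 + 1) = T.vertex s.1 s.2 := by
  have h0 : (T.coord s (T.corner s.1 s.2)).im = 0 := by rw [T.coord_left]; simp
  rw [vertex, vertex, T.param_eq_transfer (T.corner_mem_face _ _) h0, Gluing.transfer,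
    T.coord_left, neg_neg, T.frame_one]

theorem vertex_sideEdge (s : F × Fin 3) (β : Bool) :
    T.vertex (T.sideEdge s β true).1 (T.sideEdge s β true).2 =
      T.vertex (T.sideEdge s β false).1 (T.sideEdge s β false).2 := by
  cases β
  · exact vertex_opp s
  · have := vertex_opp (T := T) (T.opp s)
    rw [T.opp_opp] at this
    exact this.symm

theorem im_sidePoint_zero (s : F × Fin 3) (β ω : Bool) :
    (T.coord s (T.sidePoint s β ω 0)).im = 0 := by
  simp [Gluing.sidePoint]

theorem kiteMap_sidePoint_zero (s : F × Fin 3) (β ω : Bool) :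
    kiteMap D s (T.sidePoint s β ω 0) =
      T.vertex (T.sideEdge s β false).1 (T.sideEdge s β false).2 := by
  rw [kiteMap, if_pos (im_sidePoint_zero s β ω).ge]
  have : T.sidePoint s β ω 0 = T.corner s.1 (T.sideEdge s β false).2 := by
    have h := T.sidePoint_false s β 0
    rw [AffineMap.lineMap_apply_zero] at h
    rw [← h]
    simp [Gluing.sidePoint]
  rw [this, (D s.1).map_eq_param (T.corner_mem_face _ _), vertex, T.sideEdge_false_fst]

variable (hH : ∀ s, 0 < T.height s + T.height (T.opp s)) [Finite F]
include hH

theorem circumradius_eq_dev (e : F × Fin 3) {t : ℝ} (h0 : 0 < t) (h1 : t ≤ 1) :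
    (D e.1).circumradius e.2 t =
      T.dev e.1 (AffineMap.lineMap (T.corner e.1 e.2) (T.center e.1) t) := by
  have hpow := T.pow_sidePoint_false_neg (s := e) (β := false) h0 h1
  rw [T.sidePoint_false] at hpow
  change T.pow e.1 (AffineMap.lineMap (T.corner e.1 e.2) (T.center e.1) t) < 0 at hpow
  rw [Circumdisk.circumradius, (D e.1).center_eq, (D e.1).map_eq_dev hH hpow]

theorem kiteMap_eq_kiteDev {s : F × Fin 3} {z : ℂ} (hz : z ∈ T.twoDisks s) :
    kiteMap D s z = T.kiteDev s z := by
  unfold kiteMap kiteDev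
  split_ifs with h
  · refine (D s.1).map_eq_dev hH (hz.elim id fun h' => ?_)
    have := Gluing.pow_transfer_le hH (s := T.opp s) (z := T.transfer s z)
      (by rw [T.coord_transfer, Complex.neg_im]; linarith)
    rw [T.transfer_transfer, T.opp_opp] at this
    exact this.trans_lt h'
  · exact (D (T.opp s).1).map_eq_dev hH
      (hz.elim (fun h' => (Gluing.pow_transfer_lt hH (not_le.1 h)).trans h') id)

theorem kiteMap_sidePoint (s : F × Fin 3) (β ω : Bool) {t : ℝ} (ht : t ∈ Icc (0 : ℝ) 1) :
    kiteMap D s (T.sidePoint s β ω t) =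
      (D (T.sideEdge s β ω).1).circumradius (T.sideEdge s β ω).2 t := by
  rcases ht.1.eq_or_lt with rfl | h0
  · rw [kiteMap_sidePoint_zero, circumradius_zero]
    cases ω
    · rfl
    · exact (vertex_sideEdge s β).symm
  · have hmem := T.sidePoint_mem_twoDisks (s := s) (β := β) (ω := ω) h0 ht.2
    rw [circumradius_eq_dev D hH _ h0 ht.2, kiteMap_eq_kiteDev D hH hmem]
    cases ω
    · rw [kiteDev_of_left hH (T.pow_sidePoint_false_neg h0 ht.2), T.sidePoint_false,
        T.sideEdge_false_fst]
    · have hpow := T.pow_sidePoint_false_neg (s := T.opp s) (β := !β) h0 ht.2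
      have e1 := T.transfer_sidePoint s β true t
      rw [Bool.not_true] at e1
      rw [← e1] at hpow
      rw [kiteDev_of_right hH hpow, e1, T.sidePoint_false, T.sideEdge_true_fst]
      have e2 := T.sideEdge_opp s β true
      rw [Bool.not_true] at e2
      rw [e2]

omit [Finite F] in
-- The two closed halves of the kite are in the two closed disks, where the disk maps are
-- continuous, and the maps agree on the common side by the gluing. The closed disks are needed for
-- the two ends of the side.
theorem continuousOn_kiteMap (s : F × Fin 3) : ContinuousOn (kiteMap D s) (T.kite s) := by
  have hc : Continuous fun z => (T.coord s z).im :=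
    Complex.continuous_im.comp (T.continuous_coord s)
  have hcases : ∀ z ∈ T.kite s, |(T.coord s z).re| < 1 ∨ ∃ i, z = T.corner s.1 i := by
    intro z hz
    rcases hz.1.lt_or_eq with h | h
    · exact Or.inl h
    · right
      have h2 := hz.2.1
      have h3 := hz.2.2
      rw [h, sub_self, mul_zero] at h2 h3
      have h0 : (T.coord s z).im = 0 := le_antisymm h3 h2
      rcases abs_eq (zero_le_one' ℝ) |>.1 h with h | h
      · refine ⟨s.2 + 1, T.coord_injective s ?_⟩
        rw [T.coord_right]
        exact Complex.ext (by simpa using h) (by simpa using h0)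
      · refine ⟨s.2, T.coord_injective s ?_⟩
        rw [T.coord_left]
        exact Complex.ext (by simpa using h) (by simpa using h0)
  have hleft : ∀ z ∈ T.kite s, 0 ≤ (T.coord s z).im → T.pow s.1 z ≤ 0 := by
    intro z hz h0
    rcases hcases z hz with h | ⟨i, rfl⟩
    · exact (T.pow_neg_of_mem_kite hz h h0).le
    · rw [T.pow_corner]
  have hright : ∀ z ∈ T.kite s, (T.coord s z).im ≤ 0 →
      T.pow (T.opp s).1 (T.transfer s z) ≤ 0 := by
    intro z hz h0
    rcases hcases z hz with h | ⟨i, rfl⟩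
    · exact (T.pow_transfer_neg_of_mem_kite hz h h0).le
    · have := Gluing.pow_transfer_le hH h0
      rwa [T.pow_corner] at this
  have hA : ContinuousOn (kiteMap D s) (T.kite s ∩ {z | 0 ≤ (T.coord s z).im}) := by
    refine ((D s.1).continuousOn_closedDisk.mono fun z hz => hleft z hz.1 hz.2).congr ?_
    intro z hz
    exact if_pos hz.2
  have hB : ContinuousOn (kiteMap D s) (T.kite s ∩ {z | (T.coord s z).im ≤ 0}) := by
    have h1 : ContinuousOn (fun z => (D (T.opp s).1).map (T.transfer s z))
        (T.kite s ∩ {z | (T.coord s z).im ≤ 0}) :=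
      (D (T.opp s).1).continuousOn_closedDisk.comp (T.continuous_transfer s).continuousOn
        fun z hz => hright z hz.1 hz.2
    refine h1.congr ?_
    rintro z ⟨hz, hz0⟩
    rw [mem_ofPred_eq] at hz0
    rcases hz0.lt_or_eq with h | h
    · exact if_neg (not_le.2 h)
    · rw [kiteMap, if_pos h.ge]
      have hsq : (T.coord s z).re ^ 2 ≤ 1 := (sq_le_one_iff_abs_le_one _).2 hz.1
      have hf := T.mem_face_of_im_eq_zero h hsq
      rw [(D s.1).map_eq_param hf, T.param_eq_transfer hf h]
      exact ((D (T.opp s).1).map_eq_param (T.transfer_mem_face hf h)).symm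
  have hunion : T.kite s = (T.kite s ∩ {z | 0 ≤ (T.coord s z).im}) ∪
      (T.kite s ∩ {z | (T.coord s z).im ≤ 0}) := by
    ext z
    simp only [mem_union, mem_inter_iff, mem_ofPred_eq]
    have := le_total 0 (T.coord s z).im
    tauto
  rw [hunion]
  exact hA.union_of_isClosed hB
    ((T.isClosed_kite s).inter (isClosed_le continuous_const hc))
    ((T.isClosed_kite s).inter (isClosed_le hc continuous_const))

theorem kiteMap_openKite {s : F × Fin 3} {z : ℂ} (hz : z ∈ T.openKite s) :
    kiteMap D s z = T.kiteDev s z :=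
  kiteMap_eq_kiteDev D hH (T.openKite_subset_twoDisks s hz)

/-- The images of the closed kites form a compact set that contains the dense set of generic points.
-/
theorem exists_mem_kite (p : S) : ∃ s, ∃ z ∈ T.kite s, kiteMap D s z = p := by
  have hcl : IsClosed (⋃ s, kiteMap D s '' T.kite s) :=
    (isCompact_iUnion fun s => (T.isCompact_kite s).image_of_continuousOn
      (continuousOn_kiteMap D hH s)).isClosed
  have : p ∈ ⋃ s, kiteMap D s '' T.kite s := by
    rw [← hcl.closure_eq, Metric.mem_closure_iff]
    intro ε hε
    obtain ⟨q, hq, hqp⟩ := exists_isGeneric hH p hε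
    obtain ⟨s, z, hz, rfl⟩ := exists_mem_openKite hH hq
    refine ⟨_, mem_iUnion.2 ⟨s, z, T.openKite_subset_kite s hz, kiteMap_openKite D hH hz⟩, ?_⟩
    rwa [dist_comm]
  obtain ⟨s, z, hz, h⟩ := mem_iUnion.1 this
  exact ⟨s, z, hz, h⟩

theorem circumradius_notMem_vertices (e : F × Fin 3) {t : ℝ} (h0 : 0 < t) (h1 : t ≤ 1) :
    (D e.1).circumradius e.2 t ∉ T.vertices := by
  have hpow := T.pow_sidePoint_false_neg (s := e) (β := false) h0 h1
  rw [T.sidePoint_false] at hpow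
  rw [circumradius_eq_dev D hH e h0 h1]
  exact (flatAt_dev hH hpow).not_vertex

/-- The start `t = 0` is a vertex of the triangulation, whereas all other points of a circumradius
are developed from an open disk and so are not vertices. Hence starts meet only starts. -/
theorem circumradius_eq_iff {e e' : F × Fin 3} {t t' : ℝ} (ht : t ∈ Icc (0 : ℝ) 1)
    (ht' : t' ∈ Icc (0 : ℝ) 1)
    (h : (D e.1).circumradius e.2 t = (D e'.1).circumradius e'.2 t') :
    t = t' ∧ (t = 0 → T.vertex e.1 e.2 = T.vertex e'.1 e'.2) ∧ (t ≠ 0 → e.1 = e'.1) ∧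
      (t ≠ 0 → t ≠ 1 → e = e') := by
  rcases ht.1.eq_or_lt with rfl | h0
  · rcases ht'.1.eq_or_lt with rfl | h0'
    · rw [circumradius_zero, circumradius_zero] at h
      exact ⟨rfl, fun _ => h, fun h => absurd rfl h, fun h => absurd rfl h⟩
    · exfalso
      apply circumradius_notMem_vertices D hH e' h0' ht'.2
      rw [← h, circumradius_zero]
      exact ⟨_, _, rfl⟩
  · rcases ht'.1.eq_or_lt with rfl | h0'
    · exfalso
      apply circumradius_notMem_vertices D hH e h0 ht.2
      rw [h, circumradius_zero]
      exact ⟨_, _, rfl⟩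
    · rw [circumradius_eq_dev D hH e h0 ht.2, circumradius_eq_dev D hH e' h0' ht'.2] at h
      obtain ⟨h1, h2, h3⟩ := circumradius_eq_circumradius hH h0 ht.2 h0' ht'.2 h
      exact ⟨h1, fun h => absurd h h0.ne', fun _ => h2, fun _ => h3⟩

theorem circumradius_ne_kiteMap {e s : F × Fin 3} {t : ℝ} (ht : t ∈ Icc (0 : ℝ) 1) {z : ℂ}
    (hz : z ∈ T.openKite s) : (D e.1).circumradius e.2 t ≠ kiteMap D s z := by
  rw [kiteMap_openKite D hH hz]
  rcases ht.1.eq_or_lt with rfl | h0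
  · rw [circumradius_zero]
    intro h
    exact (flatAt_kiteDev hH (T.openKite_subset_twoDisks s hz)).not_vertex ⟨_, _, h⟩
  · rw [circumradius_eq_dev D hH e h0 ht.2]
    exact circumradius_ne_kiteDev hH h0 ht.2 hz

end GeodesicTriangulation

/-! ### Assembling the decomposition. -/

namespace Gluing

variable {F : Type*} (G : Gluing F)

theorem lineMap_kiteVertex (s : F × Fin 3) (β ω : Bool) (t : ℝ) :
    AffineMap.lineMap (G.kiteVertex s (if β then 2 else 0))
      (G.kiteVertex s (if ω then 1 else 3)) t = G.sidePoint s β ω t := by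
  apply G.coord_injective s
  rw [coord_lineMap]
  unfold sidePoint
  cases β <;> cases ω <;> simp only [if_true, if_false, Bool.false_eq_true, kiteVertex,
    Matrix.cons_val, coord_frame] <;> apply Complex.ext <;> simp [endRe, apexIm] <;> ring

theorem sidePoint_mem_kite (hH : ∀ s, 0 < G.height s + G.height (G.opp s)) (s : F × Fin 3)
    (β ω : Bool) {t : ℝ} (ht : t ∈ Icc (0 : ℝ) 1) : G.sidePoint s β ω t ∈ G.kite s := by
  unfold sidePoint kite IsInKite
  simp only [mem_ofPred_eq, coord_frame]
  have habs : |endRe β * (1 - t)| = 1 - t := by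
    rw [abs_mul, abs_of_nonneg (show 0 ≤ 1 - t by linarith [ht.2])]
    cases β <;> simp [endRe]
  have := mul_nonneg (hH s).le ht.1
  rw [habs]
  refine ⟨by linarith [ht.1], ?_, ?_⟩ <;> cases ω <;>
    simp only [apexIm, if_true, if_false, Bool.false_eq_true] <;> linarith

/-- The edges of a gluing: each pair of glued sides has exactly one representative. -/
theorem exists_representatives [Finite F] : ∃ (E : Type) (_ : Finite E) (side : E → F × Fin 3),
    (∀ q q', q ≠ q' → side q' ≠ side q ∧ side q' ≠ G.opp (side q)) ∧
    ∀ s, ∃ q, side q = s ∨ side q = G.opp s := by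
  obtain ⟨n, ⟨e⟩⟩ := Finite.exists_equiv_fin (F × Fin 3)
  refine ⟨{k : Fin n // k < e (G.opp (e.symm k))}, inferInstance, fun k => e.symm k, ?_, ?_⟩
  · rintro ⟨k, hk⟩ ⟨k', hk'⟩ hne
    have hne' : k ≠ k' := fun h => hne (Subtype.ext h)
    refine ⟨fun h => hne' (e.symm.injective h).symm, fun h => ?_⟩
    dsimp only at h
    rw [h, G.opp_opp, e.apply_symm_apply] at hk'
    rw [← h, e.apply_symm_apply] at hk
    exact lt_asymm hk hk'
  · intro s
    rcases lt_trichotomy (e s) (e (G.opp s)) with h | h | h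
    · exact ⟨⟨e s, by rwa [e.symm_apply_apply]⟩, Or.inl (e.symm_apply_apply s)⟩
    · exact absurd (e.injective h).symm (G.opp_ne s)
    · exact ⟨⟨e (G.opp s), by rwa [e.symm_apply_apply, G.opp_opp]⟩,
        Or.inr (e.symm_apply_apply _)⟩

/-- One of the two faces adjacent to a side. -/
def sideFace (s : F × Fin 3) (ω : Bool) : F := if ω then (G.opp s).1 else s.1

theorem sideEdge_fst (s : F × Fin 3) (β ω : Bool) : (G.sideEdge s β ω).1 = G.sideFace s ω := by
  cases β <;> cases ω <;> rfl

end Gluing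

namespace GeodesicTriangulation

variable {S : Type*} [MetricSpace S] {F : Type*} {T : GeodesicTriangulation S F}

variable (T) in
/-- One of the two ends of a side. -/
def sideEnd (s : F × Fin 3) (β : Bool) : S :=
  T.vertex (T.sideEdge s β false).1 (T.sideEdge s β false).2

theorem vertex_sideEdge_eq (s : F × Fin 3) (β ω : Bool) :
    T.vertex (T.sideEdge s β ω).1 (T.sideEdge s β ω).2 = T.sideEnd s β := by
  cases ω
  · rfl
  · exact vertex_sideEdge s β

variable (D : (f : F) → T.Circumdisk f)

theorem circumradius_sideEdge_zero (s : F × Fin 3) (β ω : Bool) :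
    (D (T.sideEdge s β ω).1).circumradius (T.sideEdge s β ω).2 0 = T.sideEnd s β := by
  rw [circumradius_zero, vertex_sideEdge_eq]

theorem circumradius_sideEdge_one (s : F × Fin 3) (β ω : Bool) :
    (D (T.sideEdge s β ω).1).circumradius (T.sideEdge s β ω).2 1 =
      (D (T.sideFace s ω)).circumcenter := by
  rw [circumradius_one, T.sideEdge_fst]

theorem vertices_eq_range : T.vertices = range fun e : F × Fin 3 => T.vertex e.1 e.2 := by
  ext v
  constructor
  · rintro ⟨f, i, rfl⟩
    exact ⟨(f, i), rfl⟩
  · rintro ⟨e, rfl⟩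
    exact ⟨_, _, rfl⟩

theorem continuousOn_circumradius (f : F) (i : Fin 3) :
    ContinuousOn ((D f).circumradius i) (Icc 0 1) := by
  refine (D f).continuousOn_map.comp AffineMap.lineMap_continuous.continuousOn fun t ht => ?_
  have h1 : T.corner f i ∈ closedBall (D f).center (D f).radius := ((D f).dist_corner i).le
  have h2 : (D f).center ∈ closedBall (D f).center (D f).radius := by
    rw [mem_closedBall, dist_self, ← (D f).dist_corner i]
    exact dist_nonneg
  exact (convex_closedBall _ _).lineMap_mem h1 h2 ht

theorem exists_circumradius_eq {x : S} (hx : x ∈ T.vertices ∪ range fun f => (D f).circumcenter) :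
    ∃ e : F × Fin 3, ∃ t, (t = 0 ∨ t = 1) ∧ (D e.1).circumradius e.2 t = x := by
  rcases hx with ⟨f, i, rfl⟩ | ⟨f, rfl⟩
  · exact ⟨(f, i), 0, Or.inl rfl, circumradius_zero D f i⟩
  · exact ⟨(f, 0), 1, Or.inr rfl, circumradius_one D f 0⟩

variable (hH : ∀ s, 0 < T.height s + T.height (T.opp s)) [Finite F]
include hH

theorem isFlatImmersionOn_kiteMap (s : F × Fin 3) :
    T.IsFlatImmersionOn (kiteMap D s) (T.openKite s) := by
  refine isFlatImmersionOn_of_flatAt (T.isOpen_openKite s) fun z hz => ?_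
  refine (flatAt_kiteDev hH (T.openKite_subset_twoDisks s hz)).congr ?_
  filter_upwards [(T.isOpen_openKite s).mem_nhds hz] with y hy
  exact kiteMap_openKite D hH hy

theorem kiteMap_eq_kiteMap {s s' : F × Fin 3} {z z' : ℂ} (hz : z ∈ T.openKite s)
    (hz' : z' ∈ T.openKite s') (h : kiteMap D s z = kiteMap D s' z') :
    (s' = s ∧ z' = z) ∨ s' = T.opp s := by
  rw [kiteMap_openKite D hH hz, kiteMap_openKite D hH hz'] at h
  exact (kiteDev_eq_kiteDev hH hz hz' h).imp id And.left

/-- The decomposition of the surface into kites. -/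
noncomputable def kiteDecomposition {E : Type*} [Finite E] (side : E → F × Fin 3)
    (hne : ∀ q q', q ≠ q' → side q' ≠ side q ∧ side q' ≠ T.opp (side q))
    (hcov : ∀ s, ∃ q, side q = s ∨ side q = T.opp s) :
    QuadDecomposition T (F × Fin 3) E where
  finite_edge := inferInstance
  finite_face := inferInstance
  black := T.vertices
  white := range fun f => (D f).circumcenter
  finite_black := by
    rw [vertices_eq_range]
    exact finite_range _
  finite_white := finite_range _
  disjoint_black_white := by
    rw [disjoint_left]
    rintro x hx ⟨f, rfl⟩
    have := circumradius_notMem_vertices D hH (f, 0) zero_lt_one le_rfl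
    rw [circumradius_one] at this
    exact this hx
  edgeMap e := (D e.1).circumradius e.2
  continuousOn_edgeMap e := continuousOn_circumradius D e.1 e.2
  injOn_edgeMap e t ht t' ht' h := (circumradius_eq_iff D hH ht ht' h).1
  edgeMap_zero e := by
    rw [circumradius_zero]
    exact ⟨_, _, rfl⟩
  edgeMap_one e := by
    rw [circumradius_one]
    exact ⟨_, rfl⟩
  quad q := T.kiteVertex (side q)
  isQuadrilateral q := Gluing.isQuadrilateral_kiteVertex hH _
  faceMap q := kiteMap D (side q)
  continuousOn_faceMap q := by
    rw [Gluing.quadRegion_kiteVertex hH]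
    exact continuousOn_kiteMap D hH _
  injOn_faceMap q := by
    rw [Gluing.quadRegion_kiteVertex hH, Gluing.interior_kite]
    intro z hz z' hz' h
    rcases kiteMap_eq_kiteMap D hH hz hz' h with h | h
    · exact h.2.symm
    · exact absurd h.symm (T.opp_ne _)
  flat_faceMap q := by
    rw [Gluing.quadRegion_kiteVertex hH, Gluing.interior_kite]
    exact isFlatImmersionOn_kiteMap D hH _
  side_eq_edge q k hk l hl := by
    obtain ⟨β, rfl⟩ : ∃ β : Bool, k = if β then 2 else 0 := by
      rcases hk with rfl | rfl
      exacts [⟨false, rfl⟩, ⟨true, rfl⟩]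
    obtain ⟨ω, rfl⟩ : ∃ ω : Bool, l = if ω then 1 else 3 := by
      rcases hl with rfl | rfl
      exacts [⟨true, rfl⟩, ⟨false, rfl⟩]
    refine ⟨T.sideEdge (side q) β ω, fun t ht => ?_⟩
    rw [Gluing.lineMap_kiteVertex, kiteMap_sidePoint D hH _ _ _ ht]
  disjoint_edge_edge e e' hee := by
    rw [disjoint_left]
    rintro _ ⟨t, ht, rfl⟩ ⟨t', ht', h⟩
    obtain ⟨h1, -, -, h2⟩ := circumradius_eq_iff D hH (Ioo_subset_Icc_self ht')
      (Ioo_subset_Icc_self ht) h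
    exact hee (h2 ht'.1.ne' ht'.2.ne).symm
  disjoint_vertex_edge e := by
    rw [disjoint_left]
    rintro x hx ⟨t, ht, h⟩
    obtain ⟨e', t', ht', rfl⟩ := exists_circumradius_eq D hx
    have ht1 : t' ∈ Icc (0 : ℝ) 1 := by rcases ht' with rfl | rfl <;> simp
    have h1 := (circumradius_eq_iff D hH (Ioo_subset_Icc_self ht) ht1 h).1
    subst h1
    rcases ht' with rfl | rfl
    · exact lt_irrefl _ ht.1
    · exact lt_irrefl _ ht.2
  disjoint_face_face q q' hqq := by
    rw [Gluing.quadRegion_kiteVertex hH, Gluing.interior_kite, Gluing.quadRegion_kiteVertex hH,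
      Gluing.interior_kite, disjoint_left]
    rintro _ ⟨z, hz, rfl⟩ ⟨z', hz', h⟩
    rcases kiteMap_eq_kiteMap D hH hz hz' h.symm with h | h
    · exact (hne q q' hqq).1 h.1
    · exact (hne q q' hqq).2 h
  disjoint_vertex_face q := by
    rw [Gluing.quadRegion_kiteVertex hH, Gluing.interior_kite, disjoint_left]
    rintro x hx ⟨z, hz, h⟩
    obtain ⟨e', t', ht', rfl⟩ := exists_circumradius_eq D hx
    have ht1 : t' ∈ Icc (0 : ℝ) 1 := by rcases ht' with rfl | rfl <;> simp
    exact circumradius_ne_kiteMap D hH ht1 hz h.symm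
  disjoint_edge_face e q := by
    rw [Gluing.quadRegion_kiteVertex hH, Gluing.interior_kite, disjoint_left]
    rintro _ ⟨t, ht, rfl⟩ ⟨z, hz, h⟩
    exact circumradius_ne_kiteMap D hH ht hz h.symm
  cover x := by
    obtain ⟨s, z, hz, rfl⟩ := exists_mem_kite D hH x
    rcases T.mem_kite_cases hz with hz | ⟨β, ω, t, ht, rfl⟩
    · obtain ⟨q, h | h⟩ := hcov s
      · refine Or.inr (Or.inr ⟨q, z, ?_, by rw [h]⟩)
        rwa [Gluing.quadRegion_kiteVertex hH, Gluing.interior_kite, h]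
      -- The chosen representative is the opposite side, so the same point is read in the
      -- transferred kite.
      · have hz' : T.transfer s z ∈ T.openKite (T.opp s) := T.transfer_mem_openKite.2 hz
        refine Or.inr (Or.inr ⟨q, T.transfer s z, ?_, ?_⟩)
        · rwa [Gluing.quadRegion_kiteVertex hH, Gluing.interior_kite, h]
        · rw [h, kiteMap_openKite D hH hz', kiteMap_openKite D hH hz,
            kiteDev_opp hH (T.openKite_subset_twoDisks s hz)]
    · rw [kiteMap_sidePoint D hH _ _ _ ht]
      rcases ht.1.eq_or_lt with rfl | h0
      · exact Or.inl (Or.inl (by rw [circumradius_zero]; exact ⟨_, _, rfl⟩))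
      · rcases ht.2.eq_or_lt with rfl | h1
        · exact Or.inl (Or.inr (by rw [circumradius_one]; exact ⟨_, rfl⟩))
        · exact Or.inr (Or.inl ⟨_, t, ⟨h0, h1⟩, rfl⟩)

/-- Common points of two circumradii that are sides of kites. -/
theorem circumradius_sideEdge_eq {s s' : F × Fin 3} {β ω β' ω' : Bool} {t t' : ℝ}
    (ht : t ∈ Icc (0 : ℝ) 1) (ht' : t' ∈ Icc (0 : ℝ) 1)
    (h : (D (T.sideEdge s β ω).1).circumradius (T.sideEdge s β ω).2 t =
      (D (T.sideEdge s' β' ω').1).circumradius (T.sideEdge s' β' ω').2 t') :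
    t = t' ∧ (t ≠ 1 → T.sideEnd s β = T.sideEnd s' β') ∧
      (t ≠ 0 → T.sideFace s ω = T.sideFace s' ω') := by
  obtain ⟨h1, h2, h3, h4⟩ := circumradius_eq_iff D hH ht ht' h
  rw [vertex_sideEdge_eq, vertex_sideEdge_eq] at h2
  rw [T.sideEdge_fst, T.sideEdge_fst] at h3
  refine ⟨h1, fun ht1 => ?_, h3⟩
  by_cases ht0 : t = 0
  · exact h2 ht0
  · rw [← vertex_sideEdge_eq s β ω, h4 ht0 ht1, vertex_sideEdge_eq]

/-- Common points of the images of two kites. -/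
theorem exists_of_mem_inter_kiteMap {s s' : F × Fin 3} (hs : s' ≠ s) (hs' : s' ≠ T.opp s) {p : S}
    (hp : p ∈ kiteMap D s '' T.kite s ∩ kiteMap D s' '' T.kite s') :
    ∃ β ω β' ω', ∃ t ∈ Icc (0 : ℝ) 1,
      (D (T.sideEdge s β ω).1).circumradius (T.sideEdge s β ω).2 t = p ∧
      (t ≠ 1 → T.sideEnd s β = T.sideEnd s' β') ∧
      (t ≠ 0 → T.sideFace s ω = T.sideFace s' ω') := by
  obtain ⟨⟨z, hz, rfl⟩, z', hz', h⟩ := hp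
  rcases T.mem_kite_cases hz with hz | ⟨β, ω, t, ht, rfl⟩
  · rcases T.mem_kite_cases hz' with hz' | ⟨β', ω', t', ht', rfl⟩
    · rcases kiteMap_eq_kiteMap D hH hz hz' h.symm with h | h
      · exact absurd h.1 hs
      · exact absurd h hs'
    · rw [kiteMap_sidePoint D hH _ _ _ ht'] at h
      exact absurd h (circumradius_ne_kiteMap D hH ht' hz)
  · rcases T.mem_kite_cases hz' with hz' | ⟨β', ω', t', ht', rfl⟩
    · rw [kiteMap_sidePoint D hH _ _ _ ht] at h
      exact absurd h.symm (circumradius_ne_kiteMap D hH ht hz')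
    · rw [kiteMap_sidePoint D hH _ _ _ ht, kiteMap_sidePoint D hH _ _ _ ht'] at h
      have := circumradius_sideEdge_eq D hH ht ht' h.symm
      exact ⟨β, ω, β', ω', t, ht, (kiteMap_sidePoint D hH _ _ _ ht).symm, this.2⟩

theorem circumradius_sideEdge_mem (s : F × Fin 3) (β ω : Bool) {t : ℝ} (ht : t ∈ Icc (0 : ℝ) 1) :
    (D (T.sideEdge s β ω).1).circumradius (T.sideEdge s β ω).2 t ∈ kiteMap D s '' T.kite s :=
  ⟨_, T.sidePoint_mem_kite hH s β ω ht, kiteMap_sidePoint D hH _ _ _ ht⟩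

end GeodesicTriangulation

/-! ### Simplicial triangulations: incidence of closed kites. -/

namespace GeodesicTriangulation

variable {S : Type*} [MetricSpace S] {F : Type*} {T : GeodesicTriangulation S F}

namespace IsSimplicial

variable (hT : T.IsSimplicial)
include hT

theorem sideEnd_injective (s : F × Fin 3) : Function.Injective (T.sideEnd s) := by
  have key : T.sideEnd s false ≠ T.sideEnd s true := fun h => by
    have := hT.1 s.1 h
    exact (by decide : ∀ i : Fin 3, i ≠ i + 1) s.2 this
  intro β β' h
  cases β <;> cases β'
  · rfl
  · exact absurd h key
  · exact absurd h.symm key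
  · rfl

/-- Kites sharing both black vertices lie over the same edge, since an edge is determined by its
ends. -/
theorem eq_or_eq_opp {s s' : F × Fin 3} {β γ β' γ' : Bool} (hβ : T.sideEnd s β = T.sideEnd s' β')
    (hγ : T.sideEnd s γ = T.sideEnd s' γ') (hne : β ≠ γ) : s' = s ∨ s' = T.opp s := by
  have hne' : β' ≠ γ' := by
    rintro rfl
    exact hne (hT.sideEnd_injective s (hβ.trans hγ.symm))
  have hpair : ∀ (s : F × Fin 3) {β γ : Bool}, β ≠ γ →
      ({T.vertex s.1 s.2, T.vertex s.1 (s.2 + 1)} : Set S) = {T.sideEnd s β, T.sideEnd s γ} := by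
    intro s β γ h
    cases β <;> cases γ
    · exact absurd rfl h
    · rfl
    · exact pair_comm _ _
    · exact absurd rfl h
  apply hT.2.2
  rw [hpair s hne, hpair s' hne', hβ, hγ]

/-- If a face were glued to itself along the sides `i` and `j`, distinctness of its vertices would
give `j + 1 = i` and `i + 1 = j`, impossible modulo 3. -/
theorem fst_opp_ne (s : F × Fin 3) : (T.opp s).1 ≠ s.1 := by
  intro h
  have h1 : T.vertex s.1 ((T.opp s).2 + 1) = T.vertex s.1 s.2 := by
    rw [← vertex_opp s, h]
  have h2 : T.vertex s.1 (s.2 + 1) = T.vertex s.1 (T.opp s).2 := by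
    have := vertex_opp (T := T) (T.opp s)
    rwa [T.opp_opp, h] at this
  have h3 := hT.1 _ h1
  have h4 := hT.1 _ h2
  exact (by decide : ∀ i j : Fin 3, j + 1 = i → i + 1 ≠ j) _ _ h3 h4

theorem sideFace_injective (s : F × Fin 3) : Function.Injective (T.sideFace s) := by
  intro ω ω' h
  cases ω <;> cases ω'
  · rfl
  · exact absurd h.symm (hT.fst_opp_ne s)
  · exact absurd h (hT.fst_opp_ne s)
  · rfl

/-- Two distinct sides of a face contain all three vertices. Were both glued to the same face, the
vertex sets of the two faces would coincide, hence so would the faces, contrary to `fst_opp_ne`. -/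
theorem eq_of_fst_eq_of_fst_opp_eq {s s' : F × Fin 3} (h : s.1 = s'.1)
    (h' : (T.opp s).1 = (T.opp s').1) : s = s' := by
  by_contra hne
  have hi : s.2 ≠ s'.2 := fun hi => hne (Prod.ext h hi)
  have hsub : ∀ s : F × Fin 3, ∀ i, i = s.2 ∨ i = s.2 + 1 →
      T.vertex s.1 i ∈ range (T.vertex (T.opp s).1) := by
    rintro s i (rfl | rfl)
    · exact ⟨_, vertex_opp s⟩
    · have := vertex_opp (T := T) (T.opp s)
      rw [T.opp_opp] at this
      exact ⟨_, this.symm⟩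
  have hcov : ∀ i j : Fin 3, i ≠ j → ∀ k, (k = i ∨ k = i + 1) ∨ (k = j ∨ k = j + 1) := by decide
  have hle : ∀ s s' : F × Fin 3, s.2 ≠ s'.2 → s.1 = s'.1 → (T.opp s).1 = (T.opp s').1 →
      range (T.vertex s.1) ⊆ range (T.vertex (T.opp s).1) := by
    rintro s s' hi h h' _ ⟨k, rfl⟩
    rcases hcov _ _ hi k with hk | hk
    · exact hsub s k hk
    · rw [h, h']
      exact hsub s' k hk
  have hcard : ∀ f f', range (T.vertex f) ⊆ range (T.vertex f') → f = f' := by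
    intro f f' hff
    apply hT.2.1
    refine (finite_range _).eq_of_subset_of_encard_le hff ?_
    rw [← image_univ, ← image_univ, (hT.1 f).encard_image, (hT.1 f').encard_image]
  exact hT.fst_opp_ne s (hcard _ _ (hle s s' hi h h')).symm

theorem eq_or_eq_opp_of_sideFace {s s' : F × Fin 3} {ω γ ω' γ' : Bool}
    (hω : T.sideFace s ω = T.sideFace s' ω') (hγ : T.sideFace s γ = T.sideFace s' γ')
    (hne : ω ≠ γ) : s' = s ∨ s' = T.opp s := by
  have hne' : ω' ≠ γ' := by
    rintro rfl
    exact hne (hT.sideFace_injective s (hω.trans hγ.symm))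
  cases ω <;> cases γ <;> cases ω' <;> cases γ' <;> first
    | exact absurd rfl hne
    | exact absurd rfl hne'
    | exact Or.inl (hT.eq_of_fst_eq_of_fst_opp_eq hω hγ).symm
    | exact Or.inl (hT.eq_of_fst_eq_of_fst_opp_eq hγ hω).symm
    | skip
  · refine Or.inr (hT.eq_of_fst_eq_of_fst_opp_eq (s := s') (s' := T.opp s) hγ.symm ?_)
    rw [T.opp_opp]
    exact hω.symm
  · refine Or.inr (hT.eq_of_fst_eq_of_fst_opp_eq (s := s') (s' := T.opp s) hω.symm ?_)
    rw [T.opp_opp]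
    exact hγ.symm

/-- In a simplicial complex a circumradius is determined by its face and its black end, because the
corners of a face are distinct vertices. -/
theorem sideEdge_eq {s s' : F × Fin 3} {β ω β' ω' : Bool} (hβ : T.sideEnd s β = T.sideEnd s' β')
    (hω : T.sideFace s ω = T.sideFace s' ω') : T.sideEdge s β ω = T.sideEdge s' β' ω' := by
  rw [← T.sideEdge_fst s β ω, ← T.sideEdge_fst s' β' ω'] at hω
  refine Prod.ext hω (hT.1 (T.sideEdge s β ω).1 ?_)
  rw [vertex_sideEdge_eq, hω, vertex_sideEdge_eq, hβ]

variable (D : (f : F) → T.Circumdisk f)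
variable (hH : ∀ s, 0 < T.height s + T.height (T.opp s)) [Finite F]
include hH

theorem injOn_kiteMap (s : F × Fin 3) : InjOn (kiteMap D s) (T.kite s) := by
  intro z hz z' hz' h
  rcases T.mem_kite_cases hz with hz | ⟨β, ω, t, ht, rfl⟩
  · rcases T.mem_kite_cases hz' with hz' | ⟨β', ω', t', ht', rfl⟩
    · rcases kiteMap_eq_kiteMap D hH hz hz' h with h | h
      · exact h.2.symm
      · exact absurd h.symm (T.opp_ne _)
    · rw [kiteMap_sidePoint D hH _ _ _ ht'] at h
      exact absurd h.symm (circumradius_ne_kiteMap D hH ht' hz)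
  · rcases T.mem_kite_cases hz' with hz' | ⟨β', ω', t', ht', rfl⟩
    · rw [kiteMap_sidePoint D hH _ _ _ ht] at h
      exact absurd h (circumradius_ne_kiteMap D hH ht hz')
    · rw [kiteMap_sidePoint D hH _ _ _ ht, kiteMap_sidePoint D hH _ _ _ ht'] at h
      obtain ⟨rfl, h1, h2⟩ := circumradius_sideEdge_eq D hH ht ht' h
      by_cases ht1 : t = 1
      · subst ht1
        rw [hT.sideFace_injective s (h2 one_ne_zero)]
        simp [Gluing.sidePoint]
      · rw [hT.sideEnd_injective s (h1 ht1)]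
        by_cases ht0 : t = 0
        · subst ht0
          simp [Gluing.sidePoint]
        · rw [hT.sideFace_injective s (h2 ht0)]

/-- Kites over different edges share at most one black vertex (`uniqB`) and at most one white vertex
(`uniqW`). If they share one of each, the circumradius between them is common to both kites; any
common point lies on a circumradius whose ends are subject to the same constraints. -/
theorem inter_kiteMap {s s' : F × Fin 3} (hs : s' ≠ s) (hs' : s' ≠ T.opp s) :
    kiteMap D s '' T.kite s ∩ kiteMap D s' '' T.kite s' = ∅ ∨
    (∃ v ∈ T.vertices ∪ range fun f => (D f).circumcenter,
      kiteMap D s '' T.kite s ∩ kiteMap D s' '' T.kite s' = {v}) ∨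
    ∃ e : F × Fin 3, kiteMap D s '' T.kite s ∩ kiteMap D s' '' T.kite s' =
      (D e.1).circumradius e.2 '' Icc 0 1 := by
  have key := fun p => exists_of_mem_inter_kiteMap D hH hs hs' (p := p)
  have h01 : (0 : ℝ) ∈ Icc (0 : ℝ) 1 := by simp
  have h11 : (1 : ℝ) ∈ Icc (0 : ℝ) 1 := by simp
  have uniqB : ∀ {β γ β' γ'}, T.sideEnd s β = T.sideEnd s' β' →
      T.sideEnd s γ = T.sideEnd s' γ' → β = γ := by
    intro β γ β' γ' h h'
    by_contra hne
    exact (hT.eq_or_eq_opp h h' hne).elim hs hs'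
  have uniqW : ∀ {ω γ ω' γ'}, T.sideFace s ω = T.sideFace s' ω' →
      T.sideFace s γ = T.sideFace s' γ' → ω = γ := by
    intro ω γ ω' γ' h h'
    by_contra hne
    exact (hT.eq_or_eq_opp_of_sideFace h h' hne).elim hs hs'
  by_cases hB : ∃ β β', T.sideEnd s β = T.sideEnd s' β'
  · obtain ⟨β, β', hβ⟩ := hB
    by_cases hW : ∃ ω ω', T.sideFace s ω = T.sideFace s' ω'
    · obtain ⟨ω, ω', hω⟩ := hW
      refine Or.inr (Or.inr ⟨T.sideEdge s β ω, Subset.antisymm (fun p hp => ?_) ?_⟩)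
      · obtain ⟨γ, ε, γ', ε', t, ht, rfl, h1, h2⟩ := key p hp
        refine ⟨t, ht, ?_⟩
        by_cases ht1 : t = 1
        · subst ht1
          rw [uniqW hω (h2 one_ne_zero), circumradius_sideEdge_one, circumradius_sideEdge_one]
        · rw [uniqB hβ (h1 ht1)]
          by_cases ht0 : t = 0
          · subst ht0
            rw [circumradius_sideEdge_zero, circumradius_sideEdge_zero]
          · rw [uniqW hω (h2 ht0)]
      · rintro _ ⟨t, ht, rfl⟩
        refine ⟨circumradius_sideEdge_mem D hH s β ω ht, ?_⟩
        rw [hT.sideEdge_eq hβ hω]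
        exact circumradius_sideEdge_mem D hH s' β' ω' ht
    · refine Or.inr (Or.inl ⟨T.sideEnd s β, Or.inl ⟨_, _, rfl⟩, Subset.antisymm (fun p hp => ?_) ?_⟩)
      · obtain ⟨γ, ε, γ', ε', t, ht, rfl, h1, h2⟩ := key p hp
        obtain rfl : t = 0 := by
          by_contra ht0
          exact hW ⟨_, _, h2 ht0⟩
        rw [mem_singleton_iff, circumradius_sideEdge_zero, uniqB hβ (h1 zero_ne_one)]
      · rintro _ rfl
        constructor
        · rw [← circumradius_sideEdge_zero D s β false]
          exact circumradius_sideEdge_mem D hH s β false h01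
        · rw [hβ, ← circumradius_sideEdge_zero D s' β' false]
          exact circumradius_sideEdge_mem D hH s' β' false h01
  · by_cases hW : ∃ ω ω', T.sideFace s ω = T.sideFace s' ω'
    · obtain ⟨ω, ω', hω⟩ := hW
      refine Or.inr (Or.inl ⟨(D (T.sideFace s ω)).circumcenter, Or.inr ⟨_, rfl⟩,
        Subset.antisymm (fun p hp => ?_) ?_⟩)
      · obtain ⟨γ, ε, γ', ε', t, ht, rfl, h1, h2⟩ := key p hp
        obtain rfl : t = 1 := by
          by_contra ht1
          exact hB ⟨_, _, h1 ht1⟩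
        rw [mem_singleton_iff, circumradius_sideEdge_one, uniqW hω (h2 one_ne_zero)]
      · rintro _ rfl
        constructor
        · rw [← circumradius_sideEdge_one D s false ω]
          exact circumradius_sideEdge_mem D hH s false ω h11
        · rw [hω, ← circumradius_sideEdge_one D s' false ω']
          exact circumradius_sideEdge_mem D hH s' false ω' h11
    · refine Or.inl (eq_empty_of_forall_notMem fun p hp => ?_)
      obtain ⟨γ, ε, γ', ε', t, ht, rfl, h1, h2⟩ := key p hp
      by_cases ht1 : t = 1
      · exact hW ⟨_, _, h2 (by rw [ht1]; exact one_ne_zero)⟩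
      · exact hB ⟨_, _, h1 ht1⟩

theorem isQuadSurface_kiteDecomposition {E : Type*} [Finite E] (side : E → F × Fin 3)
    (hne : ∀ q q', q ≠ q' → side q' ≠ side q ∧ side q' ≠ T.opp (side q))
    (hcov : ∀ s, ∃ q, side q = s ∨ side q = T.opp s) :
    (kiteDecomposition D hH side hne hcov).IsQuadSurface := by
  have e : ∀ q, quadRegion ((kiteDecomposition D hH side hne hcov).quad q) = T.kite (side q) :=
    fun q => Gluing.quadRegion_kiteVertex hH _
  constructor
  · intro q
    rw [e]
    exact hT.injOn_kiteMap D hH _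
  · intro q q' hq
    rw [e, e]
    exact hT.inter_kiteMap D hH (hne q q' hq).1 (hne q q' hq).2

end IsSimplicial

end GeodesicTriangulation

end PolyhedralSurface

theorem mainTheorem10 {S : Type*} [MetricSpace S] {F : Type*} [Finite F]
    (T : PolyhedralSurface.GeodesicTriangulation S F)
    (hDelaunay : T.IsDelaunay) (hD : T.ConditionD) :
    -- each face has an immersed circumscribed disk,
    (∀ f, Nonempty (T.Circumdisk f)) ∧
    ∀ D : (f : F) → T.Circumdisk f,
      -- the circumradii have no common interior points and no self-intersections,
      (∀ f i f' i', ∀ t ∈ Ioo (0 : ℝ) 1, ∀ t' ∈ Ioo (0 : ℝ) 1,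
        (D f).circumradius i t = (D f').circumradius i' t' → f = f' ∧ i = i' ∧ t = t') ∧
      -- and they are the edges of a quad-surface with isometric charts
      ∃ (Face : Type) (Q : PolyhedralSurface.QuadDecomposition T (F × Fin 3) Face),
        Q.black = T.vertices ∧
        Q.white = range (fun f => (D f).circumcenter) ∧
        (∀ f i, ∀ t ∈ Icc (0 : ℝ) 1, Q.edgeMap (f, i) t = (D f).circumradius i t) ∧
        (T.IsSimplicial → Q.IsQuadSurface) := by
  have hH := T.height_add_pos hD
  refine ⟨PolyhedralSurface.GeodesicTriangulation.nonempty_circumdisk hH, fun D => ⟨?_, ?_⟩⟩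
  · intro f i f' i' t ht t' ht' h
    obtain ⟨h1, -, -, h2⟩ := PolyhedralSurface.GeodesicTriangulation.circumradius_eq_iff D hH
      (e := (f, i)) (e' := (f', i')) (Ioo_subset_Icc_self ht) (Ioo_subset_Icc_self ht') h
    obtain ⟨h3, h4⟩ := Prod.mk.inj (h2 ht.1.ne' ht.2.ne)
    exact ⟨h3, h4, h1⟩
  · obtain ⟨E, _, side, hne, hcov⟩ := T.exists_representatives
    exact ⟨E, PolyhedralSurface.GeodesicTriangulation.kiteDecomposition D hH side hne hcov,
      rfl, rfl, fun _ _ _ _ => rfl, fun hT => hT.isQuadSurface_kiteDecomposition D hH _ _ _⟩
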